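/- Let $n\ge 1$ and let $\Omega\subset\mathbb R^n$ be a bounded polygonal (polyhedral) domain: non-empty, open, bounded, connected, with Lipschitz boundary, and with $\overline\Omega$ a union of finitely many $n$-simplices forming a simplicial complex. Let $\partial\Omega=\Gamma_1\cup\Gamma_2$ with $\Gamma_1,\Gamma_2$ disjoint and measurable and $\operatorname{meas}(\Gamma_1)>0$ for the $(n-1)$-dimensional surface measure $ds$. Put $V=H^1(\Omega)$ with $\|v\|_V^2=\int_\Omega v^2\,dx+\int_\Omega|\nabla v|^2\,dx$, $K_+=\{v\in V: v\ge 0 \text{ a.e. in }\Omega\}$ and, for $\alpha>0$ (with traces in the boundary integrals), $$a_\alpha(u,v)=\int_\Omega\nabla u\cdot\nabla v\,dx+\alpha\int_{\Gamma_1}uv\,ds,\qquad \ell_\alpha(v)=\int_\Omega g\,v\,dx-\int_{\Gamma_2}q\,v\,ds+\alpha\int_{\Gamma_1}b\,v\,ds,$$ where $b>0$ is a constant, $q\in L^2(\Gamma_2)$ and $g\in L^2(\Omega)$. Let $(\tau_h)$ be a regular family of triangulations of $\Omega$: each $\tau_h$ is a finite simplicial complex with union $\overline\Omega$ whose maximal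 simplices are $n$-dimensional, and there is $\sigma>0$, independent of $h$, such that every maximal simplex $T$ of every $\tau_h$ contains a ball of diameter at least $\operatorname{diam}(T)/\sigma$. Here $h$ is the longest side of the simplices of $\tau_h$. Put $$V_h=\{v_h\in C^0(\overline\Omega): v_h|_T \text{ is affine for every maximal simplex } T \text{ of } \tau_h\},\qquad K_{+h}=\{v_h\in V_h: v_h\ge 0\text{ in }\Omega\}.$$ Let $1<r\le 2$ with $r>n/2$ (automatic if $n\le 2$), and let $H^r(\Omega)$ be the Sobolev–Slobodeckij space. Let $u_{\alpha g}\in K_+\cap H^r(\Omega)$ satisfy $a_\alpha(u_{\alpha g},v-u_{\alpha g})\ge\ell_\alpha(v-u_{\alpha g})$ for all $v\in K_+$. Then there is a constant $C=C(\alpha)>0$, which may also depend on the fixed data $\Omega,\Gamma_1,\Gamma_2,b,q,g,r$, on $u_{\alpha g}$ and on the family $(\tau_h)$, but not on $h$, such that for every member $\tau_h$ of the family and every $u_{h\alpha g}\in K_{+h}$ with $a_\alpha(u_{h\alpha g},v_h-u_{h\alpha g})\ge\ell_\alpha(v_h-u_{h\alpha g})$ for all $v_h\in K_{+h}$, $$\|u_{h\alpha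 g}-u_{\alpha g}\|_V\le C(\alpha)\,h^{(r-1)/2}.$$ -/

import Mathlib

open MeasureTheory Set Filter Topology
open scoped ContDiff RealInnerProductSpace

noncomputable section

namespace ObstacleFEM

/-- Euclidean space `ℝⁿ`. -/
abbrev Euc (n : ℕ) := EuclideanSpace ℝ (Fin n)

variable {n : ℕ}

/-! ### Sobolev spaces on an open set -/

/-- `G` is the weak gradient of `u` on `Ω`: `∫_Ω u ∂_w φ = - ∫_Ω (G · w) φ` for all test functions
`φ ∈ C_c^∞(Ω)` and all directions `w`. -/
def HasWeakGrad (Ω : Set (Euc n)) (u : Euc n → ℝ) (G : Euc n → Euc n) : Prop :=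
  LocallyIntegrableOn u Ω ∧ LocallyIntegrableOn G Ω ∧
    ∀ φ : Euc n → ℝ, ContDiff ℝ ∞ φ → HasCompactSupport φ → tsupport φ ⊆ Ω →
      ∀ w : Euc n, ∫ x in Ω, u x * fderiv ℝ φ x w = -∫ x in Ω, ⟪G x, w⟫ * φ x

open Classical in
/-- The weak gradient `∇u` on `Ω` (unique up to a.e. equality when it exists; `0` otherwise). -/
def weakGrad (Ω : Set (Euc n)) (u : Euc n → ℝ) : Euc n → Euc n :=
  if h : ∃ G, HasWeakGrad Ω u G then h.choose else 0

/-- The squared Sobolev–Slobodeckij seminorm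
`∫_Ω ∫_Ω |u(x) - u(y)|² / |x - y|^(n + 2 s) dx dy`. -/
def slobodeckij (Ω : Set (Euc n)) (s : ℝ) (u : Euc n → ℝ) : ENNReal :=
  ∫⁻ x in Ω, ∫⁻ y in Ω, ENNReal.ofReal (|u x - u y| ^ 2 / ‖x - y‖ ^ ((n : ℝ) + 2 * s))

/-- `u ∈ H^(m + s)(Ω)` for an integer `m` and `0 ≤ s < 1`: all weak partial derivatives of order at
most `m` exist and lie in `L²(Ω)` and, if `s > 0`, those of order `m` have a finite
Sobolev–Slobodeckij seminorm of order `s`. -/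
def MemSobolev (Ω : Set (Euc n)) (s : ℝ) : ℕ → (Euc n → ℝ) → Prop
  | 0, u => MemLp u 2 (volume.restrict Ω) ∧ (0 < s → slobodeckij Ω s u < ⊤)
  | m + 1, u => MemLp u 2 (volume.restrict Ω) ∧
      ∃ G, HasWeakGrad Ω u G ∧ ∀ i, MemSobolev Ω s m (fun x => G x i)

/-- The Sobolev space `H^r(Ω)` for real `r ≥ 0`. -/
def MemHr (Ω : Set (Euc n)) (r : ℝ) (u : Euc n → ℝ) : Prop :=
  MemSobolev Ω (Int.fract r) ⌊r⌋₊ u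

/-- The space `V = H¹(Ω)`. -/
def MemH1 (Ω : Set (Euc n)) (u : Euc n → ℝ) : Prop := MemSobolev Ω 0 1 u

/-- The norm of `V = H¹(Ω)`: `‖u‖_V² = ∫_Ω u² + ∫_Ω |∇u|²`. -/
def h1Norm (Ω : Set (Euc n)) (u : Euc n → ℝ) : ℝ :=
  √((∫ x in Ω, u x ^ 2) + ∫ x in Ω, ‖weakGrad Ω u x‖ ^ 2)

/-! ### Surface measure and traces -/

/-- The surface measure `ds` on a portion `Γ` of a boundary: the `(n-1)`-dimensional Hausdorff
measure, normalized to agree with Lebesgue measure on hyperplanes (counting measure if `n = 1`). -/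
def surf (Γ : Set (Euc n)) : Measure (Euc n) :=
  (Measure.euclideanHausdorffMeasure (n - 1)).restrict Γ

/-- `γ ∈ L²(∂Ω)` is the trace of `u ∈ H¹(Ω)`: there are `φ_k ∈ C^∞(Ω̄)` with `φ_k → u` in `H¹(Ω)`
and `φ_k → γ` in `L²(∂Ω)`. -/
def IsTrace (Ω : Set (Euc n)) (u γ : Euc n → ℝ) : Prop :=
  MemH1 Ω u ∧ MemLp γ 2 (surf (frontier Ω)) ∧
    ∃ φ : ℕ → Euc n → ℝ, (∀ k, ContDiff ℝ ∞ (φ k)) ∧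
      Tendsto (fun k => h1Norm Ω (φ k - u)) atTop (𝓝 0) ∧
      Tendsto (fun k => eLpNorm (φ k - γ) 2 (surf (frontier Ω))) atTop (𝓝 0)

open Classical in
/-- The trace of `u ∈ H¹(Ω)` on `∂Ω` (on a bounded Lipschitz domain it exists and is unique up to
a.e. equality for the surface measure; `0` if there is none). -/
def trace (Ω : Set (Euc n)) (u : Euc n → ℝ) : Euc n → ℝ :=
  if h : ∃ γ, IsTrace Ω u γ then h.choose else 0

/-! ### The variational inequality -/

/-- `a_α(u, v) = ∫_Ω ∇u · ∇v dx + α ∫_{Γ₁} u v ds`. -/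
def aForm (Ω Γ₁ : Set (Euc n)) (α : ℝ) (u v : Euc n → ℝ) : ℝ :=
  (∫ x in Ω, ⟪weakGrad Ω u x, weakGrad Ω v x⟫) + α * ∫ x, trace Ω u x * trace Ω v x ∂(surf Γ₁)

/-- `(g, v)_H - (q, v)_Q + α (b, v)_R` with `H = L²(Ω)`, `Q = L²(Γ₂)`, `R = L²(Γ₁)` and a constant
`b`. -/
def load (Ω Γ₁ Γ₂ : Set (Euc n)) (α b : ℝ) (q g v : Euc n → ℝ) : ℝ :=
  (∫ x in Ω, g x * v x) - (∫ x, q x * trace Ω v x ∂(surf Γ₂)) + α * ∫ x, b * trace Ω v x ∂(surf Γ₁)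

/-- `u ∈ K` solves the elliptic variational inequality over the set `K ⊆ V`:
`a_α(u, v - u) ≥ (g, v - u)_H - (q, v - u)_Q + α (b, v - u)_R` for all `v ∈ K`. -/
def SolvesVI (Ω Γ₁ Γ₂ : Set (Euc n)) (α b : ℝ) (q g : Euc n → ℝ) (K : Set (Euc n → ℝ))
    (u : Euc n → ℝ) : Prop :=
  u ∈ K ∧ ∀ v ∈ K, load Ω Γ₁ Γ₂ α b q g (v - u) ≤ aForm Ω Γ₁ α u (v - u)

/-- `K₊ = {v ∈ V : v ≥ 0 in Ω}`. -/
def KPlus (Ω : Set (Euc n)) : Set (Euc n → ℝ) :=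
  {v | MemH1 Ω v ∧ ∀ᵐ x ∂(volume.restrict Ω), 0 ≤ v x}

/-! ### Polygonal domains and triangulations -/

/-- `Ω` has a Lipschitz boundary: near each boundary point, in suitable orthonormal coordinates
(with last axis `e`), `Ω` is the strict epigraph of a Lipschitz function. -/
def HasLipschitzBoundary (Ω : Set (Euc n)) : Prop :=
  ∀ x ∈ frontier Ω, ∃ (e : Euc n) (L : NNReal) (ψ : Euc n → ℝ) (ρ : ℝ),
    ‖e‖ = 1 ∧ LipschitzWith L ψ ∧ 0 < ρ ∧
      ∀ y ∈ Metric.ball x ρ, y ∈ Ω ↔ ψ (y - ⟪e, y⟫ • e) < ⟪e, y⟫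

/-- A simplicial complex triangulates `Ω`: it is finite, its union is `Ω̄`, and all its maximal
simplices are `n`-dimensional. (That simplices meet in common faces is part of being a complex.) -/
structure IsTriangulation (Ω : Set (Euc n)) (T : Geometry.SimplicialComplex ℝ (Euc n)) : Prop where
  finite : T.faces.Finite
  space_eq : T.space = closure Ω
  pure : ∀ s ∈ T.facets, s.card = n + 1

/-- Bounded polygonal (polyhedral) domains: bounded, open, connected, non-empty, with Lipschitz
boundary, and with a closure that is triangulated by finitely many simplices. -/
structure IsPolygonalDomain (Ω : Set (Euc n)) : Prop where
  isOpen : IsOpen Ω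
  isConnected : IsConnected Ω
  isBounded : Bornology.IsBounded Ω
  lipschitz : HasLipschitzBoundary Ω
  polygonal : ∃ T, IsTriangulation Ω T

/-- The parameter `h` of a triangulation: the longest side of its simplices. -/
def meshSize (T : Geometry.SimplicialComplex ℝ (Euc n)) : ℝ :=
  sSup {d | ∃ s ∈ T.facets, ∃ x ∈ s, ∃ y ∈ s, d = dist x y}

/-- A regular family of triangulations of `Ω`: there is `σ` such that every simplex `s` of every
member contains a ball of diameter at least `diam s / σ`. -/
def IsRegularFamily {ι : Type*} (Ω : Set (Euc n))
    (τ : ι → Geometry.SimplicialComplex ℝ (Euc n)) : Prop :=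
  (∀ i, IsTriangulation Ω (τ i)) ∧
    ∃ σ : ℝ, 0 < σ ∧ ∀ i, ∀ s ∈ (τ i).facets, ∃ z : Euc n,
      Metric.ball z (Metric.diam (convexHull ℝ (s : Set (Euc n))) / (2 * σ)) ⊆
        convexHull ℝ (s : Set (Euc n))

/-- `V_h`: functions that are continuous on `Ω̄` and affine on each simplex of the triangulation. -/
def Vh (Ω : Set (Euc n)) (T : Geometry.SimplicialComplex ℝ (Euc n)) : Set (Euc n → ℝ) :=
  {v | ContinuousOn v (closure Ω) ∧
    ∀ s ∈ T.facets, ∃ p : Euc n →ᵃ[ℝ] ℝ, EqOn v p (convexHull ℝ (s : Set (Euc n)))}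

/-- `K₊ₕ = {v ∈ V_h : v ≥ 0 in Ω}`. -/
def KPlush (Ω : Set (Euc n)) (T : Geometry.SimplicialComplex ℝ (Euc n)) : Set (Euc n → ℝ) :=
  {v | v ∈ Vh Ω T ∧ ∀ x ∈ Ω, 0 ≤ v x}

end ObstacleFEM

end

/-!
The error estimate combines three facts. The discrete cone is contained in the continuous one, so
testing each variational inequality with the solution of the other problem or an approximation of it
gives Falk's estimate `‖u_h - u‖² ≤ C ‖v_h - u‖` for every `v_h` in the discrete cone
(`IsPolygonalDomain.exists_error_le`). The distance of `u` to the discrete cone is `O(h^(r - 1))`,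
by interpolation at the vertices (`OscRegular.exists_interpolation_error`). The right-hand side of
Falk's estimate is linear in that distance, which leaves the rate `(r - 1) / 2`.

The bilinear form is coercive because the gradient and the trace on a boundary part of positive area
control the `H¹` norm (`exists_energy_le_of_trace`). This rests on the Poincaré–Wirtinger inequality,
obtained from the Poincaré inequality on the simplices of a triangulation by chaining simplices
that meet inside the domain (`linked_self_of_tiling`), and on trace theory: on a bounded Lipschitz
domain smooth functions are dense in `H¹`, by mollification into cones (`smoothLimit_of_hasH1Grad`),
and the trace inequality for smooth functions (`exists_trace_le`) gives existence and uniqueness of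
traces (`exists_isTrace`, `IsTrace.ae_unique`).

For the interpolation error the space `H^r` enters only through a bound for the oscillation of the
gradient over convex sets of diameter `d` by `d^(n + 2 (r - 1))` times a finite measure of the set
(`OscRegular`, `exists_oscRegular`). Since `r > n / 2`, the affine functions with the mean value and
mean gradient of `u` on homothetic copies of a convex set shrinking to a point `p` of its closure
converge at `p` (`OscRegular.exists_tendsto_affApprox`), and the cone condition shows that the limit
does not depend on the convex set (`exists_cone_join`, `OscRegular.tendsto_affApprox_sub`). These
limits are the nodal values that are interpolated (`OscRegular.exists_pointValues`). The error on a
simplex is then controlled by the measure of that simplex, and the errors add up. The limits are also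
limits of mean values of `u`, so the interpolant of a non-negative function is non-negative. That
finite element functions belong to `H¹` follows from their Lipschitz continuity
(`IsTriangulation.exists_hasH1Grad`).
-/

open scoped ENNReal NNReal

noncomputable section

namespace ObstacleFEM

variable {n : ℕ}

/-! ### Square integrals -/

/-- The squared `L²` norm `∫ |f|² dμ`, as an extended nonnegative real. -/
def lsq {X F : Type*} [MeasurableSpace X] [NormedAddCommGroup F] (μ : Measure X) (f : X → F) :
    ℝ≥0∞ :=
  ∫⁻ x, ‖f x‖ₑ ^ 2 ∂μ

section lsq

variable {X F : Type*} [MeasurableSpace X] [NormedAddCommGroup F] {μ ν : Measure X} {f g : X → F}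

lemma lsq_eq_eLpNorm_sq (μ : Measure X) (f : X → F) : lsq μ f = eLpNorm f 2 μ ^ 2 := by
  have := eLpNorm_nnreal_pow_eq_lintegral (μ := μ) (f := f) (p := 2) (by norm_num)
  simp only [lsq]
  norm_cast at this ⊢
  rw [← ENNReal.rpow_natCast (eLpNorm f _ μ)]
  simpa using this.symm

lemma lsq_lt_top (hf : MemLp f 2 μ) : lsq μ f < ⊤ := by
  rw [lsq_eq_eLpNorm_sq]
  exact ENNReal.pow_lt_top hf.2

lemma memLp_of_lsq_lt_top (hf : AEStronglyMeasurable f μ) (h : lsq μ f < ⊤) : MemLp f 2 μ := by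
  refine ⟨hf, ?_⟩
  rw [lsq_eq_eLpNorm_sq] at h
  contrapose! h
  simp [top_le_iff.1 h]

lemma lsq_mono_measure (h : μ ≤ ν) : lsq μ f ≤ lsq ν f := lintegral_mono' h le_rfl

lemma lsq_congr (h : f =ᵐ[μ] g) : lsq μ f = lsq μ g :=
  lintegral_congr_ae (h.mono fun x hx => by simp [hx])

lemma enorm_add_sq_le (a b : F) : ‖a + b‖ₑ ^ 2 ≤ 2 * ‖a‖ₑ ^ 2 + 2 * ‖b‖ₑ ^ 2 := by
  have h : ‖a + b‖ ^ 2 ≤ 2 * ‖a‖ ^ 2 + 2 * ‖b‖ ^ 2 := by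
    nlinarith [norm_add_le a b, norm_nonneg (a + b), sq_nonneg (‖a‖ - ‖b‖), norm_nonneg a,
      norm_nonneg b]
  simp only [← ofReal_norm]
  rw [← ENNReal.ofReal_pow (norm_nonneg _), ← ENNReal.ofReal_pow (norm_nonneg _),
    ← ENNReal.ofReal_pow (norm_nonneg _)]
  have h2 : (2 : ℝ≥0∞) = ENNReal.ofReal 2 := by simp
  rw [h2, ← ENNReal.ofReal_mul (by norm_num), ← ENNReal.ofReal_mul (by norm_num),
    ← ENNReal.ofReal_add (by positivity) (by positivity)]
  exact ENNReal.ofReal_le_ofReal h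

lemma enorm_sub_sq_le (a b : F) : ‖a - b‖ₑ ^ 2 ≤ 2 * ‖a‖ₑ ^ 2 + 2 * ‖b‖ₑ ^ 2 := by
  simpa [sub_eq_add_neg] using enorm_add_sq_le a (-b)

lemma enorm_sq_sub_comm (a b : F) : ‖a - b‖ₑ ^ 2 = ‖b - a‖ₑ ^ 2 := by
  rw [← enorm_neg, neg_sub]

lemma lsq_add_le (hf : AEStronglyMeasurable f μ) :
    lsq μ (f + g) ≤ 2 * lsq μ f + 2 * lsq μ g := by
  unfold lsq
  rw [← lintegral_const_mul'' _ (hf.enorm.pow_const 2), ← lintegral_const_mul' _ _ (by simp),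
    ← lintegral_add_left' ((hf.enorm.pow_const 2).const_mul _)]
  exact lintegral_mono fun x => enorm_add_sq_le _ _

lemma lsq_neg : lsq μ (-f) = lsq μ f := by simp [lsq]

lemma lsq_sub_comm : lsq μ (f - g) = lsq μ (g - f) := by
  rw [← lsq_neg, neg_sub]

lemma lsq_sub_le (hf : AEStronglyMeasurable f μ) :
    lsq μ (f - g) ≤ 2 * lsq μ f + 2 * lsq μ g := by
  rw [sub_eq_add_neg, ← lsq_neg (f := g)]
  exact lsq_add_le hf

lemma lsq_eq_zero_iff (hf : AEStronglyMeasurable f μ) : lsq μ f = 0 ↔ f =ᵐ[μ] 0 := by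
  rw [lsq_eq_eLpNorm_sq, pow_eq_zero_iff (by norm_num), eLpNorm_eq_zero_iff hf (by norm_num)]

lemma ofReal_integral_norm_sq (hf : MemLp f 2 μ) :
    ENNReal.ofReal (∫ x, ‖f x‖ ^ 2 ∂μ) = lsq μ f := by
  have hi : Integrable (fun x => ‖f x‖ ^ 2) μ := by
    simpa using hf.integrable_norm_pow (p := 2) (by norm_num)
  rw [ofReal_integral_eq_lintegral_ofReal hi (ae_of_all _ fun x => by positivity)]
  refine lintegral_congr fun x => ?_
  rw [ENNReal.ofReal_pow (norm_nonneg _), ofReal_norm]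

lemma integral_norm_sq (hf : MemLp f 2 μ) : ∫ x, ‖f x‖ ^ 2 ∂μ = (lsq μ f).toReal := by
  rw [← ofReal_integral_norm_sq hf, ENNReal.toReal_ofReal (integral_nonneg fun x => by positivity)]

end lsq

/-! ### Weak gradients and the space `H¹` -/

/-- `u ∈ H¹(Ω)` with weak gradient `G`. Carrying the gradient as a separate argument avoids the
chosen representative `weakGrad` until the forms are estimated. -/
structure HasH1Grad (Ω : Set (Euc n)) (u : Euc n → ℝ) (G : Euc n → Euc n) : Prop where
  memLp : MemLp u 2 (volume.restrict Ω)
  memLp_grad : MemLp G 2 (volume.restrict Ω)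
  hasWeakGrad : HasWeakGrad Ω u G

/-- The energy `∫_Ω u² + ∫_Ω |G|²`, as an extended nonnegative real. -/
def energy (Ω : Set (Euc n)) (u : Euc n → ℝ) (G : Euc n → Euc n) : ℝ≥0∞ :=
  lsq (volume.restrict Ω) u + lsq (volume.restrict Ω) G

variable {Ω : Set (Euc n)} {u v : Euc n → ℝ} {G G' : Euc n → Euc n}

lemma locallyIntegrableOn_of_memLp {F : Type*} [NormedAddCommGroup F] {f : Euc n → F}
    (hf : MemLp f 2 (volume.restrict Ω)) : LocallyIntegrableOn f Ω := by
  have : LocallyIntegrable f (volume.restrict Ω) := hf.locallyIntegrable (by norm_num)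
  exact locallyIntegrableOn_of_locallyIntegrable_restrict this

lemma integrable_mul_of_locallyIntegrableOn {u φ : Euc n → ℝ} (hu : LocallyIntegrableOn u Ω)
    (hφ : Continuous φ) (hc : HasCompactSupport φ) (hs : tsupport φ ⊆ Ω) :
    IntegrableOn (fun x => u x * φ x) Ω := by
  have h1 : IntegrableOn u (tsupport φ) := hu.integrableOn_compact_subset hs hc
  have h2 : IntegrableOn (fun x => u x * φ x) (tsupport φ) :=
    h1.mul_continuousOn hφ.continuousOn hc
  refine IntegrableOn.mono_set (t := univ) ?_ (subset_univ _)
  rw [integrableOn_univ]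
  refine (integrableOn_iff_integrable_of_support_subset ?_).1 h2
  intro x hx
  apply subset_tsupport
  simp only [Function.mem_support] at hx ⊢
  exact right_ne_zero_of_mul hx

lemma locallyIntegrableOn_inner (hG : LocallyIntegrableOn G Ω) (w : Euc n) :
    LocallyIntegrableOn (fun x => ⟪G x, w⟫) Ω := by
  have := (innerSL ℝ w).locallyIntegrableOn_comp hG
  refine this.congr (ae_of_all _ fun x => ?_)
  simp [real_inner_comm]

lemma HasWeakGrad.integrableOn_left (h : HasWeakGrad Ω u G) {φ : Euc n → ℝ} (hφ : ContDiff ℝ ∞ φ)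
    (hc : HasCompactSupport φ) (hs : tsupport φ ⊆ Ω) (w : Euc n) :
    IntegrableOn (fun x => u x * fderiv ℝ φ x w) Ω := by
  refine integrable_mul_of_locallyIntegrableOn h.1 ?_ ?_ ?_
  · exact (hφ.continuous_fderiv (by simp)).clm_apply continuous_const
  · exact (hc.fderiv_apply (𝕜 := ℝ) w)
  · exact (tsupport_fderiv_apply_subset ℝ w).trans hs

lemma HasWeakGrad.integrableOn_right (h : HasWeakGrad Ω u G) {φ : Euc n → ℝ} (hφ : ContDiff ℝ ∞ φ)
    (hc : HasCompactSupport φ) (hs : tsupport φ ⊆ Ω) (w : Euc n) :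
    IntegrableOn (fun x => ⟪G x, w⟫ * φ x) Ω :=
  integrable_mul_of_locallyIntegrableOn (locallyIntegrableOn_inner h.2.1 w) hφ.continuous hc hs

lemma HasWeakGrad.add (h : HasWeakGrad Ω u G) (h' : HasWeakGrad Ω v G') :
    HasWeakGrad Ω (u + v) (G + G') := by
  refine ⟨h.1.add h'.1, h.2.1.add h'.2.1, fun φ hφ hc hs w => ?_⟩
  simp only [Pi.add_apply, add_mul, inner_add_left]
  rw [integral_add (h.integrableOn_left hφ hc hs w) (h'.integrableOn_left hφ hc hs w),
    integral_add (h.integrableOn_right hφ hc hs w) (h'.integrableOn_right hφ hc hs w),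
    h.2.2 φ hφ hc hs w, h'.2.2 φ hφ hc hs w]
  ring

lemma HasWeakGrad.const_smul (h : HasWeakGrad Ω u G) (c : ℝ) : HasWeakGrad Ω (c • u) (c • G) := by
  refine ⟨h.1.smul c, h.2.1.smul c, fun φ hφ hc hs w => ?_⟩
  simp only [Pi.smul_apply, smul_eq_mul, mul_assoc, inner_smul_left, RCLike.conj_to_real]
  rw [integral_const_mul, integral_const_mul, h.2.2 φ hφ hc hs w]
  ring

lemma HasWeakGrad.sub (h : HasWeakGrad Ω u G) (h' : HasWeakGrad Ω v G') :
    HasWeakGrad Ω (u - v) (G - G') := by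
  have := h.add (h'.const_smul (-1))
  simpa [sub_eq_add_neg] using this

/-- The weak gradient is unique: the difference of two gradients annihilates all test functions. -/
lemma HasWeakGrad.ae_unique (hΩ : IsOpen Ω) (h : HasWeakGrad Ω u G) (h' : HasWeakGrad Ω u G') :
    G =ᵐ[volume.restrict Ω] G' := by
  have h0 : HasWeakGrad Ω 0 (G - G') := by simpa using h.sub h'
  have key : ∀ᵐ x, x ∈ Ω → (G - G') x = 0 := by
    refine hΩ.ae_eq_zero_of_integral_contDiff_smul_eq_zero h0.2.1 fun φ hφ hc hs => ?_
    have hint : Integrable (fun x => φ x • (G - G') x) := by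
      have h1 : IntegrableOn (G - G') (tsupport φ) := h0.2.1.integrableOn_compact_subset hs hc
      have h2 : IntegrableOn (fun x => φ x • (G - G') x) (tsupport φ) :=
        h1.continuousOn_smul hφ.continuous.continuousOn hc
      refine (integrableOn_iff_integrable_of_support_subset ?_).1 h2
      intro x hx
      apply subset_tsupport
      simp only [Function.mem_support] at hx ⊢
      exact left_ne_zero_of_smul hx
    refine ext_inner_right ℝ fun w => ?_
    have e1 := integral_inner (𝕜 := ℝ) hint w
    have e2 := h0.2.2 φ hφ hc hs w
    simp only [Pi.zero_apply, zero_mul, integral_zero] at e2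
    rw [inner_zero_left, real_inner_comm, ← e1]
    rw [setIntegral_eq_integral_of_forall_compl_eq_zero] at e2
    · rw [← neg_zero, e2, neg_neg]
      refine integral_congr_ae (ae_of_all _ fun x => ?_)
      simp only [inner_smul_right, real_inner_comm]
      ring
    · intro x hx
      rw [image_eq_zero_of_notMem_tsupport (fun h => hx (hs h))]
      simp
  rw [EventuallyEq, ae_restrict_iff' hΩ.measurableSet]
  filter_upwards [key] with x hx hxΩ
  exact sub_eq_zero.1 (hx hxΩ)

lemma HasWeakGrad.congr (h : HasWeakGrad Ω u G) (hu : u =ᵐ[volume.restrict Ω] v)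
    (hG : G =ᵐ[volume.restrict Ω] G') : HasWeakGrad Ω v G' := by
  refine ⟨?_, ?_, fun φ hφ hc hs w => ?_⟩
  · exact h.1.congr hu
  · exact h.2.1.congr hG
  · have e1 : ∫ x in Ω, u x * fderiv ℝ φ x w = ∫ x in Ω, v x * fderiv ℝ φ x w :=
      integral_congr_ae (hu.mono fun x hx => by simp only [hx])
    have e2 : ∫ x in Ω, ⟪G x, w⟫ * φ x = ∫ x in Ω, ⟪G' x, w⟫ * φ x :=
      integral_congr_ae (hG.mono fun x hx => by simp only [hx])
    rw [← e1, ← e2]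
    exact h.2.2 φ hφ hc hs w

lemma HasWeakGrad.weakGrad_ae (hΩ : IsOpen Ω) (h : HasWeakGrad Ω u G) :
    weakGrad Ω u =ᵐ[volume.restrict Ω] G := by
  have hex : ∃ G, HasWeakGrad Ω u G := ⟨G, h⟩
  unfold weakGrad
  rw [dif_pos hex]
  exact hex.choose_spec.ae_unique hΩ h

lemma memLp_euc_iff {F : Type*} [MeasurableSpace F] {μ : Measure F} {G : F → Euc n} :
    MemLp G 2 μ ↔ ∀ i, MemLp (fun x => G x i) 2 μ :=
  memLp_piLp_iff

/-- The fractional seminorms in `MemSobolev` are absent for smoothness `0`. -/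
lemma memH1_iff : MemH1 Ω u ↔ ∃ G, HasH1Grad Ω u G := by
  constructor
  · rintro ⟨h1, G, hG, h2⟩
    exact ⟨G, h1, memLp_euc_iff.2 fun i => (h2 i).1, hG⟩
  · rintro ⟨G, h1, h2, hG⟩
    exact ⟨h1, G, hG, fun i => ⟨memLp_euc_iff.1 h2 i, fun h => absurd h (lt_irrefl _)⟩⟩

namespace HasH1Grad

lemma memH1 (h : HasH1Grad Ω u G) : MemH1 Ω u := memH1_iff.2 ⟨G, h⟩

lemma sub (h : HasH1Grad Ω u G) (h' : HasH1Grad Ω v G') : HasH1Grad Ω (u - v) (G - G') :=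
  ⟨h.1.sub h'.1, h.2.sub h'.2, h.3.sub h'.3⟩

lemma weakGrad_ae (hΩ : IsOpen Ω) (h : HasH1Grad Ω u G) :
    weakGrad Ω u =ᵐ[volume.restrict Ω] G := h.3.weakGrad_ae hΩ

lemma weakGrad (hΩ : IsOpen Ω) (h : HasH1Grad Ω u G) : HasH1Grad Ω u (weakGrad Ω u) :=
  ⟨h.1, h.2.ae_eq (h.weakGrad_ae hΩ).symm,
    h.3.congr ae_eq_rfl (h.weakGrad_ae hΩ).symm⟩

lemma energy_lt_top (h : HasH1Grad Ω u G) : energy Ω u G < ⊤ :=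
  ENNReal.add_lt_top.2 ⟨lsq_lt_top h.1, lsq_lt_top h.2⟩

lemma ofReal_h1Norm_sq (hΩ : IsOpen Ω) (h : HasH1Grad Ω u G) :
    ENNReal.ofReal (h1Norm Ω u ^ 2) = energy Ω u G := by
  have h1 : 0 ≤ ∫ x in Ω, u x ^ 2 := integral_nonneg fun x => by positivity
  have h2 : 0 ≤ ∫ x in Ω, ‖ObstacleFEM.weakGrad Ω u x‖ ^ 2 := integral_nonneg fun x => by positivity
  rw [h1Norm, Real.sq_sqrt (add_nonneg h1 h2), ENNReal.ofReal_add h1 h2, energy]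
  congr 1
  · rw [← ofReal_integral_norm_sq h.1]
    simp
  · rw [ofReal_integral_norm_sq (h.weakGrad hΩ).2, lsq_congr (h.weakGrad_ae hΩ)]

lemma h1Norm_sq (hΩ : IsOpen Ω) (h : HasH1Grad Ω u G) :
    h1Norm Ω u ^ 2 = (energy Ω u G).toReal := by
  rw [← h.ofReal_h1Norm_sq hΩ, ENNReal.toReal_ofReal (by positivity)]

end HasH1Grad

lemma h1Norm_nonneg : 0 ≤ h1Norm Ω u := Real.sqrt_nonneg _

lemma energy_add_le (h : HasH1Grad Ω u G) :
    energy Ω (u + v) (G + G') ≤ 2 * energy Ω u G + 2 * energy Ω v G' := by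
  have h1 := lsq_add_le (g := v) h.1.1
  have h2 := lsq_add_le (g := G') h.2.1
  unfold energy
  calc _ ≤ _ := add_le_add h1 h2
    _ = _ := by ring

lemma energy_sub_le (h : HasH1Grad Ω u G) :
    energy Ω (u - v) (G - G') ≤ 2 * energy Ω u G + 2 * energy Ω v G' := by
  have h1 := lsq_sub_le (g := v) h.1.1
  have h2 := lsq_sub_le (g := G') h.2.1
  unfold energy
  calc _ ≤ _ := add_le_add h1 h2
    _ = _ := by ring

lemma tendsto_energy_of_tendsto_h1Norm (hΩ : IsOpen Ω) {u : ℕ → Euc n → ℝ}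
    {G : ℕ → Euc n → Euc n} (h : ∀ k, HasH1Grad Ω (u k) (G k))
    (ht : Tendsto (fun k => h1Norm Ω (u k)) atTop (𝓝 0)) :
    Tendsto (fun k => energy Ω (u k) (G k)) atTop (𝓝 0) := by
  simp only [← (h _).ofReal_h1Norm_sq hΩ]
  have := (ENNReal.continuous_ofReal.tendsto _).comp (ht.pow 2)
  simpa [Function.comp_def] using this

lemma tendsto_h1Norm_of_tendsto_energy (hΩ : IsOpen Ω) {u : ℕ → Euc n → ℝ}
    {G : ℕ → Euc n → Euc n} (h : ∀ k, HasH1Grad Ω (u k) (G k))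
    (ht : Tendsto (fun k => energy Ω (u k) (G k)) atTop (𝓝 0)) :
    Tendsto (fun k => h1Norm Ω (u k)) atTop (𝓝 0) := by
  have h1 : Tendsto (fun k => √(energy Ω (u k) (G k)).toReal) atTop (𝓝 0) := by
    have := (Real.continuous_sqrt.tendsto _).comp
      ((ENNReal.tendsto_toReal (a := 0) (by simp)).comp ht)
    simpa [Function.comp_def] using this
  refine h1.congr fun k => ?_
  rw [← (h k).h1Norm_sq hΩ, Real.sqrt_sq h1Norm_nonneg]

/-- A smooth function has its classical gradient as weak gradient. -/
lemma hasWeakGrad_of_contDiff {φ : Euc n → ℝ} (hφ : ContDiff ℝ 1 φ) :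
    HasWeakGrad Ω φ (gradient φ) := by
  have hgc : Continuous (gradient φ) :=
    (InnerProductSpace.toDual ℝ (Euc n)).symm.continuous.comp (hφ.continuous_fderiv (by simp))
  refine ⟨hφ.continuous.locallyIntegrable.locallyIntegrableOn _,
    hgc.locallyIntegrable.locallyIntegrableOn _, fun ψ hψ hc hs w => ?_⟩
  have h1 : ∫ x in Ω, φ x * fderiv ℝ ψ x w = ∫ x, φ x * fderiv ℝ ψ x w := by
    refine setIntegral_eq_integral_of_forall_compl_eq_zero fun x hx => ?_
    rw [fderiv_of_notMem_tsupport ℝ (fun h => hx (hs h))]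
    simp
  have h2 : ∫ x in Ω, ⟪gradient φ x, w⟫ * ψ x = ∫ x, ⟪gradient φ x, w⟫ * ψ x := by
    refine setIntegral_eq_integral_of_forall_compl_eq_zero fun x hx => ?_
    rw [image_eq_zero_of_notMem_tsupport (fun h => hx (hs h))]
    simp
  have cψ : Continuous fun x => fderiv ℝ ψ x w :=
    (hψ.continuous_fderiv (by simp)).clm_apply continuous_const
  have cφ : Continuous fun x => fderiv ℝ φ x w :=
    (hφ.continuous_fderiv (by simp)).clm_apply continuous_const
  rw [h1, h2, integral_mul_fderiv_eq_neg_fderiv_mul_of_integrable]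
  · simp [gradient]
  · exact (cφ.mul hψ.continuous).integrable_of_hasCompactSupport hc.mul_left
  · exact (hφ.continuous.mul cψ).integrable_of_hasCompactSupport (hc.fderiv_apply (𝕜 := ℝ) w).mul_left
  · exact (hφ.continuous.mul hψ.continuous).integrable_of_hasCompactSupport hc.mul_left
  · exact fun x _ => hφ.differentiable (by simp) x
  · exact fun x _ => hψ.differentiable (by simp) x

lemma memLp_of_continuous {F : Type*} [NormedAddCommGroup F] {f : Euc n → F}
    (hb : Bornology.IsBounded Ω) (hf : Continuous f) : MemLp f 2 (volume.restrict Ω) := by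
  have hK : IsCompact (closure Ω) := hb.isCompact_closure
  obtain ⟨C, hC⟩ := hK.exists_bound_of_continuousOn hf.continuousOn
  have : IsFiniteMeasure (volume.restrict Ω) := ⟨by simpa using hb.measure_lt_top⟩
  have : IsFiniteMeasure (volume.restrict (closure Ω)) :=
    ⟨by simpa using hK.isBounded.measure_lt_top⟩
  refine (MemLp.of_bound (μ := volume.restrict (closure Ω)) hf.aestronglyMeasurable C
    ?_).mono_measure (Measure.restrict_mono subset_closure le_rfl)
  exact (ae_restrict_iff' isClosed_closure.measurableSet).2 (ae_of_all _ hC)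

lemma continuous_gradient {φ : Euc n → ℝ} (hφ : ContDiff ℝ 1 φ) : Continuous (gradient φ) :=
  (InnerProductSpace.toDual ℝ (Euc n)).symm.continuous.comp (hφ.continuous_fderiv (by simp))

lemma hasH1Grad_of_contDiff (hb : Bornology.IsBounded Ω) {φ : Euc n → ℝ} (hφ : ContDiff ℝ 1 φ) :
    HasH1Grad Ω φ (gradient φ) :=
  ⟨memLp_of_continuous hb hφ.continuous, memLp_of_continuous hb (continuous_gradient hφ),
    hasWeakGrad_of_contDiff hφ⟩

/-- The product rule for a weakly differentiable and a smooth function. -/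
lemma HasWeakGrad.mul_contDiff (h : HasWeakGrad Ω u G) (hΩ : IsOpen Ω) {χ : Euc n → ℝ}
    (hχ : ContDiff ℝ ∞ χ) :
    HasWeakGrad Ω (fun x => χ x * u x) (fun x => χ x • G x + u x • gradient χ x) := by
  have hgc := continuous_gradient (hχ.of_le (by simp))
  refine ⟨?_, ?_, fun φ hφ hc hs w => ?_⟩
  · exact h.1.continuousOn_mul hχ.continuous.continuousOn hΩ.isLocallyClosed
  · exact (h.2.1.continuousOn_smul hΩ.isLocallyClosed hχ.continuous.continuousOn).add
      (h.1.smul_continuousOn hΩ.isLocallyClosed hgc.continuousOn)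
  · have hs' : tsupport (fun x => χ x * φ x) ⊆ Ω :=
      (closure_mono (Function.support_mul_subset_right _ _)).trans hs
    have key := h.2.2 (fun x => χ x * φ x) (hχ.mul hφ) hc.mul_left hs' w
    have e1 : ∀ x, fderiv ℝ (fun x => χ x * φ x) x w
        = χ x * fderiv ℝ φ x w + φ x * ⟪gradient χ x, w⟫ := fun x => by
      rw [fderiv_fun_mul (hχ.differentiable (by simp) x) (hφ.differentiable (by simp) x)]
      simp [gradient]
    have i1 : IntegrableOn (fun x => u x * (χ x * fderiv ℝ φ x w)) Ω :=
      integrable_mul_of_locallyIntegrableOn h.1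
        (hχ.continuous.mul ((hφ.continuous_fderiv (by simp)).clm_apply continuous_const))
        ((hc.fderiv_apply (𝕜 := ℝ) w).mul_left)
        ((closure_mono (Function.support_mul_subset_right _ _)).trans
          ((tsupport_fderiv_apply_subset ℝ w).trans hs))
    have i2 : IntegrableOn (fun x => u x * (φ x * ⟪gradient χ x, w⟫)) Ω :=
      integrable_mul_of_locallyIntegrableOn h.1
        (hφ.continuous.mul (hgc.inner continuous_const)) (hc.mul_right)
        ((closure_mono (Function.support_mul_subset_left _ _)).trans hs)
    have i3 : IntegrableOn (fun x => ⟪G x, w⟫ * (χ x * φ x)) Ω :=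
      h.integrableOn_right (hχ.mul hφ) hc.mul_left hs' w
    simp only [e1, mul_add] at key
    rw [integral_add i1 i2] at key
    have e2 : ∫ x in Ω, ⟪χ x • G x + u x • gradient χ x, w⟫ * φ x
        = (∫ x in Ω, ⟪G x, w⟫ * (χ x * φ x)) + ∫ x in Ω, u x * (φ x * ⟪gradient χ x, w⟫) := by
      rw [← integral_add i3 i2]
      refine integral_congr_ae (ae_of_all _ fun x => ?_)
      simp only [inner_add_left, inner_smul_left, RCLike.conj_to_real]
      ring
    have e3 : ∫ x in Ω, χ x * u x * fderiv ℝ φ x w = ∫ x in Ω, u x * (χ x * fderiv ℝ φ x w) :=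
      integral_congr_ae (ae_of_all _ fun x => by ring)
    rw [e2, e3]
    linarith

/-! ### Averaged translations in `L²` -/

lemma enorm_integral_sq_le {X F : Type*} [MeasurableSpace X] [NormedAddCommGroup F]
    [NormedSpace ℝ F] {μ : Measure X} {f : X → F} (hf : AEStronglyMeasurable f μ) :
    ‖∫ x, f x ∂μ‖ₑ ^ 2 ≤ μ univ * lsq μ f := by
  have h1 : ‖∫ x, f x ∂μ‖ₑ ≤ eLpNorm f 1 μ := by
    rw [eLpNorm_one_eq_lintegral_enorm]
    exact enorm_integral_le_lintegral_enorm f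
  have h2 := eLpNorm_le_eLpNorm_mul_rpow_measure_univ (μ := μ) (p := 1) (q := 2)
    (by norm_num) hf
  calc ‖∫ x, f x ∂μ‖ₑ ^ 2 ≤ (eLpNorm f 2 μ * μ univ ^ (1 / (1 : ℝ≥0∞).toReal - 1 / (2 : ℝ≥0∞).toReal)) ^ 2 := by
        gcongr; exact h1.trans h2
    _ = μ univ * lsq μ f := by
        rw [mul_pow, lsq_eq_eLpNorm_sq, mul_comm, ← ENNReal.rpow_natCast, ← ENNReal.rpow_mul]
        norm_num

/-- Translation is continuous in `L²`. -/
lemma tendsto_lsq_translate {F : Type*} [NormedAddCommGroup F] {f : Euc n → F}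
    (hf : MemLp f 2 volume) :
    Tendsto (fun h : Euc n => lsq volume (fun x => f (h + x) - f x)) (𝓝 0) (𝓝 0) := by
  have : Fact ((2 : ℝ≥0∞) ≠ ⊤) := ⟨by norm_num⟩
  have hc : Continuous fun h : Euc n => DomAddAct.mk h +ᵥ hf.toLp f :=
    (DomAddAct.continuous_mk).vadd continuous_const
  have h1 : Tendsto (fun h : Euc n => ‖(DomAddAct.mk h +ᵥ hf.toLp f) - hf.toLp f‖ₑ ^ 2)
      (𝓝 0) (𝓝 0) := by
    have h2 := ((hc.sub (continuous_const (y := hf.toLp f))).enorm.tendsto 0)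
    have h3 := (ENNReal.continuous_pow 2).tendsto _ |>.comp h2
    simpa [Function.comp_def] using h3
  refine h1.congr fun h => ?_
  rw [DomAddAct.mk_vadd_toLp, ← MemLp.toLp_sub, Lp.enorm_toLp, ← lsq_eq_eLpNorm_sq]
  rfl

/-- Averages `x ↦ ∫ f(x + ε z) dν(z)` over a probability measure with bounded support converge
to `f` in `L²` as `ε → 0`. -/
lemma tendsto_lsq_average {F : Type*} [NormedAddCommGroup F] [NormedSpace ℝ F] [CompleteSpace F]
    {f : Euc n → F}
    (hf : MemLp f 2 volume) (hfm : StronglyMeasurable f) {ν : Measure (Euc n)}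
    [IsProbabilityMeasure ν] {R : ℝ} (hν : ∀ᵐ z ∂ν, ‖z‖ ≤ R) :
    Tendsto (fun ε : ℝ => lsq volume (fun x => (∫ z, f (x + ε • z) ∂ν) - f x)) (𝓝 0) (𝓝 0) := by
  have ht := tendsto_lsq_translate hf
  rw [ENNReal.tendsto_nhds_zero] at ht ⊢
  intro δ hδ
  obtain ⟨r, hr, hball⟩ := Metric.eventually_nhds_iff.1 (ht δ hδ)
  have hR : 0 ≤ |R| := abs_nonneg R
  refine Metric.eventually_nhds_iff.2 ⟨r / (|R| + 1), by positivity, fun ε hε => ?_⟩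
  have hsm : ∀ z, ‖z‖ ≤ R → lsq volume (fun x => f (x + ε • z) - f x) ≤ δ := fun z hz => by
    have hdist : dist (ε • z) 0 < r := by
      rw [dist_zero_right, norm_smul]
      rw [dist_zero_right] at hε
      calc ‖ε‖ * ‖z‖ ≤ ‖ε‖ * (|R| + 1) := by
            gcongr; linarith [le_abs_self R]
        _ < r := by rwa [lt_div_iff₀ (by positivity)] at hε
    simpa [add_comm] using hball hdist
  have hmeas : StronglyMeasurable (fun p : Euc n × Euc n => f (p.1 + ε • p.2) - f p.1) :=
    (hfm.comp_measurable (by fun_prop)).sub (hfm.comp_measurable measurable_fst)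
  have hpt : ∀ᵐ x, ‖(∫ z, f (x + ε • z) ∂ν) - f x‖ₑ ^ 2
      ≤ ∫⁻ z, ‖f (x + ε • z) - f x‖ₑ ^ 2 ∂ν := by
    have hfin : ∫⁻ x, ∫⁻ z, ‖f (x + ε • z) - f x‖ₑ ^ 2 ∂ν < ⊤ := by
      rw [lintegral_lintegral_swap (hmeas.enorm.pow_const 2).aemeasurable]
      calc ∫⁻ z, lsq volume (fun x => f (x + ε • z) - f x) ∂ν
          ≤ ∫⁻ z, (2 * lsq volume f + 2 * lsq volume f) ∂ν := by
            refine lintegral_mono fun z => ?_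
            have hz : MemLp (fun x => f (x + ε • z)) 2 volume :=
              hf.comp_measurePreserving (measurePreserving_add_right volume (ε • z))
            refine (lsq_sub_le hz.1).trans ?_
            gcongr
            rw [lsq, lintegral_add_right_eq_self (fun x => ‖f x‖ₑ ^ 2) (ε • z)]
            rfl
        _ < ⊤ := by
            rw [lintegral_const, measure_univ, mul_one]
            exact ENNReal.add_lt_top.2 ⟨ENNReal.mul_lt_top (by simp) (lsq_lt_top hf),
              ENNReal.mul_lt_top (by simp) (lsq_lt_top hf)⟩
    have hm2 : Measurable fun x => ∫⁻ z, ‖f (x + ε • z) - f x‖ₑ ^ 2 ∂ν :=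
      (hmeas.enorm.pow_const 2).lintegral_prod_right'
    filter_upwards [ae_lt_top hm2 hfin.ne] with x hx
    have hxm : AEStronglyMeasurable (fun z => f (x + ε • z) - f x) ν :=
      (hmeas.comp_measurable measurable_prodMk_left).aestronglyMeasurable
    have hxL : MemLp (fun z => f (x + ε • z) - f x) 2 ν := memLp_of_lsq_lt_top hxm hx
    have hxi : Integrable (fun z => f (x + ε • z) - f x) ν := hxL.integrable (by norm_num)
    have hxi' : Integrable (fun z => f (x + ε • z)) ν := by
      refine (hxi.add (integrable_const (f x))).congr (ae_of_all _ fun z => ?_)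
      simp
    have := enorm_integral_sq_le hxm
    rw [measure_univ, one_mul, integral_sub hxi' (integrable_const _)] at this
    rwa [integral_const, probReal_univ, one_smul] at this
  calc lsq volume (fun x => (∫ z, f (x + ε • z) ∂ν) - f x)
      ≤ ∫⁻ x, ∫⁻ z, ‖f (x + ε • z) - f x‖ₑ ^ 2 ∂ν := lintegral_mono_ae hpt
    _ = ∫⁻ z, lsq volume (fun x => f (x + ε • z) - f x) ∂ν :=
        lintegral_lintegral_swap (hmeas.enorm.pow_const 2).aemeasurable
    _ ≤ ∫⁻ _, δ ∂ν := lintegral_mono_ae (hν.mono hsm)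
    _ = δ := by simp

/-! ### The uniform cone condition -/

/-- Near `x` the set `Ω` is closed under adding small vectors of the cone spanned by the ball of
radius `θ` about `e`: `y + t z ∈ Ω` whenever `y ∈ Ω ∩ B(x, ρ)`, `0 ≤ t < ρ` and `z ∈ B(e, θ)`. -/
def ConeAt (Ω : Set (Euc n)) (x e : Euc n) (θ ρ : ℝ) : Prop :=
  0 < θ ∧ 0 < ρ ∧ ∀ y ∈ Ω ∩ Metric.ball x ρ, ∀ t : ℝ, 0 ≤ t → t < ρ →
    ∀ z ∈ Metric.ball e θ, y + t • z ∈ Ω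

/-- The axis of the cone at a boundary point is the direction `e` over which the domain is an
epigraph. If the defining function is `L`-Lipschitz, every `z` with `‖z - e‖ < 1 / (1 + 2 L)` points
upwards more steeply than the graph. -/
lemma exists_coneAt {Ω : Set (Euc n)} (hΩ : IsOpen Ω) (hL : HasLipschitzBoundary Ω) {x : Euc n}
    (hx : x ∈ closure Ω) : ∃ e θ ρ, ConeAt Ω x e θ ρ := by
  by_cases hxΩ : x ∈ Ω
  · obtain ⟨r, hr, hball⟩ := Metric.isOpen_iff.1 hΩ x hxΩ
    refine ⟨0, 1, r / 2, one_pos, by positivity, fun y hy t ht0 ht z hz => hball ?_⟩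
    have h1 : dist y x < r / 2 := hy.2
    have h2 : ‖z‖ < 1 := by simpa using hz
    rw [Metric.mem_ball, dist_eq_norm] at *
    calc ‖y + t • z - x‖ = ‖(y - x) + t • z‖ := by congr 1; abel
      _ ≤ ‖y - x‖ + ‖t • z‖ := norm_add_le _ _
      _ ≤ ‖y - x‖ + t * 1 := by
        rw [norm_smul, Real.norm_of_nonneg ht0]; gcongr
      _ < r := by linarith
  · have hfr : x ∈ frontier Ω := ⟨hx, by rwa [hΩ.interior_eq]⟩
    obtain ⟨e, L, ψ, r, he, hψ, hr, hmem⟩ := hL x hfr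
    have hL0 : (0 : ℝ) ≤ L := L.2
    refine ⟨e, 1 / (1 + 2 * L), r / 4, by positivity, by positivity,
      fun y hy t ht0 ht z hz => ?_⟩
    obtain ⟨hyΩ, hyx⟩ := hy
    rw [Metric.mem_ball, dist_eq_norm] at hyx hz
    have hv : ‖z - e‖ * (1 + 2 * L) < 1 := by rwa [lt_div_iff₀ (by positivity)] at hz
    have hv1 : ‖z - e‖ ≤ 1 := by nlinarith [norm_nonneg (z - e)]
    have hz2 : ‖z‖ ≤ 2 := by
      calc ‖z‖ = ‖(z - e) + e‖ := by congr 1; abel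
        _ ≤ ‖z - e‖ + ‖e‖ := norm_add_le _ _
        _ ≤ 2 := by linarith
    have hin : ∀ v : Euc n, |⟪e, v⟫| ≤ ‖v‖ := fun v => by
      simpa [he] using abs_real_inner_le_norm e v
    have hee : ⟪e, e⟫ = (1 : ℝ) := by rw [real_inner_self_eq_norm_sq, he]; norm_num
    have hez : ⟪e, z⟫ = 1 + ⟪e, z - e⟫ := by rw [inner_sub_right, hee]; ring
    have hperp : ‖z - ⟪e, z⟫ • e‖ ≤ 2 * ‖z - e‖ := by
      have : z - ⟪e, z⟫ • e = (z - e) - ⟪e, z - e⟫ • e := by rw [hez, add_smul, one_smul]; abel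
      rw [this]
      calc _ ≤ ‖z - e‖ + ‖⟪e, z - e⟫ • e‖ := norm_sub_le _ _
        _ ≤ ‖z - e‖ + ‖z - e‖ := by
          rw [norm_smul, he, mul_one, Real.norm_eq_abs]; gcongr; exact hin _
        _ = _ := by ring
    have hyt : y + t • z ∈ Metric.ball x r := by
      rw [Metric.mem_ball, dist_eq_norm]
      calc ‖y + t • z - x‖ = ‖(y - x) + t • z‖ := by congr 1; abel
        _ ≤ ‖y - x‖ + ‖t • z‖ := norm_add_le _ _
        _ ≤ ‖y - x‖ + t * 2 := by
          rw [norm_smul, Real.norm_of_nonneg ht0]; gcongr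
        _ < r := by linarith
    have hy0 : y ∈ Metric.ball x r := by rw [Metric.mem_ball, dist_eq_norm]; linarith
    rw [hmem _ hyt]
    have hy1 := (hmem y hy0).1 hyΩ
    have hl := hψ.dist_le_mul (y + t • z - ⟪e, y + t • z⟫ • e) (y - ⟪e, y⟫ • e)
    have e1 : y + t • z - ⟪e, y + t • z⟫ • e - (y - ⟪e, y⟫ • e) = t • (z - ⟪e, z⟫ • e) := by
      rw [inner_add_right, inner_smul_right, add_smul, smul_sub, smul_smul]; abel
    rw [dist_eq_norm, dist_eq_norm, e1, norm_smul, Real.norm_of_nonneg ht0, Real.norm_eq_abs] at hl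
    have hl2 := (le_abs_self _).trans hl
    rw [inner_add_right, inner_smul_right]
    rw [inner_add_right, inner_smul_right] at hl2
    have h3 := (abs_le.1 (hin (z - e))).1
    have h4 : (L : ℝ) * (t * ‖z - ⟪e, z⟫ • e‖) ≤ t * ⟪e, z⟫ := by
      have : (L : ℝ) * ‖z - ⟪e, z⟫ • e‖ ≤ ⟪e, z⟫ := by
        calc (L : ℝ) * ‖z - ⟪e, z⟫ • e‖ ≤ L * (2 * ‖z - e‖) := by gcongr
          _ ≤ 1 - ‖z - e‖ := by linarith
          _ ≤ _ := by rw [hez]; linarith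
      calc _ = t * ((L : ℝ) * ‖z - ⟪e, z⟫ • e‖) := by ring
        _ ≤ _ := by gcongr
    linarith

/-! ### Density of smooth functions in `H¹` -/

/-- The mollifying kernel for which convolution averages `f(x + ε z)` with density `η(z)`. -/
def mollKernel (η : Euc n → ℝ) (ε : ℝ) (w : Euc n) : ℝ := (ε ^ n)⁻¹ * η ((-ε⁻¹) • w)

section mollifier

variable {η : Euc n → ℝ} {ε : ℝ}

lemma contDiff_mollKernel (hη : ContDiff ℝ ∞ η) : ContDiff ℝ ∞ (mollKernel η ε) :=
  contDiff_const.mul (hη.comp (contDiff_const_smul _))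

lemma hasCompactSupport_mollKernel (hη : HasCompactSupport η) (hε : 0 < ε) :
    HasCompactSupport (mollKernel η ε) :=
  (hη.comp_smul (neg_ne_zero.2 (inv_ne_zero hε.ne'))).mul_left

lemma tsupport_mollKernel {w : Euc n} (hw : w ∈ tsupport (mollKernel η ε)) :
    (-ε⁻¹) • w ∈ tsupport η := by
  have hcl : IsClosed {w : Euc n | (-ε⁻¹) • w ∈ tsupport η} :=
    (isClosed_tsupport η).preimage (continuous_const_smul _)
  refine closure_minimal ?_ hcl hw
  intro w hw
  exact subset_tsupport _ (right_ne_zero_of_mul hw)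

lemma integral_mul_mollKernel (hε : 0 < ε) {F : Type*} [NormedAddCommGroup F] [NormedSpace ℝ F]
    (f : Euc n → F) (x : Euc n) :
    ∫ t, mollKernel η ε (x - t) • f t = ∫ z, η z • f (x + ε • z) := by
  have h1 : ∫ t, mollKernel η ε (x - t) • f t
      = ∫ t, mollKernel η ε (x - (x + t)) • f (x + t) :=
    (integral_add_left_eq_self (fun t => mollKernel η ε (x - t) • f t) x).symm
  have h2 := Measure.integral_comp_smul (volume : Measure (Euc n))
    (fun t => mollKernel η ε (x - (x + t)) • f (x + t)) ε
  rw [h1]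
  have h3 : ∀ z : Euc n, mollKernel η ε (x - (x + ε • z)) = (ε ^ n)⁻¹ * η z := fun z => by
    simp [mollKernel, smul_smul, inv_mul_cancel₀ hε.ne']
  simp only [h3, finrank_euclideanSpace, Fintype.card_fin, mul_smul] at h2
  rw [integral_smul, abs_of_pos (by positivity)] at h2
  exact (smul_right_injective F (r := (ε ^ n)⁻¹) (by positivity) h2).symm

end mollifier

/-- Mollification into the cone: a compactly supported `H¹` function near a point where the cone
condition holds is approximated in `H¹(Ω)` by functions smooth on the whole space. -/
lemma exists_contDiff_tendsto_of_coneAt {Ω : Set (Euc n)} (hΩ : IsOpen Ω) {w : Euc n → ℝ}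
    {G : Euc n → Euc n} (hw : HasWeakGrad Ω w G) (hw2 : MemLp w 2 volume)
    (hG2 : MemLp G 2 volume) (hwm : StronglyMeasurable w) (hGm : StronglyMeasurable G)
    {x e : Euc n} {θ ρ : ℝ} (hcone : ConeAt Ω x e θ ρ)
    (hw0 : ∀ y, y ∉ Ω ∩ Metric.ball x (ρ / 2) → w y = 0)
    (hG0 : ∀ y, y ∉ Ω ∩ Metric.ball x (ρ / 2) → G y = 0) :
    ∃ φ : ℕ → Euc n → ℝ, (∀ k, ContDiff ℝ ∞ (φ k)) ∧
      Tendsto (fun k => energy Ω (φ k - w) (gradient (φ k) - G)) atTop (𝓝 0) := by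
  obtain ⟨hθ, hρ, hc⟩ := hcone
  -- averaging over `w (y + ε z)` with `z` near `e` only uses points on the inner side of `y`
  let B : ContDiffBump e := ⟨θ / 4, θ / 2, by positivity, by linarith⟩
  set η : Euc n → ℝ := B.normed volume with hη
  have hηc : ContDiff ℝ ∞ η := B.contDiff_normed
  have hηs : HasCompactSupport η := B.hasCompactSupport_normed
  have hηt : tsupport η = Metric.closedBall e (θ / 2) := B.tsupport_normed_eq
  have hη0 : ∀ z, 0 ≤ η z := B.nonneg_normed
  let ν : Measure (Euc n) := volume.withDensity fun z => ENNReal.ofReal (η z)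
  have hηm : Measurable fun z => ENNReal.ofReal (η z) :=
    ENNReal.measurable_ofReal.comp hηc.continuous.measurable
  have hνp : IsProbabilityMeasure ν := ⟨by
    rw [withDensity_apply _ MeasurableSet.univ, Measure.restrict_univ,
      ← ofReal_integral_eq_lintegral_ofReal B.integrable_normed (ae_of_all _ hη0),
      B.integral_normed, ENNReal.ofReal_one]⟩
  have hνi : ∀ {F : Type} [NormedAddCommGroup F] [NormedSpace ℝ F] (f : Euc n → F),
      ∫ z, f z ∂ν = ∫ z, η z • f z := fun f => by
    rw [integral_withDensity_eq_integral_toReal_smul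
      hηm (ae_of_all _ fun _ => by simp)]
    refine integral_congr_ae (ae_of_all _ fun z => ?_)
    simp only [ENNReal.toReal_ofReal (hη0 z)]
  have hνR : ∀ᵐ z ∂ν, ‖z‖ ≤ ‖e‖ + θ := by
    rw [ae_withDensity_iff hηm]
    refine ae_of_all _ fun z hz => ?_
    have : z ∈ tsupport η := subset_tsupport _ fun h0 => hz (by simp [h0])
    rw [hηt, Metric.mem_closedBall, dist_eq_norm] at this
    calc ‖z‖ = ‖(z - e) + e‖ := by congr 1; abel
      _ ≤ ‖z - e‖ + ‖e‖ := norm_add_le _ _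
      _ ≤ _ := by linarith
  let ε : ℕ → ℝ := fun k => (ρ / (2 * (‖e‖ + θ + 1))) * (1 / ((k : ℝ) + 1))
  have hε0 : ∀ k, 0 < ε k := fun k => by positivity
  have hεle : ∀ k, ε k * (‖e‖ + θ + 1) ≤ ρ / 2 := fun k => by
    have : (1 / ((k : ℝ) + 1)) ≤ 1 := by
      rw [div_le_one (by positivity)]; linarith [Nat.cast_nonneg (α := ℝ) k]
    calc ε k * (‖e‖ + θ + 1) ≤ (ρ / (2 * (‖e‖ + θ + 1))) * 1 * (‖e‖ + θ + 1) := by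
          simp only [ε]; gcongr
      _ = ρ / 2 := by field_simp
  have hεt : Tendsto ε atTop (𝓝 0) := by
    have := (tendsto_one_div_add_atTop_nhds_zero_nat (𝕜 := ℝ)).const_mul (ρ / (2 * (‖e‖ + θ + 1)))
    rwa [mul_zero] at this
  let L := ContinuousLinearMap.lsmul ℝ ℝ (E := ℝ)
  let φ : ℕ → Euc n → ℝ := fun k => MeasureTheory.convolution w (mollKernel η (ε k)) L volume
  have hwl : LocallyIntegrable w volume := hw2.locallyIntegrable (by norm_num)
  have hφ : ∀ k, ContDiff ℝ ∞ (φ k) := fun k =>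
    (hasCompactSupport_mollKernel hηs (hε0 k)).contDiff_convolution_right L hwl
      (contDiff_mollKernel hηc)
  have hφv : ∀ k y, φ k y = ∫ z, w (y + ε k • z) ∂ν := fun k y => by
    rw [hνi, ← integral_mul_mollKernel (hε0 k)]
    simp only [φ, convolution_def]
    refine integral_congr_ae (ae_of_all _ fun t => ?_)
    simp [L, mul_comm]
  have hz : ∀ k, ∀ z ∈ tsupport η, ‖ε k • z‖ < ρ / 2 := fun k z hz => by
    rw [hηt, Metric.mem_closedBall, dist_eq_norm] at hz
    have : ‖z‖ < ‖e‖ + θ + 1 := by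
      calc ‖z‖ = ‖(z - e) + e‖ := by congr 1; abel
        _ ≤ ‖z - e‖ + ‖e‖ := norm_add_le _ _
        _ < _ := by linarith
    rw [norm_smul, Real.norm_of_nonneg (hε0 k).le]
    exact (mul_lt_mul_of_pos_left this (hε0 k)).trans_le (hεle k)
  have hfar : ∀ k, ∀ y, y ∉ Metric.ball x ρ → ∀ z ∈ tsupport η,
      y + ε k • z ∉ Ω ∩ Metric.ball x (ρ / 2) := fun k y hy z hzη hmem => hy (by
    have h1 := hz k z hzη
    have h2 := hmem.2
    rw [Metric.mem_ball, dist_eq_norm] at h2 ⊢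
    calc ‖y - x‖ = ‖(y + ε k • z - x) - ε k • z‖ := by congr 1; abel
      _ ≤ ‖y + ε k • z - x‖ + ‖ε k • z‖ := norm_sub_le _ _
      _ < ρ := by linarith)
  -- the gradient of the mollification is the mollified weak gradient, up to the boundary
  have hgrad : ∀ k, ∀ y ∈ Ω, gradient (φ k) y = ∫ z, G (y + ε k • z) ∂ν := fun k y hy => by
    refine ext_inner_right ℝ fun v => ?_
    have hker := contDiff_mollKernel (ε := ε k) hηc
    have hkers := hasCompactSupport_mollKernel hηs (hε0 k)
    have hd := hkers.hasFDerivAt_convolution_right L hwl (hker.of_le (by simp)) y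
    have hgr : ⟪gradient (φ k) y, v⟫ = ∫ t, w t * fderiv ℝ (mollKernel η (ε k)) (y - t) v := by
      rw [gradient, InnerProductSpace.toDual_symm_apply, hd.fderiv,
        convolution_precompR_apply L hwl (hkers.fderiv ℝ) (hker.continuous_fderiv (by simp)),
        convolution_def]
      rfl
    have ht : ∀ t, y - t ∈ tsupport (mollKernel η (ε k)) →
        ∃ z ∈ tsupport η, t = y + ε k • z := fun t ht => by
      refine ⟨_, tsupport_mollKernel ht, ?_⟩
      rw [smul_smul, mul_neg, mul_inv_cancel₀ (hε0 k).ne', neg_one_smul]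
      abel
    by_cases hyx : y ∈ Metric.ball x ρ
    · -- the translated kernel is a test function on `Ω`, by the cone condition
      let ψ : Euc n → ℝ := fun t => mollKernel η (ε k) (y - t)
      have hψc : ContDiff ℝ ∞ ψ := hker.comp (contDiff_const.sub contDiff_id)
      have hψs : HasCompactSupport ψ := hkers.comp_homeomorph (Homeomorph.subLeft y)
      have hψt : tsupport ψ ⊆ Ω := fun t htt => by
        have h1 : y - t ∈ tsupport (mollKernel η (ε k)) := by
          have hcl : IsClosed {t : Euc n | y - t ∈ tsupport (mollKernel η (ε k))} :=
            (isClosed_tsupport _).preimage (continuous_const.sub continuous_id)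
          exact closure_minimal (s := Function.support ψ)
            (fun t ht => show y - t ∈ tsupport (mollKernel η (ε k)) from subset_tsupport _ ht) hcl htt
        obtain ⟨z, hzη, rfl⟩ := ht t h1
        rw [hηt] at hzη
        refine hc y ⟨hy, hyx⟩ _ (hε0 k).le ?_ z (Metric.closedBall_subset_ball (by linarith) hzη)
        have := hεle k
        nlinarith [norm_nonneg e, hε0 k]
      have hψd : ∀ t, fderiv ℝ ψ t v = -fderiv ℝ (mollKernel η (ε k)) (y - t) v := fun t => by
        have := ((hker.differentiable (by simp) (y - t)).hasFDerivAt).comp t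
          ((hasFDerivAt_id t).const_sub y)
        have h2 : HasFDerivAt ψ _ t := this
        rw [h2.fderiv]
        simp
      have key := hw.2.2 ψ hψc hψs hψt v
      have e1 : ∫ t in Ω, w t * fderiv ℝ ψ t v = ∫ t, w t * fderiv ℝ ψ t v :=
        setIntegral_eq_integral_of_forall_compl_eq_zero fun t ht => by
          rw [hw0 t fun h => ht h.1, zero_mul]
      have e2 : ∫ t in Ω, ⟪G t, v⟫ * ψ t = ∫ t, ⟪G t, v⟫ * ψ t :=
        setIntegral_eq_integral_of_forall_compl_eq_zero fun t ht => by
          rw [hG0 t fun h => ht h.1, inner_zero_left, zero_mul]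
      rw [e1, e2] at key
      simp only [hψd, mul_neg, integral_neg, neg_inj] at key
      rw [hgr, key, hνi, ← integral_mul_mollKernel (hε0 k), real_inner_comm, ← integral_inner]
      · refine integral_congr_ae (ae_of_all _ fun t => ?_)
        simp only [inner_smul_right, ψ, real_inner_comm]
        ring
      · have hGl : LocallyIntegrable G volume := hG2.locallyIntegrable (by norm_num)
        have hi : IntegrableOn G (tsupport ψ) := hGl.integrableOn_isCompact hψs
        have h2 : IntegrableOn (fun t => ψ t • G t) (tsupport ψ) :=
          hi.continuousOn_smul hψc.continuous.continuousOn hψs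
        refine (integrableOn_iff_integrable_of_support_subset ?_).1 h2
        intro t ht
        exact subset_tsupport _ (left_ne_zero_of_smul ht)
    -- away from `x` the shifted points miss the support, and both sides vanish
    · have e1 : ∫ t, w t * fderiv ℝ (mollKernel η (ε k)) (y - t) v = 0 := by
        refine integral_eq_zero_of_ae (ae_of_all _ fun t => ?_)
        by_cases htt : y - t ∈ tsupport (mollKernel η (ε k))
        · obtain ⟨z, hzη, rfl⟩ := ht t htt
          simp [hw0 _ (hfar k y hyx z hzη)]
        · simp [fderiv_of_notMem_tsupport ℝ htt]
      have e2 : ∫ z, G (y + ε k • z) ∂ν = 0 := by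
        rw [hνi]
        refine integral_eq_zero_of_ae (ae_of_all _ fun z => ?_)
        by_cases hzη : z ∈ tsupport η
        · simp [hG0 _ (hfar k y hyx z hzη)]
        · simp [image_eq_zero_of_notMem_tsupport hzη]
      rw [hgr, e1, e2, inner_zero_left]
  refine ⟨φ, hφ, ?_⟩
  have t1 := (tendsto_lsq_average hw2 hwm hνR).comp hεt
  have t2 := (tendsto_lsq_average hG2 hGm hνR).comp hεt
  have t3 := t1.add t2
  rw [add_zero] at t3
  refine tendsto_of_tendsto_of_tendsto_of_le_of_le tendsto_const_nhds t3 (fun _ => zero_le)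
    fun k => ?_
  refine add_le_add ?_ ?_
  · refine (lsq_mono_measure Measure.restrict_le_self).trans (le_of_eq ?_)
    refine lsq_congr (ae_of_all _ fun y => ?_)
    simp [hφv]
  · refine le_of_eq_of_le ?_ (lsq_mono_measure (Measure.restrict_le_self (s := Ω)))
    refine lsq_congr ((ae_restrict_iff' hΩ.measurableSet).2 (ae_of_all _ fun y hy => ?_))
    simp [hgrad k y hy]

/-- `(u, G)` is a limit in `H¹(Ω)` of functions smooth on the whole space. -/
def SmoothLimit (Ω : Set (Euc n)) (u : Euc n → ℝ) (G : Euc n → Euc n) : Prop :=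
  ∃ φ : ℕ → Euc n → ℝ, (∀ k, ContDiff ℝ ∞ (φ k)) ∧
    Tendsto (fun k => energy Ω (φ k - u) (gradient (φ k) - G)) atTop (𝓝 0)

lemma gradient_add {φ ψ : Euc n → ℝ} (hφ : Differentiable ℝ φ) (hψ : Differentiable ℝ ψ) :
    gradient (φ + ψ) = gradient φ + gradient ψ := by
  funext x
  simp [gradient, fderiv_add (hφ x) (hψ x)]

lemma gradient_sub {φ ψ : Euc n → ℝ} (hφ : Differentiable ℝ φ) (hψ : Differentiable ℝ ψ) :
    gradient (φ - ψ) = gradient φ - gradient ψ := by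
  funext x
  simp [gradient, fderiv_sub (hφ x) (hψ x)]

section SmoothLimit

variable {Ω : Set (Euc n)} {u v : Euc n → ℝ} {G G' : Euc n → Euc n}

lemma energy_congr (hu : u =ᵐ[volume.restrict Ω] v) (hG : G =ᵐ[volume.restrict Ω] G') :
    energy Ω u G = energy Ω v G' := by
  rw [energy, energy, lsq_congr hu, lsq_congr hG]

lemma SmoothLimit.congr (h : SmoothLimit Ω u G) (hu : u =ᵐ[volume.restrict Ω] v)
    (hG : G =ᵐ[volume.restrict Ω] G') : SmoothLimit Ω v G' := by
  obtain ⟨φ, hφ, ht⟩ := h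
  refine ⟨φ, hφ, ht.congr fun k => energy_congr ?_ ?_⟩
  · exact hu.mono fun x hx => by simp [hx]
  · exact hG.mono fun x hx => by simp [hx]

lemma SmoothLimit.zero : SmoothLimit Ω (0 : Euc n → ℝ) 0 := by
  refine ⟨fun _ => 0, fun _ => contDiff_const, ?_⟩
  have : gradient (0 : Euc n → ℝ) = 0 := by funext x; simp [gradient]
  simp [this, energy, lsq]

lemma SmoothLimit.add (hb : Bornology.IsBounded Ω) (h : SmoothLimit Ω u G)
    (h' : SmoothLimit Ω v G') (hu : HasH1Grad Ω u G) : SmoothLimit Ω (u + v) (G + G') := by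
  obtain ⟨φ, hφ, ht⟩ := h
  obtain ⟨ψ, hψ, ht'⟩ := h'
  refine ⟨fun k => φ k + ψ k, fun k => (hφ k).add (hψ k), ?_⟩
  have hlim : Tendsto (fun k => 2 * energy Ω (φ k - u) (gradient (φ k) - G)
      + 2 * energy Ω (ψ k - v) (gradient (ψ k) - G')) atTop (𝓝 0) := by
    simpa using (ENNReal.Tendsto.const_mul ht (Or.inr (by simp))).add
      (ENNReal.Tendsto.const_mul ht' (Or.inr (by simp)))
  refine tendsto_of_tendsto_of_tendsto_of_le_of_le tendsto_const_nhds hlim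
    (fun _ => zero_le) fun k => ?_
  have h1 := energy_add_le (v := ψ k - v) (G' := gradient (ψ k) - G')
    ((hasH1Grad_of_contDiff hb ((hφ k).of_le (by simp))).sub hu)
  refine le_trans (le_of_eq ?_) h1
  rw [gradient_add ((hφ k).differentiable (by simp)) ((hψ k).differentiable (by simp))]
  congr 1
  · exact add_sub_add_comm _ _ _ _
  · exact add_sub_add_comm _ _ _ _

lemma SmoothLimit.sum {ι : Type*} (hb : Bornology.IsBounded Ω) (s : Finset ι)
    {w : ι → Euc n → ℝ} {H : ι → Euc n → Euc n} (h : ∀ i, SmoothLimit Ω (w i) (H i))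
    (hw : ∀ i, HasH1Grad Ω (w i) (H i)) :
    SmoothLimit Ω (∑ i ∈ s, w i) (∑ i ∈ s, H i) ∧
      HasWeakGrad Ω (∑ i ∈ s, w i) (∑ i ∈ s, H i) := by
  classical
  induction s using Finset.induction_on with
  | empty =>
    refine ⟨by simpa using SmoothLimit.zero, ?_⟩
    have := (hasWeakGrad_of_contDiff (Ω := Ω) (contDiff_const (c := (0 : ℝ)) (n := 1)))
    refine this.congr ?_ ?_
    · exact ae_of_all _ fun x => by simp
    · exact ae_of_all _ fun x => by simp [gradient]
  | insert i s hi ih =>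
    rw [Finset.sum_insert hi, Finset.sum_insert hi]
    exact ⟨(h i).add hb ih.1 (hw i), (hw i).3.add ih.2⟩

end SmoothLimit

open scoped Manifold in
/-- A finite smooth partition of unity on a compact set, subordinate to balls. -/
lemma exists_smooth_partition {K : Set (Euc n)} (hK : IsCompact K) (ρ : Euc n → ℝ)
    (hρ : ∀ x ∈ K, 0 < ρ x) :
    ∃ (t : Finset (Euc n)) (χ : t → Euc n → ℝ), (∀ i : t, (i : Euc n) ∈ K) ∧
      (∀ i, ContDiff ℝ ∞ (χ i)) ∧ (∀ i, tsupport (χ i) ⊆ Metric.ball (i : Euc n) (ρ i)) ∧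
      (∀ x ∈ K, ∑ i, χ i x = 1) := by
  obtain ⟨t, htK, ht⟩ := hK.elim_nhds_subcover (fun x => Metric.ball x (ρ x))
    fun x hx => Metric.ball_mem_nhds x (hρ x hx)
  obtain ⟨f, hf⟩ := SmoothPartitionOfUnity.exists_isSubordinate 𝓘(ℝ, Euc n) hK.isClosed
    (fun i : t => Metric.ball (i : Euc n) (ρ i)) (fun _ => Metric.isOpen_ball)
    (by simpa [iUnion_subtype] using ht)
  refine ⟨t, fun i => f i, fun i => htK i i.2, fun i => (f i).contMDiff.contDiff, hf,
    fun x hx => ?_⟩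
  have := f.sum_eq_one hx
  rwa [finsum_eq_sum_of_fintype] at this

/-- **Density of smooth functions** in `H¹(Ω)` for bounded Lipschitz domains: a partition of unity
reduces the claim to functions supported where one cone works, and these are mollified into it. -/
theorem smoothLimit_of_hasH1Grad {Ω : Set (Euc n)} (hΩ : IsOpen Ω) (hb : Bornology.IsBounded Ω)
    (hL : HasLipschitzBoundary Ω) {u : Euc n → ℝ} {G : Euc n → Euc n} (h : HasH1Grad Ω u G) :
    SmoothLimit Ω u G := by
  -- extend by zero to everywhere defined, strongly measurable functions
  set u' : Euc n → ℝ := Ω.indicator (h.1.1.mk u) with hu'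
  set G' : Euc n → Euc n := Ω.indicator (h.2.1.mk G) with hG'
  have eu : u =ᵐ[volume.restrict Ω] u' := h.1.1.ae_eq_mk.trans
    (indicator_ae_eq_restrict hΩ.measurableSet).symm
  have eG : G =ᵐ[volume.restrict Ω] G' := h.2.1.ae_eq_mk.trans
    (indicator_ae_eq_restrict hΩ.measurableSet).symm
  have mu : StronglyMeasurable u' := h.1.1.stronglyMeasurable_mk.indicator hΩ.measurableSet
  have mG : StronglyMeasurable G' := h.2.1.stronglyMeasurable_mk.indicator hΩ.measurableSet
  have u2 : MemLp u' 2 volume :=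
    (memLp_indicator_iff_restrict hΩ.measurableSet).2 (h.1.ae_eq h.1.1.ae_eq_mk)
  have G2 : MemLp G' 2 volume :=
    (memLp_indicator_iff_restrict hΩ.measurableSet).2 (h.2.ae_eq h.2.1.ae_eq_mk)
  have hw : HasWeakGrad Ω u' G' := h.3.congr eu eG
  have u0 : ∀ y, y ∉ Ω → u' y = 0 := fun y hy => indicator_of_notMem hy _
  have G0 : ∀ y, y ∉ Ω → G' y = 0 := fun y hy => indicator_of_notMem hy _
  have hcone : ∀ x, ∃ e θ ρ, x ∈ closure Ω → ConeAt Ω x e θ ρ := fun x => by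
    by_cases hx : x ∈ closure Ω
    · obtain ⟨e, θ, ρ, hc⟩ := exists_coneAt hΩ hL hx
      exact ⟨e, θ, ρ, fun _ => hc⟩
    · exact ⟨0, 0, 0, fun h => absurd h hx⟩
  choose e θ ρ hc using hcone
  obtain ⟨t, χ, htK, hχ, hsub, hsum⟩ := exists_smooth_partition hb.isCompact_closure
    (fun x => ρ x / 2) fun x hx => half_pos (hc x hx).2.1
  have hcs : ∀ i, HasCompactSupport (χ i) := fun i =>
    (isCompact_closedBall (i : Euc n) (ρ i / 2)).of_isClosed_subset (isClosed_tsupport _)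
      ((hsub i).trans Metric.ball_subset_closedBall)
  have hloc : ∀ i, SmoothLimit Ω (fun x => χ i x * u' x)
      (fun x => χ i x • G' x + u' x • gradient (χ i) x) ∧
      HasH1Grad Ω (fun x => χ i x * u' x)
        (fun x => χ i x • G' x + u' x • gradient (χ i) x) := fun i => by
    have hgc := continuous_gradient ((hχ i).of_le (by simp))
    obtain ⟨A, hA⟩ := (hcs i).exists_bound_of_continuous (hχ i).continuous
    have hgs : HasCompactSupport (gradient (χ i)) :=
      ((hcs i).fderiv ℝ).comp_left (g := (InnerProductSpace.toDual ℝ (Euc n)).symm) (by simp)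
    obtain ⟨B, hB⟩ := hgs.exists_bound_of_continuous hgc
    have m1 : StronglyMeasurable fun x => χ i x * u' x :=
      (hχ i).continuous.stronglyMeasurable.mul mu
    have m2 : StronglyMeasurable fun x => χ i x • G' x :=
      (hχ i).continuous.stronglyMeasurable.smul mG
    have m3 : StronglyMeasurable fun x => u' x • gradient (χ i) x :=
      mu.smul hgc.stronglyMeasurable
    have l1 : MemLp (fun x => χ i x * u' x) 2 volume :=
      u2.of_le_mul (c := A) m1.aestronglyMeasurable (ae_of_all _ fun x => by
        rw [norm_mul]; gcongr; exact hA x)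
    have l2 : MemLp (fun x => χ i x • G' x) 2 volume :=
      G2.of_le_mul (c := A) m2.aestronglyMeasurable (ae_of_all _ fun x => by
        rw [norm_smul]; gcongr; exact hA x)
    have l3 : MemLp (fun x => u' x • gradient (χ i) x) 2 volume :=
      u2.of_le_mul (c := B) m3.aestronglyMeasurable (ae_of_all _ fun x => by
        rw [norm_smul, mul_comm]; gcongr; exact hB x)
    have hwg := hw.mul_contDiff hΩ (hχ i)
    -- the localized function and its gradient vanish outside the part of `Ω` in the small ball
    have hz : ∀ y, y ∉ Ω ∩ Metric.ball (i : Euc n) (ρ i / 2) →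
        (χ i y = 0 ∧ gradient (χ i) y = 0) ∨ (u' y = 0 ∧ G' y = 0) := fun y hy => by
      by_cases hyΩ : y ∈ Ω
      · have hyt : y ∉ tsupport (χ i) := fun h => hy ⟨hyΩ, hsub i h⟩
        refine Or.inl ⟨image_eq_zero_of_notMem_tsupport hyt, ?_⟩
        rw [gradient, fderiv_of_notMem_tsupport ℝ hyt, map_zero]
      · exact Or.inr ⟨u0 y hyΩ, G0 y hyΩ⟩
    refine ⟨exists_contDiff_tendsto_of_coneAt hΩ hwg l1 (l2.add l3) m1 (m2.add m3)
      (hc i (htK i)) (fun y hy => ?_) (fun y hy => ?_), ?_⟩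
    · rcases hz y hy with h | h <;> simp [h.1]
    · rcases hz y hy with h | h <;> simp [h.1, h.2]
    · exact ⟨l1.mono_measure Measure.restrict_le_self,
        (l2.add l3).mono_measure Measure.restrict_le_self, hwg⟩
  obtain ⟨hS, hWS⟩ := SmoothLimit.sum hb Finset.univ (fun i => (hloc i).1) (fun i => (hloc i).2)
  have esum : (∑ i, fun x => χ i x * u' x) =ᵐ[volume.restrict Ω] u := by
    refine EventuallyEq.trans ?_ eu.symm
    refine (ae_restrict_iff' hΩ.measurableSet).2 (ae_of_all _ fun x hx => ?_)
    rw [Finset.sum_apply, ← Finset.sum_mul, hsum x (subset_closure hx), one_mul]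
  refine hS.congr esum ?_
  exact (hWS.congr esum ae_eq_rfl).ae_unique hΩ h.3

/-! ### The trace inequality for smooth functions -/

/-- The trace inequality on an interval, from `f 0 = f t - ∫ f'` averaged over `t`. -/
lemma lintegral_one_dim_trace {f f' : ℝ → ℝ} (hf : ∀ t, HasDerivAt f (f' t) t)
    (hc : Continuous f') {δ : ℝ} :
    ENNReal.ofReal δ * ‖f 0‖ₑ ^ 2 ≤ 2 * lsq (volume.restrict (Ioo 0 δ)) f +
      2 * ENNReal.ofReal δ ^ 2 * lsq (volume.restrict (Ioo 0 δ)) f' := by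
  set A := lsq (volume.restrict (Ioo 0 δ)) f' with hA
  have hfc : Continuous f := continuous_iff_continuousAt.2 fun t => (hf t).continuousAt
  have h1 : ∀ t ∈ Ioo 0 δ, ‖f 0‖ₑ ^ 2 ≤ 2 * ‖f t‖ₑ ^ 2 + 2 * (ENNReal.ofReal δ * A) := by
    intro t ht
    have hint : ∫ s in Ioc 0 t, f' s = f t - f 0 := by
      rw [← intervalIntegral.integral_of_le ht.1.le]
      exact intervalIntegral.integral_eq_sub_of_hasDerivAt (fun s _ => hf s)
        (hc.intervalIntegrable _ _)
    have e1 : f 0 = f t - ∫ s in Ioc 0 t, f' s := by rw [hint]; ring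
    have h2 : ‖∫ s in Ioc 0 t, f' s‖ₑ ^ 2 ≤ ENNReal.ofReal δ * A := by
      refine (enorm_integral_sq_le hc.aestronglyMeasurable).trans ?_
      refine mul_le_mul' ?_ (lsq_mono_measure (Measure.restrict_mono ?_ le_rfl))
      · simp only [Measure.restrict_apply_univ, Real.volume_Ioc, sub_zero]
        exact ENNReal.ofReal_le_ofReal ht.2.le
      · exact fun s hs => ⟨hs.1, hs.2.trans_lt ht.2⟩
    rw [e1]
    exact (enorm_sub_sq_le _ _).trans (by gcongr)
  calc ENNReal.ofReal δ * ‖f 0‖ₑ ^ 2 = ∫⁻ _ in Ioo 0 δ, ‖f 0‖ₑ ^ 2 := by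
        simp [mul_comm]
    _ ≤ ∫⁻ t in Ioo 0 δ, (2 * ‖f t‖ₑ ^ 2 + 2 * (ENNReal.ofReal δ * A)) :=
        setLIntegral_mono' measurableSet_Ioo h1
    _ = 2 * lsq (volume.restrict (Ioo 0 δ)) f + 2 * ENNReal.ofReal δ ^ 2 * A := by
        rw [lintegral_add_right _ measurable_const, lintegral_const_mul' _ _ (by simp)]
        simp only [lintegral_const, Measure.restrict_apply_univ, Real.volume_Ioo, sub_zero, lsq]
        ring

lemma inner_orthogonal_span {e : Euc n} (h : (ℝ ∙ e)ᗮ) : ⟪e, (h : Euc n)⟫ = 0 :=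
  Submodule.mem_orthogonal_singleton_iff_inner_right.1 h.2

/-- The parametrization `h ↦ h + ψ(h) e` of a graph over the hyperplane orthogonal to `e`. -/
def graphMap (e : Euc n) (ψ : Euc n → ℝ) (h : (ℝ ∙ e)ᗮ) : Euc n := (h : Euc n) + ψ h • e

lemma lipschitzWith_graphMap {e : Euc n} (he : ‖e‖ = 1) {ψ : Euc n → ℝ} {L : ℝ≥0}
    (hψ : LipschitzWith L ψ) : LipschitzWith (1 + L) (graphMap e ψ) := by
  refine LipschitzWith.of_dist_le_mul fun h h' => ?_
  have h1 := hψ.dist_le_mul (h : Euc n) h'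
  rw [Real.dist_eq] at h1
  rw [dist_eq_norm]
  have : graphMap e ψ h - graphMap e ψ h' = ((h : Euc n) - h') + (ψ h - ψ h') • e := by
    simp only [graphMap, sub_smul]; abel
  rw [this]
  calc ‖((h : Euc n) - h') + (ψ h - ψ h') • e‖ ≤ ‖(h : Euc n) - h'‖ + ‖(ψ h - ψ h') • e‖ :=
        norm_add_le _ _
    _ ≤ dist (h : Euc n) h' + L * dist (h : Euc n) h' := by
        rw [norm_smul, he, mul_one, Real.norm_eq_abs, dist_eq_norm]
        gcongr
        rwa [dist_eq_norm] at h1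
    _ = _ := by rw [Subtype.dist_eq]; push_cast; ring

lemma euclideanHausdorff_image_le {X Y : Type*} [EMetricSpace X] [MeasurableSpace X] [BorelSpace X]
    [EMetricSpace Y] [MeasurableSpace Y] [BorelSpace Y] {f : X → Y} {K : ℝ≥0}
    (hf : LipschitzWith K f) (d : ℕ) (s : Set X) :
    (Measure.euclideanHausdorffMeasure d : Measure Y) (f '' s) ≤
      (K : ℝ≥0∞) ^ d * (Measure.euclideanHausdorffMeasure d : Measure X) s := by
  have h := hf.hausdorffMeasure_image_le (d := d) (Nat.cast_nonneg d) s
  simp only [Measure.euclideanHausdorffMeasure_def, Measure.smul_apply]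
  rw [ENNReal.rpow_natCast] at h
  simp only [ENNReal.smul_def, smul_eq_mul]
  calc _ ≤ _ := mul_le_mul_right h _
    _ = _ := by ring

/-- The surface measure of a Lipschitz graph is controlled by the Lebesgue measure of the
parameter hyperplane. -/
lemma surf_graph_le {e : Euc n} (he : ‖e‖ = 1) {ψ : Euc n → ℝ} {L : ℝ≥0}
    (hψ : LipschitzWith L ψ) :
    surf (range (graphMap e ψ)) ≤ ((1 + L : ℝ≥0) : ℝ≥0∞) ^ (n - 1) •
      (Measure.euclideanHausdorffMeasure (n - 1) : Measure ↥(ℝ ∙ e)ᗮ).map (graphMap e ψ) := by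
  have hg := lipschitzWith_graphMap he hψ
  refine Measure.le_iff.2 fun s hs => ?_
  rw [surf, Measure.restrict_apply hs, Measure.smul_apply,
    Measure.map_apply hg.continuous.measurable hs, ← image_preimage_eq_inter_range]
  exact euclideanHausdorff_image_le hg _ _

/-- Cavalieri's principle for the coordinates `h + t e`, `h ⟂ e`. -/
lemma exists_lintegral_orthogonal {e : Euc n} (he : ‖e‖ = 1) :
    ∃ c : ℝ≥0, ∀ F : Euc n → ℝ≥0∞, Measurable F →
      ∫⁻ h : ↥(ℝ ∙ e)ᗮ, (∫⁻ t : ℝ, F ((h : Euc n) + t • e))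
        ∂(Measure.euclideanHausdorffMeasure (n - 1)) = c * ∫⁻ x, F x := by
  have hn : 1 ≤ n := by
    rcases Nat.eq_zero_or_pos n with rfl | h
    · exfalso
      have : e = 0 := Subsingleton.elim _ _
      simp [this] at he
    · exact h
  have he0 : e ≠ 0 := by rintro rfl; simp at he
  have hfin : Module.finrank ℝ ↥(ℝ ∙ e)ᗮ = n - 1 := by
    have : Fact (Module.finrank ℝ (Euc n) = (n - 1) + 1) := ⟨by simp; omega⟩
    exact Submodule.finrank_orthogonal_span_singleton he0
  have hHaar : (Measure.euclideanHausdorffMeasure (n - 1) :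
      Measure ↥(ℝ ∙ e)ᗮ).IsAddHaarMeasure := by
    rw [← hfin]; infer_instance
  have hee : ⟪e, e⟫ = (1 : ℝ) := by rw [real_inner_self_eq_norm_sq, he]; norm_num
  let Φ : (↥(ℝ ∙ e)ᗮ × ℝ) ≃ₗ[ℝ] Euc n := LinearEquiv.ofBijective
    ((ℝ ∙ e)ᗮ.subtype.coprod (LinearMap.toSpanSingleton ℝ (Euc n) e)) (by
      constructor
      · rw [← LinearMap.ker_eq_bot, LinearMap.ker_eq_bot']
        rintro ⟨h, t⟩ h0
        simp only [LinearMap.coprod_apply, Submodule.subtype_apply,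
          LinearMap.toSpanSingleton_apply] at h0
        have ht : t = 0 := by
          have := congrArg (fun y => ⟪e, y⟫) h0
          simpa [inner_add_right, inner_smul_right, hee, inner_orthogonal_span, he0] using this
        subst ht
        simpa using h0
      · intro y
        refine ⟨(⟨y - ⟪e, y⟫ • e, ?_⟩, ⟪e, y⟫), by simp⟩
        rw [Submodule.mem_orthogonal_singleton_iff_inner_right, inner_sub_right, inner_smul_right,
          hee]
        ring)
  let ν : Measure ↥(ℝ ∙ e)ᗮ := Measure.euclideanHausdorffMeasure (n - 1)
  have : ν.IsAddHaarMeasure := hHaar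
  have hm : ((ν.prod (volume : Measure ℝ)).map Φ.toContinuousLinearEquiv).IsAddHaarMeasure :=
    ContinuousLinearEquiv.isAddHaarMeasure_map _ _
  refine ⟨Measure.addHaarScalarFactor ((ν.prod (volume : Measure ℝ)).map
    Φ.toContinuousLinearEquiv) volume, fun F hF => ?_⟩
  have h1 := Measure.isAddLeftInvariant_eq_smul ((ν.prod (volume : Measure ℝ)).map
    Φ.toContinuousLinearEquiv) volume
  have h2 : ∫⁻ x, F x ∂((ν.prod (volume : Measure ℝ)).map Φ.toContinuousLinearEquiv)
      = ∫⁻ h, (∫⁻ t : ℝ, F ((h : Euc n) + t • e)) ∂ν := by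
    have hΦ : Measurable Φ.toContinuousLinearEquiv :=
      Φ.toContinuousLinearEquiv.continuous.measurable
    rw [lintegral_map hF hΦ]
    exact lintegral_prod (fun z => F (Φ.toContinuousLinearEquiv z)) (hF.comp hΦ).aemeasurable
  rw [← h2]
  refine (congrArg (fun m => ∫⁻ x, F x ∂m) h1).trans ?_
  rw [lintegral_smul_measure]
  rfl

/-- Where an open set is a strict epigraph its boundary lies on the graph. -/
lemma frontier_eq_of_epigraph {Ω : Set (Euc n)} (hΩ : IsOpen Ω) {x e : Euc n} {ψ : Euc n → ℝ}
    (hψ : Continuous ψ) {ρ : ℝ}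
    (hmem : ∀ y ∈ Metric.ball x ρ, y ∈ Ω ↔ ψ (y - ⟪e, y⟫ • e) < ⟪e, y⟫) {y : Euc n}
    (hy : y ∈ Metric.ball x ρ) (hyf : y ∈ frontier Ω) : ψ (y - ⟪e, y⟫ • e) = ⟪e, y⟫ := by
  have h1 : y ∉ Ω := fun h => by
    have := hyf.2
    rw [hΩ.interior_eq] at this
    exact this h
  refine le_antisymm ?_ (not_lt.1 fun h => h1 ((hmem y hy).2 h))
  by_contra! hlt
  have hopen : IsOpen {z : Euc n | ⟪e, z⟫ < ψ (z - ⟪e, z⟫ • e)} :=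
    isOpen_lt (by fun_prop) (by fun_prop)
  obtain ⟨z, ⟨hz1, hz2⟩, hzΩ⟩ := mem_closure_iff.1 hyf.1 _ (hopen.inter Metric.isOpen_ball)
    ⟨hlt, hy⟩
  exact lt_asymm hz1 ((hmem z hz2).1 hzΩ)

/-- Near a boundary point, apply the trace inequality on an interval along the axis `e` over each
point of the graph and integrate over the graph; the segments stay in `Ω` and, by Cavalieri's
principle, their union carries a multiple of Lebesgue measure. -/
lemma exists_local_trace_le {Ω : Set (Euc n)} (hΩ : IsOpen Ω) (hL : HasLipschitzBoundary Ω)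
    {x : Euc n} (hx : x ∈ frontier Ω) :
    ∃ (ρ : ℝ) (C : ℝ≥0∞), 0 < ρ ∧ C ≠ ⊤ ∧ ∀ φ : Euc n → ℝ, ContDiff ℝ 1 φ →
      lsq (surf (frontier Ω ∩ Metric.ball x ρ)) φ ≤ C * energy Ω φ (gradient φ) := by
  obtain ⟨e, L, ψ, r, he, hψ, hr, hmem⟩ := hL x hx
  obtain ⟨c, hc⟩ := exists_lintegral_orthogonal he
  have hee : ⟪e, e⟫ = (1 : ℝ) := by rw [real_inner_self_eq_norm_sq, he]; norm_num
  set δ : ℝ := r / 4 with hδ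
  have hδ0 : 0 < δ := by positivity
  set D : ℝ≥0∞ := ENNReal.ofReal δ with hD
  have hD0 : D ≠ 0 := by simpa [hD] using hδ0
  have hDt : D ≠ ⊤ := ENNReal.ofReal_ne_top
  set P := frontier Ω ∩ Metric.ball x (r / 2) with hP
  have hPm : MeasurableSet P := isClosed_frontier.measurableSet.inter measurableSet_ball
  set K : ℝ≥0∞ := ((1 + L : ℝ≥0) : ℝ≥0∞) ^ (n - 1) with hK
  have hPg : ∀ y ∈ P, ψ (y - ⟪e, y⟫ • e) = ⟪e, y⟫ := fun y hy =>
    frontier_eq_of_epigraph hΩ hψ.continuous hmem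
      (Metric.ball_subset_ball (by linarith) hy.2) hy.1
  have hPr : P ⊆ range (graphMap e ψ) := fun y hy => by
    refine ⟨⟨y - ⟪e, y⟫ • e, ?_⟩, ?_⟩
    · rw [Submodule.mem_orthogonal_singleton_iff_inner_right, inner_sub_right, inner_smul_right,
        hee]
      ring
    · simp [graphMap, hPg y hy]
  -- radius `r / 2` and length `r / 4` keep the segments within the ball of the local chart
  have hPΩ : ∀ y ∈ P, ∀ t ∈ Ioo 0 δ, y + t • e ∈ Ω := fun y hy t ht => by
    have hyx := hy.2
    rw [Metric.mem_ball, dist_eq_norm] at hyx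
    have hb : y + t • e ∈ Metric.ball x r := by
      rw [Metric.mem_ball, dist_eq_norm]
      calc ‖y + t • e - x‖ = ‖(y - x) + t • e‖ := by congr 1; abel
        _ ≤ ‖y - x‖ + ‖t • e‖ := norm_add_le _ _
        _ = ‖y - x‖ + t := by rw [norm_smul, he, mul_one, Real.norm_of_nonneg ht.1.le]
        _ < r := by linarith [ht.2]
    rw [hmem _ hb]
    have e1 : y + t • e - ⟪e, y + t • e⟫ • e = y - ⟪e, y⟫ • e := by
      rw [inner_add_right, inner_smul_right, hee, mul_one, add_smul]; abel
    rw [e1, hPg y hy, inner_add_right, inner_smul_right, hee]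
    linarith [ht.1]
  have hsurf : surf P ≤ K • ((Measure.euclideanHausdorffMeasure (n - 1) :
      Measure ↥(ℝ ∙ e)ᗮ).map (graphMap e ψ)).restrict P := by
    have h1 := Measure.restrict_mono_measure (surf_graph_le he hψ) P
    rw [Measure.restrict_smul] at h1
    refine le_trans (le_of_eq ?_) h1
    rw [surf, surf, Measure.restrict_restrict hPm, inter_eq_left.2 hPr]
  refine ⟨r / 2, D⁻¹ * (K * (c * (2 + 2 * D ^ 2))), by positivity, ?_, fun φ hφ => ?_⟩
  · refine ENNReal.mul_ne_top (ENNReal.inv_ne_top.2 hD0) (ENNReal.mul_ne_top ?_ ?_)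
    · exact ENNReal.pow_ne_top ENNReal.coe_ne_top
    · exact ENNReal.mul_ne_top ENNReal.coe_ne_top (by
        simp [ENNReal.add_eq_top, ENNReal.mul_eq_top, hDt])
  have hgm := lipschitzWith_graphMap he hψ
  have hgrc := continuous_gradient hφ
  let k : Euc n → ℝ≥0∞ := fun y => 2 * ‖φ y‖ₑ ^ 2 + 2 * D ^ 2 * ‖gradient φ y‖ₑ ^ 2
  have hkm : Measurable k :=
    ((hφ.continuous.measurable.enorm.pow_const 2).const_mul _).add
      ((hgrc.measurable.enorm.pow_const 2).const_mul _)
  have hline : ∀ y, D * ‖φ y‖ₑ ^ 2 ≤ ∫⁻ t in Ioo 0 δ, k (y + t • e) := fun y => by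
    have hd : ∀ t : ℝ, HasDerivAt (fun t : ℝ => φ (y + t • e)) (⟪gradient φ (y + t • e), e⟫) t :=
      fun t => by
        have h1 := (hφ.differentiable (by simp) (y + t • e)).hasFDerivAt
        have h2 : HasDerivAt (fun t : ℝ => y + t • e) e t := by
          simpa using ((hasDerivAt_id t).smul_const e).const_add y
        have := h1.comp_hasDerivAt t h2
        rw [gradient, InnerProductSpace.toDual_symm_apply]
        exact this
    have hcd : Continuous fun t : ℝ => ⟪gradient φ (y + t • e), e⟫ := by fun_prop
    have h1 := lintegral_one_dim_trace hd hcd (δ := δ)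
    simp only [zero_smul, add_zero] at h1
    refine h1.trans ?_
    rw [lintegral_add_left (by
      exact ((hφ.continuous.comp (by fun_prop)).measurable.enorm.pow_const 2).const_mul _),
      lintegral_const_mul' _ _ (by simp), lintegral_const_mul' _ _ (by
        simp [ENNReal.mul_eq_top, hDt])]
    refine add_le_add le_rfl ?_
    refine mul_le_mul_right (lintegral_mono fun t => ?_) _
    have : ‖⟪gradient φ (y + t • e), e⟫‖ ≤ ‖gradient φ (y + t • e)‖ := by
      simpa [he] using norm_inner_le_norm (𝕜 := ℝ) (gradient φ (y + t • e)) e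
    gcongr
    exact enorm_le_iff_norm_le.2 this
  have hkey : D * lsq (surf P) φ ≤ K * (c * ∫⁻ x in Ω, k x) := by
    calc D * lsq (surf P) φ = ∫⁻ y, D * ‖φ y‖ₑ ^ 2 ∂(surf P) := by
          rw [lsq, lintegral_const_mul' _ _ hDt]
      _ ≤ ∫⁻ y, D * ‖φ y‖ₑ ^ 2 ∂(K • ((Measure.euclideanHausdorffMeasure (n - 1) :
            Measure ↥(ℝ ∙ e)ᗮ).map (graphMap e ψ)).restrict P) := lintegral_mono' hsurf le_rfl
      _ = K * ∫⁻ h, P.indicator (fun y => D * ‖φ y‖ₑ ^ 2) (graphMap e ψ h)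
            ∂(Measure.euclideanHausdorffMeasure (n - 1)) := by
          rw [lintegral_smul_measure, ← lintegral_indicator hPm, lintegral_map _
            hgm.continuous.measurable]
          · rfl
          · exact ((hφ.continuous.measurable.enorm.pow_const 2).const_mul _).indicator hPm
      _ ≤ K * ∫⁻ h : ↥(ℝ ∙ e)ᗮ, (∫⁻ t : ℝ, (Ω.indicator k) ((h : Euc n) + t • e))
            ∂(Measure.euclideanHausdorffMeasure (n - 1)) := by
          refine mul_le_mul_right (lintegral_mono fun h => ?_) _
          by_cases hh : graphMap e ψ h ∈ P
          · rw [indicator_of_mem hh]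
            refine (hline _).trans ?_
            rw [← lintegral_add_left_eq_self (fun t : ℝ => Ω.indicator k ((h : Euc n) + t • e))
              (ψ h), ← lintegral_indicator measurableSet_Ioo]
            refine lintegral_mono fun t => ?_
            by_cases ht : t ∈ Ioo 0 δ
            · have e1 : (h : Euc n) + (ψ h + t) • e = graphMap e ψ h + t • e := by
                rw [graphMap, add_smul]; abel
              rw [indicator_of_mem ht]
              simp only [e1]
              rw [indicator_of_mem (hPΩ _ hh t ht)]
            · rw [indicator_of_notMem ht]; exact zero_le
          · rw [indicator_of_notMem hh]; exact zero_le
      _ = K * (c * ∫⁻ x in Ω, k x) := by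
          rw [hc _ (hkm.indicator hΩ.measurableSet), lintegral_indicator hΩ.measurableSet]
  have hk : ∫⁻ x in Ω, k x ≤ (2 + 2 * D ^ 2) * energy Ω φ (gradient φ) := by
    rw [lintegral_add_left ((hφ.continuous.measurable.enorm.pow_const 2).const_mul _),
      lintegral_const_mul' _ _ (by simp), lintegral_const_mul' _ _ (by
        simp [ENNReal.mul_eq_top, hDt]), energy, mul_add]
    refine add_le_add ?_ ?_
    · exact mul_le_mul_left le_self_add _
    · exact mul_le_mul_left le_add_self _
  calc lsq (surf P) φ = D⁻¹ * (D * lsq (surf P) φ) := by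
        rw [← mul_assoc, ENNReal.inv_mul_cancel hD0 hDt, one_mul]
    _ ≤ D⁻¹ * (K * (c * ((2 + 2 * D ^ 2) * energy Ω φ (gradient φ)))) := by
        refine mul_le_mul_right (hkey.trans ?_) _
        exact mul_le_mul_right (mul_le_mul_right hk _) _
    _ = _ := by ring

/-- **Trace inequality** for smooth functions on a bounded Lipschitz domain. -/
theorem exists_trace_le {Ω : Set (Euc n)} (hΩ : IsOpen Ω) (hb : Bornology.IsBounded Ω)
    (hL : HasLipschitzBoundary Ω) :
    ∃ C : ℝ≥0∞, C ≠ ⊤ ∧ ∀ φ : Euc n → ℝ, ContDiff ℝ 1 φ →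
      lsq (surf (frontier Ω)) φ ≤ C * energy Ω φ (gradient φ) := by
  have hloc : ∀ x, ∃ (ρ : ℝ) (C : ℝ≥0∞), x ∈ frontier Ω → 0 < ρ ∧ C ≠ ⊤ ∧
      ∀ φ : Euc n → ℝ, ContDiff ℝ 1 φ →
        lsq (surf (frontier Ω ∩ Metric.ball x ρ)) φ ≤ C * energy Ω φ (gradient φ) := fun x => by
    by_cases hx : x ∈ frontier Ω
    · obtain ⟨ρ, C, h⟩ := exists_local_trace_le hΩ hL hx
      exact ⟨ρ, C, fun _ => h⟩
    · exact ⟨0, 0, fun h => absurd h hx⟩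
  choose ρ C h using hloc
  have hK : IsCompact (frontier Ω) :=
    hb.isCompact_closure.of_isClosed_subset isClosed_frontier frontier_subset_closure
  obtain ⟨t, htK, ht⟩ := hK.elim_nhds_subcover (fun x => Metric.ball x (ρ x))
    fun x hx => Metric.ball_mem_nhds x (h x hx).1
  refine ⟨∑ i : t, C i, ?_, fun φ hφ => ?_⟩
  · exact ENNReal.sum_ne_top.2 fun i _ => (h i (htK i i.2)).2.1
  have hle : surf (frontier Ω) ≤
      Measure.sum fun i : t => surf (frontier Ω ∩ Metric.ball (i : Euc n) (ρ i)) := by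
    refine le_trans (Measure.restrict_mono ?_ le_rfl) Measure.restrict_iUnion_le
    intro y hy
    obtain ⟨i, hi, hyi⟩ := mem_iUnion₂.1 (ht hy)
    exact mem_iUnion.2 ⟨⟨i, hi⟩, hy, hyi⟩
  calc lsq (surf (frontier Ω)) φ ≤ _ := lsq_mono_measure hle
    _ = ∑ i : t, lsq (surf (frontier Ω ∩ Metric.ball (i : Euc n) (ρ i))) φ := by
        rw [lsq, lintegral_sum_measure, tsum_fintype]; rfl
    _ ≤ ∑ i : t, C i * energy Ω φ (gradient φ) :=
        Finset.sum_le_sum fun i _ => (h i (htK i i.2)).2.2 φ hφ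
    _ = _ := by rw [Finset.sum_mul]

/-! ### Existence, uniqueness and continuity of traces -/

lemma tendsto_eLpNorm_iff_lsq {X F ι : Type*} [MeasurableSpace X] [NormedAddCommGroup F]
    {μ : Measure X} {f : ι → X → F} {l : Filter ι} :
    Tendsto (fun k => eLpNorm (f k) 2 μ) l (𝓝 0) ↔ Tendsto (fun k => lsq μ (f k)) l (𝓝 0) := by
  simp only [lsq_eq_eLpNorm_sq]
  constructor
  · intro h
    simpa [Function.comp_def] using ((ENNReal.continuous_pow 2).tendsto 0).comp h
  · intro h
    have := ((ENNReal.continuous_rpow_const (y := 1 / 2)).tendsto 0).comp h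
    simp only [Function.comp_def, ← ENNReal.rpow_natCast, ← ENNReal.rpow_mul] at this
    simpa using this

lemma surf_mono {Γ Γ' : Set (Euc n)} (h : Γ ⊆ Γ') : surf Γ ≤ surf Γ' :=
  Measure.restrict_mono h le_rfl

/-- The boundary has finite area, by the trace inequality for the constant `1`. -/
lemma surf_frontier_lt_top {Ω : Set (Euc n)} (hΩ : IsOpen Ω) (hb : Bornology.IsBounded Ω)
    (hL : HasLipschitzBoundary Ω) : surf (frontier Ω) univ < ⊤ := by
  obtain ⟨C, hC, h⟩ := exists_trace_le hΩ hb hL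
  have h1 := h (fun _ => 1) contDiff_const
  have h2 : lsq (surf (frontier Ω)) (fun _ : Euc n => (1 : ℝ)) = surf (frontier Ω) univ := by
    simp [lsq]
  rw [h2] at h1
  exact h1.trans_lt (ENNReal.mul_lt_top hC.lt_top
    (hasH1Grad_of_contDiff hb contDiff_const).energy_lt_top)

section trace

variable {Ω : Set (Euc n)} {u v γ γ' : Euc n → ℝ} {G G' : Euc n → Euc n}

lemma tendsto_two_mul_add {ι : Type*} {l : Filter ι} {a b : ι → ℝ≥0∞} (ha : Tendsto a l (𝓝 0))
    (hb : Tendsto b l (𝓝 0)) : Tendsto (fun k => 2 * a k + 2 * b k) l (𝓝 0) := by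
  simpa using (ENNReal.Tendsto.const_mul ha (Or.inr (by simp))).add
    (ENNReal.Tendsto.const_mul hb (Or.inr (by simp)))

/-- Traces obey the trace inequality. -/
theorem exists_isTrace_le (hΩ : IsOpen Ω) (hb : Bornology.IsBounded Ω)
    (hL : HasLipschitzBoundary Ω) :
    ∃ C : ℝ≥0∞, C ≠ ⊤ ∧ ∀ (u γ : Euc n → ℝ) (G : Euc n → Euc n), HasH1Grad Ω u G →
      IsTrace Ω u γ → lsq (surf (frontier Ω)) γ ≤ C * energy Ω u G := by
  obtain ⟨C, hC, hle⟩ := exists_trace_le hΩ hb hL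
  refine ⟨4 * C, ENNReal.mul_ne_top (by simp) hC, fun u γ G hu ⟨_, hγ, φ, hφ, h1, h2⟩ => ?_⟩
  have hφ1 : ∀ k, HasH1Grad Ω (φ k) (gradient (φ k)) := fun k =>
    hasH1Grad_of_contDiff hb ((hφ k).of_le (by simp))
  have t1 := tendsto_energy_of_tendsto_h1Norm hΩ (fun k => (hφ1 k).sub hu) h1
  have t2 := tendsto_eLpNorm_iff_lsq.1 h2
  have hk : ∀ k, lsq (surf (frontier Ω)) γ ≤
      2 * lsq (surf (frontier Ω)) (φ k - γ) +
        2 * (C * (2 * energy Ω (φ k - u) (gradient (φ k) - G) + 2 * energy Ω u G)) := fun k => by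
    have e1 : γ = (γ - φ k) + φ k := by abel
    have e2 : energy Ω (φ k) (gradient (φ k)) ≤
        2 * energy Ω (φ k - u) (gradient (φ k) - G) + 2 * energy Ω u G := by
      have := energy_add_le (v := u) (G' := G) ((hφ1 k).sub hu)
      simpa using this
    calc lsq (surf (frontier Ω)) γ
        = lsq (surf (frontier Ω)) ((γ - φ k) + φ k) := by rw [← e1]
      _ ≤ 2 * lsq (surf (frontier Ω)) (γ - φ k) + 2 * lsq (surf (frontier Ω)) (φ k) :=
          lsq_add_le (hγ.1.sub (hφ k).continuous.aestronglyMeasurable)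
      _ ≤ _ := by
          rw [lsq_sub_comm]
          gcongr
          exact (hle _ ((hφ k).of_le (by simp))).trans (by gcongr)
  have hlim : Tendsto (fun k => 2 * lsq (surf (frontier Ω)) (φ k - γ) +
      2 * (C * (2 * energy Ω (φ k - u) (gradient (φ k) - G) + 2 * energy Ω u G))) atTop
      (𝓝 (2 * 0 + 2 * (C * (2 * 0 + 2 * energy Ω u G)))) := by
    refine (ENNReal.Tendsto.const_mul t2 (Or.inr (by simp))).add
      (ENNReal.Tendsto.const_mul (ENNReal.Tendsto.const_mul ?_ (Or.inr hC)) (Or.inr (by simp)))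
    exact (ENNReal.Tendsto.const_mul t1 (Or.inr (by simp))).add tendsto_const_nhds
  have := ge_of_tendsto' hlim hk
  calc _ ≤ _ := this
    _ = _ := by ring

lemma IsTrace.sub (hΩ : IsOpen Ω) (hb : Bornology.IsBounded Ω) (h : IsTrace Ω u γ)
    (h' : IsTrace Ω v γ') : IsTrace Ω (u - v) (γ - γ') := by
  obtain ⟨hu, hγ, φ, hφ, h1, h2⟩ := h
  obtain ⟨hv, hγ', ψ, hψ, h1', h2'⟩ := h'
  obtain ⟨G, hG⟩ := memH1_iff.1 hu
  obtain ⟨G', hG'⟩ := memH1_iff.1 hv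
  have hφ1 : ∀ k, HasH1Grad Ω (φ k) (gradient (φ k)) := fun k =>
    hasH1Grad_of_contDiff hb ((hφ k).of_le (by simp))
  have hψ1 : ∀ k, HasH1Grad Ω (ψ k) (gradient (ψ k)) := fun k =>
    hasH1Grad_of_contDiff hb ((hψ k).of_le (by simp))
  refine ⟨(hG.sub hG').memH1, hγ.sub hγ', fun k => φ k - ψ k, fun k => (hφ k).sub (hψ k), ?_, ?_⟩
  · refine tendsto_h1Norm_of_tendsto_energy hΩ (fun k => ((hφ1 k).sub (hψ1 k)).sub (hG.sub hG')) ?_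
    have t1 := tendsto_energy_of_tendsto_h1Norm hΩ (fun k => (hφ1 k).sub hG) h1
    have t2 := tendsto_energy_of_tendsto_h1Norm hΩ (fun k => (hψ1 k).sub hG') h1'
    refine tendsto_of_tendsto_of_tendsto_of_le_of_le tendsto_const_nhds
      (tendsto_two_mul_add t1 t2) (fun _ => zero_le) fun k => ?_
    rw [sub_sub_sub_comm, sub_sub_sub_comm (gradient (φ k))]
    exact energy_sub_le ((hφ1 k).sub hG)
  · rw [tendsto_eLpNorm_iff_lsq] at h2 h2' ⊢
    refine tendsto_of_tendsto_of_tendsto_of_le_of_le tendsto_const_nhds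
      (tendsto_two_mul_add h2 h2') (fun _ => zero_le) fun k => ?_
    simp only []
    rw [sub_sub_sub_comm]
    exact lsq_sub_le ((hφ k).continuous.aestronglyMeasurable.sub hγ.1)

lemma isTrace_of_contDiff (hb : Bornology.IsBounded Ω) (hΩ : IsOpen Ω)
    (hL : HasLipschitzBoundary Ω) {φ : Euc n → ℝ} (hφ : ContDiff ℝ ∞ φ) : IsTrace Ω φ φ := by
  obtain ⟨C, hC, hle⟩ := exists_trace_le hΩ hb hL
  have h1 := hasH1Grad_of_contDiff hb (hφ.of_le (by simp) : ContDiff ℝ 1 φ)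
  refine ⟨h1.memH1, ?_, fun _ => φ, fun _ => hφ, ?_, ?_⟩
  · exact memLp_of_lsq_lt_top hφ.continuous.aestronglyMeasurable
      ((hle φ (hφ.of_le (by simp))).trans_lt (ENNReal.mul_lt_top hC.lt_top h1.energy_lt_top))
  · refine tendsto_h1Norm_of_tendsto_energy hΩ (fun _ => h1.sub h1) ?_
    simp [energy, lsq]
  · simp

/-- Every function of `H¹(Ω)` on a bounded Lipschitz domain has a trace: by the trace inequality the
boundary values of approximating smooth functions are a Cauchy sequence. -/
theorem exists_isTrace (hΩ : IsOpen Ω) (hb : Bornology.IsBounded Ω)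
    (hL : HasLipschitzBoundary Ω) (hu : MemH1 Ω u) : ∃ γ, IsTrace Ω u γ := by
  obtain ⟨C, hC, hle⟩ := exists_trace_le hΩ hb hL
  obtain ⟨G, hG⟩ := memH1_iff.1 hu
  obtain ⟨φ, hφ, ht⟩ := smoothLimit_of_hasH1Grad hΩ hb hL hG
  have hφ1 : ∀ k, HasH1Grad Ω (φ k) (gradient (φ k)) := fun k =>
    hasH1Grad_of_contDiff hb ((hφ k).of_le (by simp))
  have hmem : ∀ k, MemLp (φ k) 2 (surf (frontier Ω)) := fun k =>
    (isTrace_of_contDiff hb hΩ hL (hφ k)).2.1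
  set e : ℕ → ℝ≥0∞ := fun k => energy Ω (φ k - u) (gradient (φ k) - G) with he
  have hdist : ∀ k l, edist ((hmem k).toLp) ((hmem l).toLp) ^ 2 ≤ C * (2 * e k + 2 * e l) :=
    fun k l => by
      rw [Lp.edist_toLp_toLp, ← lsq_eq_eLpNorm_sq]
      refine (hle _ (((hφ k).sub (hφ l)).of_le (by simp))).trans ?_
      gcongr
      change energy Ω (φ k - φ l) (gradient (φ k - φ l)) ≤ _
      rw [gradient_sub ((hφ k).differentiable (by simp)) ((hφ l).differentiable (by simp))]
      have := energy_sub_le (v := φ l - u) (G' := gradient (φ l) - G) ((hφ1 k).sub hG)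
      simpa using this
  have hcauchy : CauchySeq fun k => (hmem k).toLp := by
    rw [EMetric.cauchySeq_iff]
    intro ε hε
    have h4 : Tendsto (fun k => C * (4 * e k)) atTop (𝓝 0) := by
      simpa using ENNReal.Tendsto.const_mul (ENNReal.Tendsto.const_mul ht
        (Or.inr (by simp : (4 : ℝ≥0∞) ≠ ⊤))) (Or.inr hC)
    obtain ⟨N, hN⟩ := eventually_atTop.1 (h4.eventually_lt_const
      (show (0 : ℝ≥0∞) < ε ^ 2 from ENNReal.pow_pos hε 2))
    refine ⟨N, fun k hk l hl => ?_⟩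
    have hlt : edist ((hmem k).toLp) ((hmem l).toLp) ^ 2 < ε ^ 2 := by
      refine (hdist k l).trans_lt ?_
      rcases le_total (e k) (e l) with h | h
      · refine lt_of_le_of_lt ?_ (hN l hl)
        gcongr
        calc 2 * e k + 2 * e l ≤ 2 * e l + 2 * e l := by gcongr
          _ = 4 * e l := by ring
      · refine lt_of_le_of_lt ?_ (hN k hk)
        gcongr
        calc 2 * e k + 2 * e l ≤ 2 * e k + 2 * e k := by gcongr
          _ = 4 * e k := by ring
    exact lt_of_not_ge fun h => absurd hlt (not_lt.2 (pow_le_pow_left' h 2))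
  obtain ⟨F, hF⟩ := cauchySeq_tendsto_of_complete hcauchy
  refine ⟨F, hu, Lp.memLp F, φ, hφ, ?_, ?_⟩
  · exact tendsto_h1Norm_of_tendsto_energy hΩ (fun k => (hφ1 k).sub hG) ht
  · have h1 := tendsto_iff_edist_tendsto_0.1 hF
    refine h1.congr fun k => ?_
    rw [Lp.edist_def]
    refine eLpNorm_congr_ae ?_
    exact (hmem k).coeFn_toLp.sub ae_eq_rfl

/-- The trace is unique, by the trace inequality for the zero function. -/
lemma IsTrace.ae_unique (hΩ : IsOpen Ω) (hb : Bornology.IsBounded Ω)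
    (hL : HasLipschitzBoundary Ω) (h : IsTrace Ω u γ) (h' : IsTrace Ω u γ') :
    γ =ᵐ[surf (frontier Ω)] γ' := by
  obtain ⟨C, hC, hle⟩ := exists_isTrace_le hΩ hb hL
  obtain ⟨G, hG⟩ := memH1_iff.1 h.1
  have h1 := hle _ _ _ (hG.sub hG) (h.sub hΩ hb h')
  have h2 : energy Ω (u - u) (G - G) = 0 := by simp [energy, lsq]
  rw [h2, mul_zero, nonpos_iff_eq_zero, lsq_eq_zero_iff (h.2.1.sub h'.2.1).1] at h1
  exact h1.mono fun x hx => sub_eq_zero.1 hx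

lemma isTrace_trace (hΩ : IsOpen Ω) (hb : Bornology.IsBounded Ω)
    (hL : HasLipschitzBoundary Ω) (hu : MemH1 Ω u) : IsTrace Ω u (trace Ω u) := by
  have h := exists_isTrace hΩ hb hL hu
  rw [trace, dif_pos h]
  exact h.choose_spec

lemma trace_sub_ae (hΩ : IsOpen Ω) (hb : Bornology.IsBounded Ω)
    (hL : HasLipschitzBoundary Ω) (hu : MemH1 Ω u) (hv : MemH1 Ω v) :
    trace Ω (u - v) =ᵐ[surf (frontier Ω)] trace Ω u - trace Ω v := by
  have h := (isTrace_trace hΩ hb hL hu).sub hΩ hb (isTrace_trace hΩ hb hL hv)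
  exact (isTrace_trace hΩ hb hL h.1).ae_unique hΩ hb hL h

end trace

/-! ### Mean oscillation and Poincaré inequalities -/

/-- The squared oscillation `∫_A ∫_B |f(x) - f(y)|² dy dx`, not divided by the volumes. -/
def osc {F : Type*} [NormedAddCommGroup F] (A B : Set (Euc n)) (f : Euc n → F) : ℝ≥0∞ :=
  ∫⁻ x in A, ∫⁻ y in B, ‖f x - f y‖ₑ ^ 2

lemma osc_mono {F : Type*} [NormedAddCommGroup F] {A A' B B' : Set (Euc n)} (f : Euc n → F)
    (hA : A ⊆ A') (hB : B ⊆ B') : osc A B f ≤ osc A' B' f :=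
  lintegral_mono' (Measure.restrict_mono hA le_rfl) fun _ =>
    lintegral_mono' (Measure.restrict_mono hB le_rfl) le_rfl

/-- A dilation by a factor `t ≥ 1 / 2` costs at most the constant `2 ^ n`. -/
lemma lintegral_comp_smul_add_le {g : Euc n → ℝ≥0∞} (hg : Measurable g) (c : Euc n) {t : ℝ}
    (ht : 1 / 2 ≤ t) : ∫⁻ y, g (c + t • y) ≤ 2 ^ n * ∫⁻ y, g y := by
  have ht0 : t ≠ 0 := by linarith
  have h1 : ∫⁻ y, g (c + t • y) = ENNReal.ofReal |(t ^ n)⁻¹| * ∫⁻ y, g (c + y) := by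
    have := lintegral_map (μ := (volume : Measure (Euc n))) (f := fun y => g (c + y))
      (g := fun y => t • y) (by fun_prop) (by fun_prop)
    rw [← this, Measure.map_addHaar_smul volume ht0, lintegral_smul_measure]
    simp
  rw [h1, lintegral_add_left_eq_self]
  gcongr
  rw [abs_of_pos (by positivity), ← inv_pow]
  calc ENNReal.ofReal (t⁻¹ ^ n) ≤ ENNReal.ofReal (2 ^ n) := by
        apply ENNReal.ofReal_le_ofReal
        have : t⁻¹ ≤ 2 := by
          rw [inv_le_comm₀ (by positivity) (by norm_num)]; linarith
        gcongr
    _ = 2 ^ n := by rw [ENNReal.ofReal_pow (by norm_num)]; simp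

/-- The **Poincaré inequality** on a convex set, for smooth functions. The difference `φ x - φ y` is
the integral of the gradient over the segment; the change of variables to a point of the segment is
made in `y` on the half of the segment near `y` and in `x` on the other half, so that its Jacobian
stays bounded. -/
lemma osc_convex_le_of_contDiff {D : Set (Euc n)} (hD : Convex ℝ D) (hDm : MeasurableSet D) {d : ℝ}
    (hd : ∀ x ∈ D, ∀ y ∈ D, dist x y ≤ d) {φ : Euc n → ℝ} (hφ : ContDiff ℝ 1 φ) :
    osc D D φ ≤ 2 ^ n * ENNReal.ofReal d ^ 2 * volume D *
      lsq (volume.restrict D) (gradient φ) := by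
  have hgc := continuous_gradient hφ
  set g : Euc n → ℝ≥0∞ := D.indicator fun x => ‖gradient φ x‖ₑ ^ 2 with hg
  have hgm : Measurable g := (hgc.measurable.enorm.pow_const 2).indicator hDm
  have hgI : ∫⁻ x, g x = lsq (volume.restrict D) (gradient φ) := lintegral_indicator hDm _
  have hpt : ∀ x ∈ D, ∀ y ∈ D, ‖φ x - φ y‖ₑ ^ 2 ≤
      ENNReal.ofReal d ^ 2 * ∫⁻ t in Ioc (0 : ℝ) 1, g ((1 - t) • x + t • y) := fun x hx y hy => by
    have hder : ∀ t : ℝ, HasDerivAt (fun t : ℝ => φ ((1 - t) • x + t • y))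
        ⟪gradient φ ((1 - t) • x + t • y), y - x⟫ t := fun t => by
      have h1 := (hφ.differentiable (by simp) ((1 - t) • x + t • y)).hasFDerivAt
      have h2 : HasDerivAt (fun t : ℝ => (1 - t) • x + t • y) (y - x) t := by
        have := (((hasDerivAt_id t).const_sub 1).smul_const x).add
          ((hasDerivAt_id t).smul_const y)
        refine (this.congr_deriv ?_)
        simp only [neg_smul, one_smul]; abel
      have := h1.comp_hasDerivAt t h2
      rw [gradient, InnerProductSpace.toDual_symm_apply]
      exact this
    have hcd : Continuous fun t : ℝ => ⟪gradient φ ((1 - t) • x + t • y), y - x⟫ := by fun_prop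
    have hint : φ y - φ x = ∫ t in Ioc (0 : ℝ) 1, ⟪gradient φ ((1 - t) • x + t • y), y - x⟫ := by
      rw [← intervalIntegral.integral_of_le zero_le_one,
        intervalIntegral.integral_eq_sub_of_hasDerivAt (fun t _ => hder t)
          (hcd.intervalIntegrable _ _)]
      simp
    rw [enorm_sq_sub_comm, hint]
    refine (enorm_integral_sq_le hcd.aestronglyMeasurable).trans ?_
    rw [Measure.restrict_apply_univ, Real.volume_Ioc, sub_zero, ENNReal.ofReal_one, one_mul, lsq,
      ← lintegral_const_mul' _ _ (by simp)]
    refine setLIntegral_mono' measurableSet_Ioc fun t ht => ?_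
    have hmem : (1 - t) • x + t • y ∈ D :=
      hD hx hy (by linarith [ht.2]) ht.1.le (by ring)
    rw [hg, indicator_of_mem hmem, ← mul_pow]
    gcongr
    rw [← ofReal_norm, ← ofReal_norm, ← ENNReal.ofReal_mul (dist_nonneg.trans (hd x hx y hy))]
    apply ENNReal.ofReal_le_ofReal
    refine (norm_inner_le_norm _ _).trans ?_
    rw [mul_comm]
    gcongr
    rw [← dist_eq_norm]
    exact hd y hy x hx
  have hcomb : Measurable fun p : (Euc n × Euc n) × ℝ => g ((1 - p.2) • p.1.1 + p.2 • p.1.2) :=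
    hgm.comp (by fun_prop)
  have hin : ∀ t ∈ Ioc (0 : ℝ) 1, ∫⁻ x in D, ∫⁻ y in D, g ((1 - t) • x + t • y) ≤
      2 ^ n * volume D * ∫⁻ x, g x := fun t ht => by
    rcases le_total (1 / 2) t with h | h
    · calc ∫⁻ x in D, ∫⁻ y in D, g ((1 - t) • x + t • y)
          ≤ ∫⁻ x in D, (2 ^ n * ∫⁻ y, g y) := by
            refine lintegral_mono fun x => ?_
            exact (setLIntegral_le_lintegral _ _).trans (lintegral_comp_smul_add_le hgm _ h)
        _ = _ := by rw [lintegral_const, Measure.restrict_apply_univ]; ring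
    · rw [lintegral_lintegral_swap (by
        exact (hgm.comp (by fun_prop : Measurable fun p : Euc n × Euc n =>
          (1 - t) • p.1 + t • p.2)).aemeasurable)]
      calc ∫⁻ y in D, ∫⁻ x in D, g ((1 - t) • x + t • y)
          ≤ ∫⁻ y in D, (2 ^ n * ∫⁻ y, g y) := by
            refine lintegral_mono fun y => ?_
            refine (setLIntegral_le_lintegral _ _).trans ?_
            simp only [add_comm _ (t • y)]
            exact lintegral_comp_smul_add_le hgm _ (by linarith)
        _ = _ := by rw [lintegral_const, Measure.restrict_apply_univ]; ring
  calc osc D D φ ≤ ∫⁻ x in D, ∫⁻ y in D,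
        ENNReal.ofReal d ^ 2 * ∫⁻ t in Ioc (0 : ℝ) 1, g ((1 - t) • x + t • y) :=
        setLIntegral_mono' hDm fun x hx => setLIntegral_mono' hDm fun y hy => hpt x hx y hy
    _ = ENNReal.ofReal d ^ 2 *
        ∫⁻ t in Ioc (0 : ℝ) 1, ∫⁻ x in D, ∫⁻ y in D, g ((1 - t) • x + t • y) := by
        have e1 : ∀ x, ∫⁻ y in D, ∫⁻ t in Ioc (0 : ℝ) 1, g ((1 - t) • x + t • y)
            = ∫⁻ t in Ioc (0 : ℝ) 1, ∫⁻ y in D, g ((1 - t) • x + t • y) := fun x =>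
          lintegral_lintegral_swap (by
            exact (hgm.comp (by fun_prop : Measurable fun p : Euc n × ℝ =>
              (1 - p.2) • x + p.2 • p.1)).aemeasurable)
        have e2 : Measurable fun p : Euc n × ℝ => ∫⁻ y in D, g ((1 - p.2) • p.1 + p.2 • y) :=
          Measurable.lintegral_prod_right' (f := fun q : (Euc n × ℝ) × Euc n =>
            g ((1 - q.1.2) • q.1.1 + q.1.2 • q.2)) (hgm.comp (by fun_prop))
        simp only [lintegral_const_mul' _ _ (show ENNReal.ofReal d ^ 2 ≠ ⊤ by simp), e1]
        rw [lintegral_lintegral_swap e2.aemeasurable]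
    _ ≤ ENNReal.ofReal d ^ 2 * ∫⁻ _ in Ioc (0 : ℝ) 1, (2 ^ n * volume D * ∫⁻ x, g x) := by
        exact mul_le_mul_right (setLIntegral_mono' measurableSet_Ioc hin) _
    _ = _ := by
        rw [lintegral_const, Measure.restrict_apply_univ, Real.volume_Ioc, hgI]
        simp; ring

/-- The oscillation is stable under `L²` perturbations. -/
lemma osc_le_osc_add {F : Type*} [NormedAddCommGroup F] {D : Set (Euc n)} {u φ : Euc n → F}
    (hφ : Continuous φ) (hu : AEStronglyMeasurable u (volume.restrict D)) :
    osc D D u ≤ 2 * osc D D φ + 8 * volume D * lsq (volume.restrict D) (u - φ) := by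
  set w : Euc n → ℝ≥0∞ := fun x => 4 * ‖(u - φ) x‖ₑ ^ 2 with hw
  set q : Euc n → Euc n → ℝ≥0∞ := fun x y => 2 * ‖φ x - φ y‖ₑ ^ 2 with hq
  have hpt : ∀ x y, ‖u x - u y‖ₑ ^ 2 ≤ q x y + (w x + w y) := fun x y => by
    have e1 : u x - u y = (φ x - φ y) + ((u - φ) x - (u - φ) y) := by
      simp only [Pi.sub_apply]; abel
    have h1 := enorm_add_sq_le (φ x - φ y) ((u - φ) x - (u - φ) y)
    have h2 := enorm_sub_sq_le ((u - φ) x) ((u - φ) y)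
    rw [e1]
    calc _ ≤ _ := h1
      _ ≤ 2 * ‖φ x - φ y‖ₑ ^ 2 + 2 * (2 * ‖(u - φ) x‖ₑ ^ 2 + 2 * ‖(u - φ) y‖ₑ ^ 2) :=
          add_le_add le_rfl (mul_le_mul_right h2 _)
      _ = _ := by simp only [hq, hw]; ring
  have hm : Measurable fun p : Euc n × Euc n => q p.1 p.2 :=
    (Continuous.measurable (by fun_prop)).const_mul 2
  have hm2 : Measurable fun x => ∫⁻ y in D, q x y := hm.lintegral_prod_right'
  have hm3 : AEMeasurable w (volume.restrict D) :=
    ((hu.sub hφ.aestronglyMeasurable).enorm.pow_const 2).const_mul _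
  have hwI : ∫⁻ y in D, w y = 4 * lsq (volume.restrict D) (u - φ) :=
    lintegral_const_mul' _ _ (by simp)
  have hqI : ∫⁻ x in D, ∫⁻ y in D, q x y = 2 * osc D D φ := by
    rw [osc, ← lintegral_const_mul' _ _ (by simp)]
    exact lintegral_congr fun x => lintegral_const_mul' _ _ (by simp)
  have hx : ∀ x, ∫⁻ y in D, (q x y + (w x + w y)) =
      (∫⁻ y in D, q x y) + (w x * volume D + ∫⁻ y in D, w y) := fun x => by
    have hmx : Measurable (q x) := (Continuous.measurable (by fun_prop)).const_mul 2
    rw [lintegral_add_left hmx, lintegral_add_left measurable_const, lintegral_const,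
      Measure.restrict_apply_univ]
  calc osc D D u ≤ ∫⁻ x in D, ∫⁻ y in D, (q x y + (w x + w y)) :=
        lintegral_mono fun x => lintegral_mono fun y => hpt x y
    _ = 2 * osc D D φ + (4 * lsq (volume.restrict D) (u - φ) * volume D +
          4 * lsq (volume.restrict D) (u - φ) * volume D) := by
        rw [lintegral_congr hx, lintegral_add_left hm2, lintegral_add_right _ measurable_const,
          lintegral_const, Measure.restrict_apply_univ, lintegral_mul_const'' _ hm3, hwI, hqI]
    _ = _ := by ring

/-- The **Poincaré inequality** on a convex subset of `Ω`, for limits of smooth functions. -/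
lemma osc_convex_le {Ω D : Set (Euc n)} (hD : Convex ℝ D) (hDm : MeasurableSet D) (hDΩ : D ⊆ Ω)
    (hDf : volume D ≠ ⊤) {d : ℝ} (hd : ∀ x ∈ D, ∀ y ∈ D, dist x y ≤ d) {u : Euc n → ℝ}
    {G : Euc n → Euc n} (h : HasH1Grad Ω u G) (hs : SmoothLimit Ω u G) :
    osc D D u ≤ 4 * 2 ^ n * ENNReal.ofReal d ^ 2 * volume D * lsq (volume.restrict D) G := by
  obtain ⟨φ, hφ, ht⟩ := hs
  have hres : volume.restrict D ≤ volume.restrict Ω := Measure.restrict_mono hDΩ le_rfl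
  set e : ℕ → ℝ≥0∞ := fun k => energy Ω (φ k - u) (gradient (φ k) - G) with he
  set P : ℝ≥0∞ := 2 ^ n * ENNReal.ofReal d ^ 2 * volume D with hP
  have hPt : P ≠ ⊤ := by
    simp [hP, ENNReal.mul_eq_top, hDf]
  have hk : ∀ k, osc D D u ≤ 2 * (P * (2 * e k + 2 * lsq (volume.restrict D) G)) +
      8 * volume D * e k := fun k => by
    have hc := continuous_gradient ((hφ k).of_le (by simp))
    refine (osc_le_osc_add (hφ k).continuous (h.1.1.mono_measure hres)).trans ?_
    refine add_le_add (mul_le_mul_right ?_ _) (mul_le_mul_right ?_ _)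
    · refine (osc_convex_le_of_contDiff hD hDm hd ((hφ k).of_le (by simp))).trans ?_
      refine mul_le_mul_right ?_ _
      have e1 : gradient (φ k) = (gradient (φ k) - G) + G := by abel
      calc lsq (volume.restrict D) (gradient (φ k))
          = lsq (volume.restrict D) ((gradient (φ k) - G) + G) := by rw [← e1]
        _ ≤ 2 * lsq (volume.restrict D) (gradient (φ k) - G) +
            2 * lsq (volume.restrict D) G :=
            lsq_add_le (hc.aestronglyMeasurable.sub (h.2.1.mono_measure hres))
        _ ≤ _ := by
            gcongr
            exact (lsq_mono_measure hres).trans le_add_self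
    · rw [lsq_sub_comm]
      exact (lsq_mono_measure hres).trans le_self_add
  have hlim : Tendsto (fun k => 2 * (P * (2 * e k + 2 * lsq (volume.restrict D) G)) +
      8 * volume D * e k) atTop (𝓝 (2 * (P * (2 * 0 + 2 * lsq (volume.restrict D) G)) +
      8 * volume D * 0)) := by
    refine (ENNReal.Tendsto.const_mul (ENNReal.Tendsto.const_mul ?_ (Or.inr hPt))
      (Or.inr (by simp))).add (ENNReal.Tendsto.const_mul ht
        (Or.inr (ENNReal.mul_ne_top (by simp) hDf)))
    exact (ENNReal.Tendsto.const_mul ht (Or.inr (by simp))).add tendsto_const_nhds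
  calc _ ≤ _ := ge_of_tendsto' hlim hk
    _ = _ := by rw [hP]; ring

/-! ### The Poincaré–Wirtinger inequality by chaining convex sets -/

/-- The oscillation between `A` and `B` of smooth functions is controlled by their gradients on
`Ω`. -/
def Linked (Ω A B : Set (Euc n)) : Prop :=
  ∃ C : ℝ≥0∞, C ≠ ⊤ ∧ ∀ φ : Euc n → ℝ, ContDiff ℝ 1 φ →
    osc A B φ ≤ C * lsq (volume.restrict Ω) (gradient φ)

lemma measurable_enorm_sub_sq {φ : Euc n → ℝ} (hφ : Continuous φ) :
    Measurable fun p : Euc n × Euc n => ‖φ p.1 - φ p.2‖ₑ ^ 2 :=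
  Continuous.measurable (by fun_prop)

lemma osc_symm {A B : Set (Euc n)} {φ : Euc n → ℝ} (hφ : Continuous φ) :
    osc A B φ = osc B A φ := by
  rw [osc, lintegral_lintegral_swap (measurable_enorm_sub_sq hφ).aemeasurable]
  exact lintegral_congr fun x => lintegral_congr fun y => enorm_sq_sub_comm _ _

namespace Linked

variable {Ω A B D A' B' : Set (Euc n)}

lemma mono (h : Linked Ω A' B') (hA : A ⊆ A') (hB : B ⊆ B') : Linked Ω A B := by
  obtain ⟨C, hC, h⟩ := h
  exact ⟨C, hC, fun φ hφ => (osc_mono φ hA hB).trans (h φ hφ)⟩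

/-- Compare the values on `A` and `D` with those on `B` and average over `B`. -/
lemma trans (h : Linked Ω A B) (h' : Linked Ω B D) (hA : volume A ≠ ⊤) (hB0 : volume B ≠ 0)
    (hB : volume B ≠ ⊤) (hD : volume D ≠ ⊤) : Linked Ω A D := by
  obtain ⟨C, hC, h⟩ := h
  obtain ⟨C', hC', h'⟩ := h'
  refine ⟨(volume B)⁻¹ * (2 * volume D * C + 2 * volume A * C'), ?_, fun φ hφ => ?_⟩
  · refine ENNReal.mul_ne_top (ENNReal.inv_ne_top.2 hB0) (ENNReal.add_ne_top.2 ⟨?_, ?_⟩)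
    · exact ENNReal.mul_ne_top (ENNReal.mul_ne_top (by simp) hD) hC
    · exact ENNReal.mul_ne_top (ENNReal.mul_ne_top (by simp) hA) hC'
  have hm := measurable_enorm_sub_sq hφ.continuous
  have hm' : Measurable fun p : Euc n × Euc n => ‖φ p.2 - φ p.1‖ₑ ^ 2 := hm.comp measurable_swap
  have hkey : volume B * osc A D φ ≤ 2 * volume D * osc A B φ + 2 * volume A * osc B D φ := by
    calc volume B * osc A D φ = ∫⁻ x in A, ∫⁻ z in D, ∫⁻ y in B, ‖φ x - φ z‖ₑ ^ 2 := by
          simp only [lintegral_const, Measure.restrict_apply_univ, osc,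
            lintegral_mul_const' _ _ hB]
          ring
      _ ≤ ∫⁻ x in A, ∫⁻ z in D, ∫⁻ y in B, (2 * ‖φ x - φ y‖ₑ ^ 2 + 2 * ‖φ y - φ z‖ₑ ^ 2) := by
          refine lintegral_mono fun x => lintegral_mono fun z => lintegral_mono fun y => ?_
          have e1 : φ x - φ z = (φ x - φ y) + (φ y - φ z) := by ring
          rw [e1]
          exact enorm_add_sq_le _ _
      _ = ∫⁻ x in A, ∫⁻ z in D, (2 * (∫⁻ y in B, ‖φ x - φ y‖ₑ ^ 2) +
            2 * ∫⁻ y in B, ‖φ y - φ z‖ₑ ^ 2) := by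
          refine lintegral_congr fun x => lintegral_congr fun z => ?_
          have hmx : Measurable fun y => 2 * ‖φ x - φ y‖ₑ ^ 2 :=
            (hm.comp measurable_prodMk_left).const_mul _
          rw [lintegral_add_left hmx,
            lintegral_const_mul' _ _ (by simp), lintegral_const_mul' _ _ (by simp)]
      _ = ∫⁻ x in A, (2 * volume D * (∫⁻ y in B, ‖φ x - φ y‖ₑ ^ 2) + 2 * osc D B φ) := by
          refine lintegral_congr fun x => ?_
          rw [lintegral_add_left measurable_const, lintegral_const, Measure.restrict_apply_univ,
            lintegral_const_mul' _ _ (by simp)]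
          rw [osc]
          congr 1
          · ring
          · congr 1
            exact lintegral_congr fun z => lintegral_congr fun y => enorm_sq_sub_comm _ _
      _ = 2 * volume D * osc A B φ + 2 * volume A * osc B D φ := by
          rw [lintegral_add_right _ measurable_const, lintegral_const,
            Measure.restrict_apply_univ, lintegral_const_mul' _ _
              (ENNReal.mul_ne_top (by simp) hD), osc_symm (A := D) hφ.continuous]
          simp only [osc]
          ring
  calc osc A D φ = (volume B)⁻¹ * (volume B * osc A D φ) := by
        rw [← mul_assoc, ENNReal.inv_mul_cancel hB0 hB, one_mul]
    _ ≤ (volume B)⁻¹ * (2 * volume D * (C * lsq (volume.restrict Ω) (gradient φ)) +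
          2 * volume A * (C' * lsq (volume.restrict Ω) (gradient φ))) := by
        refine mul_le_mul_right (hkey.trans ?_) _
        exact add_le_add (mul_le_mul_right (h φ hφ) _) (mul_le_mul_right (h' φ hφ) _)
    _ = _ := by ring

lemma of_convex (hD : Convex ℝ D) (hDm : MeasurableSet D) (hDΩ : D ⊆ Ω)
    (hDb : Bornology.IsBounded D) : Linked Ω D D := by
  obtain ⟨d, hd⟩ := Metric.isBounded_iff.1 hDb
  refine ⟨2 ^ n * ENNReal.ofReal d ^ 2 * volume D, ?_, fun φ hφ => ?_⟩
  · simp [ENNReal.mul_eq_top, hDb.measure_lt_top.ne]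
  · refine (osc_convex_le_of_contDiff hD hDm (fun x hx y hy => hd hx hy) hφ).trans ?_
    exact mul_le_mul_right (lsq_mono_measure (Measure.restrict_mono hDΩ le_rfl)) _

end Linked

lemma Linked.iUnion {ι : Type*} [Fintype ι] {Ω : Set (Euc n)} {D : ι → Set (Euc n)}
    (h : ∀ i j, Linked Ω (D i) (D j)) : Linked Ω (⋃ i, D i) (⋃ i, D i) := by
  choose C hC h using h
  refine ⟨∑ i, ∑ j, C i j, ENNReal.sum_ne_top.2 fun i _ => ENNReal.sum_ne_top.2 fun j _ => hC i j,
    fun φ hφ => ?_⟩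
  calc osc (⋃ i, D i) (⋃ i, D i) φ ≤ ∑ i, ∑ j, osc (D i) (D j) φ := by
        refine (lintegral_iUnion_le _ _).trans ?_
        rw [tsum_fintype]
        refine Finset.sum_le_sum fun i _ => ?_
        calc ∫⁻ x in D i, ∫⁻ y in ⋃ j, D j, ‖φ x - φ y‖ₑ ^ 2
            ≤ ∫⁻ x in D i, ∑ j, ∫⁻ y in D j, ‖φ x - φ y‖ₑ ^ 2 := by
              refine lintegral_mono fun x => ?_
              refine (lintegral_iUnion_le _ _).trans ?_
              rw [tsum_fintype]
          _ = ∑ j, osc (D i) (D j) φ := by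
              rw [lintegral_finsetSum]
              · rfl
              · exact fun j _ => (measurable_enorm_sub_sq hφ.continuous).lintegral_prod_right'
    _ ≤ ∑ i, ∑ j, C i j * lsq (volume.restrict Ω) (gradient φ) :=
        Finset.sum_le_sum fun i _ => Finset.sum_le_sum fun j _ => h i j φ hφ
    _ = _ := by simp only [Finset.sum_mul]

/-- **Poincaré–Wirtinger inequality** on a connected open set tiled by finitely many convex sets:
two tiles that meet inside the set are linked through a small ball about a common point, and
connectedness links all of them. -/
theorem linked_self_of_tiling {ι : Type*} [Fintype ι] {Ω : Set (Euc n)} (hΩ : IsOpen Ω)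
    (hconn : IsPreconnected Ω) {D : ι → Set (Euc n)} (hDo : ∀ i, IsOpen (D i))
    (hDc : ∀ i, Convex ℝ (D i)) (hDb : ∀ i, Bornology.IsBounded (D i))
    (hDn : ∀ i, (D i).Nonempty) (hDΩ : ∀ i, D i ⊆ Ω) (hcov : Ω ⊆ ⋃ i, closure (D i)) :
    Linked Ω Ω Ω := by
  have hfin : ∀ i, volume (D i) ≠ ⊤ := fun i => (hDb i).measure_lt_top.ne
  have hpos : ∀ i, volume (D i) ≠ 0 := fun i => ((hDo i).measure_pos volume (hDn i)).ne'
  have hself : ∀ i, Linked Ω (D i) (D i) := fun i =>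
    Linked.of_convex (hDc i) (hDo i).measurableSet (hDΩ i) (hDb i)
  have hmeet : ∀ i j x, x ∈ Ω → x ∈ closure (D i) → x ∈ closure (D j) →
      Linked Ω (D i) (D j) := fun i j x hx hi hj => by
    obtain ⟨r, hr, hball⟩ := Metric.isOpen_iff.1 hΩ x hx
    set B := Metric.ball x r with hB
    have hBB : Linked Ω B B := Linked.of_convex (convex_ball _ _) measurableSet_ball hball
      Metric.isBounded_ball
    have hne : ∀ k, x ∈ closure (D k) → volume (D k ∩ B) ≠ 0 := fun k hk => by
      have hn : (D k ∩ B).Nonempty := by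
        rw [inter_comm]
        exact mem_closure_iff.1 hk B Metric.isOpen_ball (Metric.mem_ball_self hr)
      exact (((hDo k).inter Metric.isOpen_ball).measure_pos volume hn).ne'
    have hft : ∀ k, volume (D k ∩ B) ≠ ⊤ := fun k =>
      ((measure_mono inter_subset_left).trans_lt (hfin k).lt_top).ne
    have h1 : Linked Ω (D i) (D i ∩ B) := (hself i).mono subset_rfl inter_subset_left
    have h2 : Linked Ω (D i ∩ B) (D j ∩ B) := hBB.mono inter_subset_right inter_subset_right
    have h3 : Linked Ω (D j ∩ B) (D j) := (hself j).mono inter_subset_left subset_rfl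
    exact (h1.trans h2 (hfin i) (hne i hi) (hft i) (hft j)).trans h3 (hfin i) (hne j hj) (hft j)
      (hfin j)
  have hall : ∀ i j, Linked Ω (D i) (D j) := fun i j => by
    by_contra hij
    -- otherwise the tiles linked to `D i` and the others give two closed sets covering `Ω`, which meet
    -- in `Ω` by connectedness
    obtain ⟨x, hxΩ, hxU, hxV⟩ := isPreconnected_closed_iff.1 hconn
      (⋃ k ∈ {k | Linked Ω (D i) (D k)}, closure (D k))
      (⋃ k ∈ {k | ¬ Linked Ω (D i) (D k)}, closure (D k))
      ((Set.toFinite _).isClosed_biUnion fun _ _ => isClosed_closure)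
      ((Set.toFinite _).isClosed_biUnion fun _ _ => isClosed_closure)
      (fun x hx => by
        obtain ⟨k, hk⟩ := mem_iUnion.1 (hcov hx)
        by_cases hL : Linked Ω (D i) (D k)
        · exact Or.inl (mem_biUnion (show k ∈ {k | Linked Ω (D i) (D k)} from hL) hk)
        · exact Or.inr (mem_biUnion (show k ∈ {k | ¬ Linked Ω (D i) (D k)} from hL) hk))
      (by
        obtain ⟨x, hx⟩ := hDn i
        exact ⟨x, hDΩ i hx, mem_biUnion (show i ∈ {k | Linked Ω (D i) (D k)} from hself i)
          (subset_closure hx)⟩)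
      (by
        obtain ⟨x, hx⟩ := hDn j
        exact ⟨x, hDΩ j hx, mem_biUnion (show j ∈ {k | ¬ Linked Ω (D i) (D k)} from hij)
          (subset_closure hx)⟩)
    obtain ⟨k, hk, hxk⟩ := mem_iUnion₂.1 hxU
    obtain ⟨l, hl, hxl⟩ := mem_iUnion₂.1 hxV
    exact hl (Linked.trans hk (hmeet k l x hxΩ hxk hxl) (hfin i) (hpos k) (hfin k) (hfin l))
  obtain ⟨C, hC, h⟩ := Linked.iUnion hall
  -- the boundaries of convex sets are null sets, so the open tiles exhaust `Ω`
  have hae : volume.restrict Ω ≤ volume.restrict (⋃ i, D i) := by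
    refine Measure.restrict_mono_ae ?_
    have hnull : ∀ i, ∀ᵐ x : Euc n, x ∉ frontier (D i) := fun i =>
      measure_eq_zero_iff_ae_notMem.1 ((hDc i).addHaar_frontier volume)
    filter_upwards [ae_all_iff.2 hnull] with x hx hxΩ
    obtain ⟨i, hi⟩ := mem_iUnion.1 (hcov hxΩ)
    refine mem_iUnion.2 ⟨i, ?_⟩
    by_contra hxD
    exact hx i ⟨hi, by rwa [(hDo i).interior_eq]⟩
  exact ⟨C, hC, fun φ hφ => (lintegral_mono' hae fun _ => lintegral_mono' hae le_rfl).trans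
    (h φ hφ)⟩

/-! ### The Friedrichs inequality and coercivity -/

/-- **Friedrichs inequality**: the gradient together with the trace on a boundary part of positive
measure controls the `H¹` norm. -/
theorem exists_energy_le_of_trace {Ω Γ : Set (Euc n)} (hΩ : IsOpen Ω)
    (hb : Bornology.IsBounded Ω) (hL : HasLipschitzBoundary Ω) (hlink : Linked Ω Ω Ω)
    (hΓ : Γ ⊆ frontier Ω) (hpos : 0 < surf Γ univ) :
    ∃ C : ℝ≥0∞, C ≠ ⊤ ∧ ∀ (u γ : Euc n → ℝ) (G : Euc n → Euc n), HasH1Grad Ω u G →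
      IsTrace Ω u γ →
      energy Ω u G ≤ C * (lsq (volume.restrict Ω) G + lsq (surf Γ) γ) := by
  obtain ⟨Ct, hCt, htr⟩ := exists_trace_le hΩ hb hL
  obtain ⟨Cl, hCl, hosc⟩ := hlink
  set σ := surf Γ univ with hσ
  have hΓle : surf Γ ≤ surf (frontier Ω) := surf_mono hΓ
  have hΩf : volume Ω ≠ ⊤ := hb.measure_lt_top.ne
  have hσt : σ ≠ ⊤ := ((hΓle univ).trans_lt (surf_frontier_lt_top hΩ hb hL)).ne
  set V := volume Ω
  set K : ℝ≥0∞ := σ⁻¹ * (2 * V + 2 * Ct * (Cl + V)) with hK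
  have hKt : K ≠ ⊤ := ENNReal.mul_ne_top (ENNReal.inv_ne_top.2 hpos.ne')
    (ENNReal.add_ne_top.2 ⟨ENNReal.mul_ne_top (by simp) hΩf,
      ENNReal.mul_ne_top (ENNReal.mul_ne_top (by simp) hCt) (ENNReal.add_ne_top.2 ⟨hCl, hΩf⟩)⟩)
  have hsmooth : ∀ φ : Euc n → ℝ, ContDiff ℝ 1 φ →
      energy Ω φ (gradient φ) ≤
        (K + 1) * (lsq (volume.restrict Ω) (gradient φ) + lsq (surf Γ) φ) := fun φ hφ => by
    set g := lsq (volume.restrict Ω) (gradient φ) with hg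
    set s := lsq (surf Γ) φ with hs
    -- compare the boundary values with the constant `φ y`, then integrate over `y`
    have hy : ∀ y, σ * ‖φ y‖ₑ ^ 2 ≤
        2 * s + 2 * (Ct * ((∫⁻ x in Ω, ‖φ x - φ y‖ₑ ^ 2) + g)) := fun y => by
      have h1 := htr (fun x => φ x - φ y) (hφ.sub contDiff_const)
      have h2 : gradient (fun x => φ x - φ y) = gradient φ := by
        funext x; simp [gradient, fderiv_sub_const]
      rw [h2] at h1
      calc σ * ‖φ y‖ₑ ^ 2 = ∫⁻ _, ‖φ y‖ₑ ^ 2 ∂(surf Γ) := by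
            rw [lintegral_const, mul_comm]
        _ ≤ ∫⁻ x, (2 * ‖φ x‖ₑ ^ 2 + 2 * ‖φ x - φ y‖ₑ ^ 2) ∂(surf Γ) := by
            refine lintegral_mono fun x => ?_
            have e1 : φ y = φ x - (φ x - φ y) := by ring
            calc ‖φ y‖ₑ ^ 2 = ‖φ x - (φ x - φ y)‖ₑ ^ 2 := by rw [← e1]
              _ ≤ _ := enorm_sub_sq_le _ _
        _ = 2 * s + 2 * lsq (surf Γ) (fun x => φ x - φ y) := by
            rw [lintegral_add_left ((hφ.continuous.measurable.enorm.pow_const 2).const_mul _),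
              lintegral_const_mul' _ _ (by simp), lintegral_const_mul' _ _ (by simp)]
            rfl
        _ ≤ _ := by
            gcongr
            exact (lsq_mono_measure hΓle).trans h1
    have hm : Measurable fun y => ∫⁻ x in Ω, ‖φ x - φ y‖ₑ ^ 2 :=
      Measurable.lintegral_prod_right' (f := fun p : Euc n × Euc n => ‖φ p.2 - φ p.1‖ₑ ^ 2)
        ((measurable_enorm_sub_sq hφ.continuous).comp measurable_swap)
    have hswap : osc Ω Ω φ = ∫⁻ y in Ω, ∫⁻ x in Ω, ‖φ x - φ y‖ₑ ^ 2 :=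
      lintegral_congr fun y => lintegral_congr fun x => enorm_sq_sub_comm _ _
    have h1 : σ * lsq (volume.restrict Ω) φ ≤ 2 * V * s + 2 * Ct * (Cl + V) * g := by
      calc σ * lsq (volume.restrict Ω) φ = ∫⁻ y in Ω, σ * ‖φ y‖ₑ ^ 2 := by
            rw [lsq, lintegral_const_mul' _ _ hσt]
        _ ≤ ∫⁻ y in Ω, (2 * s + 2 * (Ct * ((∫⁻ x in Ω, ‖φ x - φ y‖ₑ ^ 2) + g))) :=
            lintegral_mono fun y => hy y
        _ = 2 * s * V + 2 * (Ct * (osc Ω Ω φ + g * V)) := by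
            rw [lintegral_add_left measurable_const, lintegral_const,
              Measure.restrict_apply_univ, lintegral_const_mul' _ _ (by simp),
              lintegral_const_mul' _ _ hCt, lintegral_add_right _ measurable_const,
              lintegral_const, Measure.restrict_apply_univ, ← hswap]
        _ ≤ 2 * s * V + 2 * (Ct * (Cl * g + g * V)) := by
            gcongr; exact hosc φ hφ
        _ = _ := by ring
    have h2 : lsq (volume.restrict Ω) φ ≤ K * (g + s) := by
      calc lsq (volume.restrict Ω) φ = σ⁻¹ * (σ * lsq (volume.restrict Ω) φ) := by
            rw [← mul_assoc, ENNReal.inv_mul_cancel hpos.ne' hσt, one_mul]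
        _ ≤ σ⁻¹ * ((2 * V + 2 * Ct * (Cl + V)) * (g + s)) := by
            refine mul_le_mul_right (h1.trans ?_) _
            have e1 : (2 * V + 2 * Ct * (Cl + V)) * (g + s) =
                (2 * V * s + 2 * Ct * (Cl + V) * g) + (2 * V * g + 2 * Ct * (Cl + V) * s) := by ring
            rw [e1]
            exact le_self_add
        _ = _ := by rw [hK]; ring
    calc energy Ω φ (gradient φ) ≤ K * (g + s) + (g + s) :=
          add_le_add h2 le_self_add
      _ = _ := by ring
  refine ⟨4 * (K + 1), ENNReal.mul_ne_top (by simp) (ENNReal.add_ne_top.2 ⟨hKt, by simp⟩),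
    fun u γ G hu ⟨_, hγ, φ, hφ, h1, h2⟩ => ?_⟩
  have hφ1 : ∀ k, HasH1Grad Ω (φ k) (gradient (φ k)) := fun k =>
    hasH1Grad_of_contDiff hb ((hφ k).of_le (by simp))
  have t1 := tendsto_energy_of_tendsto_h1Norm hΩ (fun k => (hφ1 k).sub hu) h1
  have t2 := tendsto_eLpNorm_iff_lsq.1 h2
  set e : ℕ → ℝ≥0∞ := fun k => energy Ω (φ k - u) (gradient (φ k) - G) with he
  set f : ℕ → ℝ≥0∞ := fun k => lsq (surf (frontier Ω)) (φ k - γ) with hf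
  set g := lsq (volume.restrict Ω) G
  set s := lsq (surf Γ) γ
  have hk : ∀ k, energy Ω u G ≤ 2 * e k +
      2 * ((K + 1) * ((2 * e k + 2 * g) + (2 * f k + 2 * s))) := fun k => by
    have i1 : energy Ω u G ≤ 2 * e k + 2 * energy Ω (φ k) (gradient (φ k)) := by
      have := energy_sub_le (v := φ k - u) (G' := gradient (φ k) - G) (hφ1 k)
      rw [sub_sub_cancel, sub_sub_cancel] at this
      rwa [add_comm]
    have i2 : lsq (volume.restrict Ω) (gradient (φ k)) ≤ 2 * e k + 2 * g := by
      have := lsq_add_le (g := G) ((hφ1 k).sub hu).2.1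
      rw [sub_add_cancel] at this
      refine this.trans ?_
      gcongr
      exact le_add_self
    have i3 : lsq (surf Γ) (φ k) ≤ 2 * f k + 2 * s := by
      have := lsq_add_le (μ := surf Γ) (f := φ k - γ) (g := γ)
        (((hφ k).continuous.aestronglyMeasurable).sub (hγ.1.mono_measure hΓle))
      rw [sub_add_cancel] at this
      refine this.trans ?_
      gcongr
      exact lsq_mono_measure hΓle
    refine i1.trans ?_
    gcongr
    refine (hsmooth _ ((hφ k).of_le (by simp))).trans ?_
    gcongr
  have hlim : Tendsto (fun k => 2 * e k +
      2 * ((K + 1) * ((2 * e k + 2 * g) + (2 * f k + 2 * s)))) atTop (𝓝 (2 * 0 +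
      2 * ((K + 1) * ((2 * 0 + 2 * g) + (2 * 0 + 2 * s))))) := by
    have two : (2 : ℝ≥0∞) ≠ ⊤ := by simp
    have t1' := ENNReal.Tendsto.const_mul t1 (Or.inr two)
    have t2' := ENNReal.Tendsto.const_mul t2 (Or.inr two)
    refine t1'.add (ENNReal.Tendsto.const_mul (ENNReal.Tendsto.const_mul ?_
      (Or.inr (ENNReal.add_ne_top.2 ⟨hKt, by simp⟩))) (Or.inr two))
    exact (t1'.add tendsto_const_nhds).add (t2'.add tendsto_const_nhds)
  calc _ ≤ _ := ge_of_tendsto' hlim hk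
    _ = _ := by ring

/-! ### Affine approximation on convex sets -/

section average

variable {F : Type*} [NormedAddCommGroup F] [NormedSpace ℝ F] {A B : Set (Euc n)} {f : Euc n → F}

lemma enorm_average_sq_mul_le (hA0 : volume A ≠ 0) (hA : volume A ≠ ⊤)
    (hf : AEStronglyMeasurable f (volume.restrict A)) :
    ‖⨍ x in A, f x‖ₑ ^ 2 * volume A ≤ lsq (volume.restrict A) f := by
  have h := enorm_integral_sq_le hf
  rw [Measure.restrict_apply_univ] at h
  have hr : 0 < volume.real A := ENNReal.toReal_pos hA0 hA
  have e1 : ‖(volume.real A)⁻¹‖ₑ = (volume A)⁻¹ := by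
    rw [Real.enorm_of_nonneg (by positivity), ENNReal.ofReal_inv_of_pos hr, Measure.real,
      ENNReal.ofReal_toReal hA]
  rw [setAverage_eq, enorm_smul, e1, mul_pow]
  calc (volume A)⁻¹ ^ 2 * ‖∫ x in A, f x‖ₑ ^ 2 * volume A
      ≤ (volume A)⁻¹ ^ 2 * (volume A * lsq (volume.restrict A) f) * volume A := by gcongr
    _ = ((volume A)⁻¹ * volume A) * ((volume A)⁻¹ * volume A) * lsq (volume.restrict A) f := by
        ring
    _ = lsq (volume.restrict A) f := by rw [ENNReal.inv_mul_cancel hA0 hA]; simp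

lemma average_const_sub [CompleteSpace F] (c : F) (hA0 : volume A ≠ 0) (hA : volume A ≠ ⊤)
    (hf : IntegrableOn f A) : ⨍ x in A, (c - f x) = c - ⨍ x in A, f x := by
  have hr : volume.real A ≠ 0 := (ENNReal.toReal_pos hA0 hA).ne'
  have : IsFiniteMeasure (volume.restrict A) := ⟨by simpa using hA.lt_top⟩
  rw [setAverage_eq, setAverage_eq, integral_sub (integrable_const _) hf, smul_sub,
    setIntegral_const, smul_smul, inv_mul_cancel₀ hr, one_smul]

/-- The deviation from the mean is controlled by the oscillation. -/
lemma lsq_sub_average_le [CompleteSpace F] (hB0 : volume B ≠ 0) (hB : volume B ≠ ⊤)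
    (hf : IntegrableOn f B) :
    lsq (volume.restrict A) (fun x => f x - ⨍ y in B, f y) * volume B ≤ osc A B f := by
  rw [lsq, ← lintegral_mul_const' _ _ hB]
  refine lintegral_mono fun x => ?_
  simp only [← average_const_sub (f x) hB0 hB hf]
  exact enorm_average_sq_mul_le hB0 hB (aestronglyMeasurable_const.sub hf.1)

lemma enorm_average_sub_average_sq_le [CompleteSpace F] (hA0 : volume A ≠ 0) (hA : volume A ≠ ⊤)
    (hB0 : volume B ≠ 0) (hB : volume B ≠ ⊤) (hfA : IntegrableOn f A) (hfB : IntegrableOn f B) :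
    ‖(⨍ x in A, f x) - ⨍ y in B, f y‖ₑ ^ 2 * volume A * volume B ≤ osc A B f := by
  have e1 : (⨍ x in A, f x) - ⨍ y in B, f y = -⨍ x in A, ((⨍ y in B, f y) - f x) := by
    rw [average_const_sub _ hA0 hA hfA, neg_sub]
  have e2 : ‖(⨍ x in A, f x) - ⨍ y in B, f y‖ₑ ^ 2 * volume A ≤
      lsq (volume.restrict A) (fun x => f x - ⨍ y in B, f y) := by
    rw [e1, enorm_neg]
    refine (enorm_average_sq_mul_le hA0 hA (aestronglyMeasurable_const.sub hfA.1)).trans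
      (le_of_eq ?_)
    exact lintegral_congr fun x => enorm_sq_sub_comm _ _
  exact (mul_le_mul_left e2 _).trans (lsq_sub_average_le hB0 hB hfB)

end average

/-- The affine function approximating `u` on `D`: its gradient is the mean of the gradient `G` and
its mean over `D` is that of `u`. -/
def affApprox (u : Euc n → ℝ) (G : Euc n → Euc n) (D : Set (Euc n)) (z : Euc n) : ℝ :=
  ⨍ x in D, (u x + ⟪⨍ y in D, G y, z - x⟫)

/-- The regularity used for interpolation: `u ∈ H¹(Ω)` on a bounded Lipschitz domain, and the
oscillation of its gradient `G` over convex sets of diameter `d` is at most `C d^(n + 2 s)` times a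
finite measure of the set, where `1 + s > n / 2`. -/
structure OscRegular (Ω : Set (Euc n)) (u : Euc n → ℝ) (G : Euc n → Euc n) (μ : Measure (Euc n))
    (C s : ℝ) : Prop where
  isOpen : IsOpen Ω
  isBounded : Bornology.IsBounded Ω
  lipschitz : HasLipschitzBoundary Ω
  grad : HasH1Grad Ω u G
  C_nonneg : 0 ≤ C
  finite : IsFiniteMeasure μ
  exponent : 0 < 1 + s - n / 2
  osc_le : ∀ (D : Set (Euc n)) (d : ℝ), IsOpen D → Convex ℝ D → D ⊆ Ω → 0 < d →
    (∀ x ∈ D, ∀ y ∈ D, dist x y ≤ d) →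
      osc D D G ≤ ENNReal.ofReal (C * d ^ ((n : ℝ) + 2 * s)) * μ D

/-- A non-empty open convex subset of `Ω` of diameter at most `d`. -/
structure ConvexPiece (Ω D : Set (Euc n)) (d : ℝ) : Prop where
  isOpen : IsOpen D
  convex : Convex ℝ D
  nonempty : D.Nonempty
  subset : D ⊆ Ω
  pos : 0 < d
  dist_le : ∀ x ∈ D, ∀ y ∈ D, dist x y ≤ d

namespace ConvexPiece

variable {Ω D : Set (Euc n)} {d : ℝ}

lemma isBounded (h : ConvexPiece Ω D d) : Bornology.IsBounded D :=
  Metric.isBounded_iff.2 ⟨d, fun x hx y hy => h.dist_le x hx y hy⟩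

lemma volume_ne_top (h : ConvexPiece Ω D d) : volume D ≠ ⊤ := h.isBounded.measure_lt_top.ne

lemma volume_ne_zero (h : ConvexPiece Ω D d) : volume D ≠ 0 :=
  (h.isOpen.measure_pos volume h.nonempty).ne'

lemma volume_real_pos (h : ConvexPiece Ω D d) : 0 < volume.real D :=
  ENNReal.toReal_pos h.volume_ne_zero h.volume_ne_top

lemma dist_le_of_mem_closure (h : ConvexPiece Ω D d) {p x : Euc n} (hp : p ∈ closure D)
    (hx : x ∈ D) : dist p x ≤ d := by
  have hcl : IsClosed {p : Euc n | dist p x ≤ d} :=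
    isClosed_le (by fun_prop) continuous_const
  exact closure_minimal (fun y hy => h.dist_le y hy x hx) hcl hp

end ConvexPiece

namespace OscRegular

variable {Ω D D' : Set (Euc n)} {u : Euc n → ℝ} {G : Euc n → Euc n} {μ : Measure (Euc n)}
  {C s d : ℝ}

lemma integrableOn_of_memLp {F : Type*} [NormedAddCommGroup F] {f : Euc n → F}
    (hf : MemLp f 2 (volume.restrict Ω)) (hD : ConvexPiece Ω D d) : IntegrableOn f D := by
  have : IsFiniteMeasure (volume.restrict D) := ⟨by simpa using hD.volume_ne_top.lt_top⟩
  exact (hf.mono_measure (Measure.restrict_mono hD.subset le_rfl)).integrable (by norm_num)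

lemma hasH1Grad_sub_linear (hb : Bornology.IsBounded Ω) (h : HasH1Grad Ω u G) (m : Euc n) :
    HasH1Grad Ω (fun x => u x - ⟪m, x⟫) (fun x => G x - m) := by
  have hc : ContDiff ℝ 1 (fun x : Euc n => ⟪m, x⟫) := (innerSL ℝ m).contDiff
  have h1 := h.sub (hasH1Grad_of_contDiff hb hc)
  have hg : gradient (fun x : Euc n => ⟪m, x⟫) = fun _ => m := by
    funext x
    have : fderiv ℝ (fun x : Euc n => ⟪m, x⟫) x = innerSL ℝ m := (innerSL ℝ m).fderiv
    rw [gradient, this]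
    exact (InnerProductSpace.toDual ℝ (Euc n)).symm_apply_apply m
  rw [hg] at h1
  exact h1

/-- The oscillation of `u` minus its affine approximation is controlled by that of the gradient. -/
lemma osc_sub_linear_le (h : OscRegular Ω u G μ C s) (hD : ConvexPiece Ω D d) :
    osc D D (fun x => u x - ⟪⨍ y in D, G y, x⟫) ≤
      4 * 2 ^ n * ENNReal.ofReal d ^ 2 * osc D D G := by
  have h1 := hasH1Grad_sub_linear h.isBounded h.grad (⨍ y in D, G y)
  have h2 := osc_convex_le hD.convex hD.isOpen.measurableSet hD.subset hD.volume_ne_top hD.dist_le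
    h1 (smoothLimit_of_hasH1Grad h.isOpen h.isBounded h.lipschitz h1)
  have h3 := lsq_sub_average_le (A := D) hD.volume_ne_zero hD.volume_ne_top
    (integrableOn_of_memLp h.grad.2 hD)
  calc _ ≤ _ := h2
    _ = 4 * 2 ^ n * ENNReal.ofReal d ^ 2 *
        (lsq (volume.restrict D) (fun x => G x - ⨍ y in D, G y) * volume D) := by ring
    _ ≤ _ := mul_le_mul_right h3 _

/-- The affine approximation, written as an affine function of `z`. -/
lemma affApprox_eq (h : OscRegular Ω u G μ C s) (hD : ConvexPiece Ω D d) (z : Euc n) :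
    affApprox u G D z = (⨍ x in D, (u x - ⟪⨍ y in D, G y, x⟫)) + ⟪⨍ y in D, G y, z⟫ := by
  set m := ⨍ y in D, G y
  have hi := integrableOn_of_memLp (hasH1Grad_sub_linear h.isBounded h.grad m).1 hD
  have e1 := average_const_sub (-⟪m, z⟫) hD.volume_ne_zero hD.volume_ne_top hi
  have e2 : affApprox u G D z = -⨍ x in D, (-⟪m, z⟫ - (u x - ⟪m, x⟫)) := by
    rw [affApprox, ← average_neg]
    congr 1
    funext x
    simp only [inner_sub_right, m]
    ring
  rw [e2, e1]
  ring

lemma abs_le_of_enorm_sq_mul_le {F : Type*} [NormedAddCommGroup F] {v : F} {V V' Q : ℝ≥0∞}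
    (h : ‖v‖ₑ ^ 2 * V' * V ≤ Q) (hV : V ≠ ⊤) (hV' : V' ≠ ⊤) (hV0 : V ≠ 0) (hV0' : V' ≠ 0)
    {q : ℝ} (hq : 0 ≤ q) (hQ : Q ≤ ENNReal.ofReal (q ^ 2) * (V' * V)) : ‖v‖ ≤ q := by
  have h1 : ‖v‖ₑ ^ 2 * (V' * V) ≤ ENNReal.ofReal (q ^ 2) * (V' * V) := by
    rw [← mul_assoc]; exact h.trans hQ
  have h2 : ‖v‖ₑ ^ 2 ≤ ENNReal.ofReal (q ^ 2) :=
    (ENNReal.mul_le_mul_iff_left (mul_ne_zero hV0' hV0) (ENNReal.mul_ne_top hV' hV)).1 h1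
  rw [← ofReal_norm, ← ENNReal.ofReal_pow (norm_nonneg _),
    ENNReal.ofReal_le_ofReal_iff (by positivity)] at h2
  exact (sq_le_sq₀ (norm_nonneg _) hq).1 h2

/-- Comparison of the affine approximations on two nested convex sets of comparable size: both the
means of `G` and those of `u` minus its linear part differ by at most the oscillation on `D`. -/
lemma affApprox_compare (h : OscRegular Ω u G μ C s) (hD : ConvexPiece Ω D d)
    (hD' : ConvexPiece Ω D' d) (hsub : D' ⊆ D) {κ : ℝ} (hκ : 0 < κ)
    (hvol : κ * d ^ n ≤ volume.real D') :
    ‖(⨍ y in D', G y) - ⨍ y in D, G y‖ ≤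
        √C / κ * d ^ (s - n / 2) * √(μ.real D) ∧
      ∀ z, (∀ x ∈ D', dist z x ≤ d) → |affApprox u G D' z - affApprox u G D z| ≤
        (2 ^ (n + 1) + 1) * (√C / κ) * d ^ (1 + s - n / 2) * √(μ.real D) := by
  have := h.finite
  have hd := hD.pos
  set m := ⨍ y in D, G y with hm
  set m' := ⨍ y in D', G y with hm'
  set q : ℝ := √C / κ * d ^ (s - n / 2) * √(μ.real D) with hq
  have hq0 : 0 ≤ q := by positivity
  have hoscT : osc D D G ≤ ENNReal.ofReal (q ^ 2) * (volume D' * volume D) := by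
    refine (h.osc_le D d hD.isOpen hD.convex hD.subset hd hD.dist_le).trans ?_
    have hV : ENNReal.ofReal (κ * d ^ n) ≤ volume D' := by
      rw [← ENNReal.ofReal_toReal hD'.volume_ne_top]
      exact ENNReal.ofReal_le_ofReal hvol
    have hV2 : ENNReal.ofReal (κ * d ^ n) ≤ volume D := hV.trans (measure_mono hsub)
    have e1 : C * d ^ ((n : ℝ) + 2 * s) * μ.real D = q ^ 2 * (κ * d ^ n * (κ * d ^ n)) := by
      have e2 : d ^ ((n : ℝ) + 2 * s) = (d ^ (s - n / 2)) ^ 2 * (d ^ n * d ^ n) := by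
        rw [← Real.rpow_natCast (d ^ (s - n / 2)) 2, ← Real.rpow_mul hd.le,
          ← Real.rpow_natCast d n, ← Real.rpow_add hd, ← Real.rpow_add hd]
        congr 1
        push_cast
        ring
      rw [hq, e2, mul_pow, mul_pow, div_pow, Real.sq_sqrt h.C_nonneg,
        Real.sq_sqrt measureReal_nonneg]
      field_simp
    calc ENNReal.ofReal (C * d ^ ((n : ℝ) + 2 * s)) * μ D
        = ENNReal.ofReal (C * d ^ ((n : ℝ) + 2 * s) * μ.real D) := by
          rw [ENNReal.ofReal_mul (mul_nonneg h.C_nonneg (by positivity)), Measure.real,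
            ENNReal.ofReal_toReal (measure_ne_top _ _)]
      _ = ENNReal.ofReal (q ^ 2) * (ENNReal.ofReal (κ * d ^ n) * ENNReal.ofReal (κ * d ^ n)) := by
          rw [e1, ENNReal.ofReal_mul (by positivity), ENNReal.ofReal_mul (by positivity)]
      _ ≤ _ := by gcongr
  have hi := integrableOn_of_memLp h.grad.2 hD
  have hi' := integrableOn_of_memLp h.grad.2 hD'
  have hmm : ‖m' - m‖ ≤ q := by
    refine abs_le_of_enorm_sq_mul_le (enorm_average_sub_average_sq_le hD'.volume_ne_zero
      hD'.volume_ne_top hD.volume_ne_zero hD.volume_ne_top hi' hi) hD.volume_ne_top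
      hD'.volume_ne_top hD.volume_ne_zero hD'.volume_ne_zero hq0 ?_
    exact (osc_mono G hsub subset_rfl).trans hoscT
  refine ⟨hmm, fun z hz => ?_⟩
  set w : Euc n → ℝ := fun x => u x - ⟪m, x⟫ with hw
  have hw1 := hasH1Grad_sub_linear h.isBounded h.grad m
  have hwi : IntegrableOn w D := integrableOn_of_memLp hw1.1 hD
  have hwi' : IntegrableOn w D' := integrableOn_of_memLp hw1.1 hD'
  have hww : ‖(⨍ x in D', w x) - ⨍ x in D, w x‖ ≤ 2 ^ (n + 1) * d * q := by
    refine abs_le_of_enorm_sq_mul_le (enorm_average_sub_average_sq_le hD'.volume_ne_zero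
      hD'.volume_ne_top hD.volume_ne_zero hD.volume_ne_top hwi' hwi) hD.volume_ne_top
      hD'.volume_ne_top hD.volume_ne_zero hD'.volume_ne_zero (by positivity) ?_
    refine (osc_mono w hsub subset_rfl).trans ((h.osc_sub_linear_le hD).trans ?_)
    have e1 : ENNReal.ofReal ((2 ^ (n + 1) * d * q) ^ 2) =
        (2 ^ (n + 1)) ^ 2 * ENNReal.ofReal d ^ 2 * ENNReal.ofReal (q ^ 2) := by
      rw [mul_pow, mul_pow, ENNReal.ofReal_mul (by positivity), ENNReal.ofReal_mul (by positivity),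
        ENNReal.ofReal_pow (by positivity), ENNReal.ofReal_pow hd.le,
        ENNReal.ofReal_pow (by norm_num)]
      simp
    rw [e1]
    calc 4 * 2 ^ n * ENNReal.ofReal d ^ 2 * osc D D G
        ≤ (2 ^ (n + 1)) ^ 2 * ENNReal.ofReal d ^ 2 *
          (ENNReal.ofReal (q ^ 2) * (volume D' * volume D)) := by
          gcongr
          calc (4 : ℝ≥0∞) * 2 ^ n = 2 ^ (n + 2) := by rw [pow_add]; ring
            _ ≤ 2 ^ ((n + 1) * 2) := by
              apply pow_le_pow_right' (by norm_num); omega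
            _ = (2 ^ (n + 1)) ^ 2 := by rw [pow_mul]
      _ = _ := by ring
  -- rewrite the approximation on the smaller set in terms of `w`
  have hdiff : affApprox u G D' z - affApprox u G D z =
      ((⨍ x in D', w x) - ⨍ x in D, w x) + ⨍ x in D', ⟪m' - m, z - x⟫ := by
    have hl : IntegrableOn (fun x => ⟪m' - m, z - x⟫) D' := by
      refine integrableOn_of_memLp (Ω := Ω) (memLp_of_continuous h.isBounded (by fun_prop)) hD'
    have e1 : affApprox u G D' z = (⨍ x in D', w x) + (⨍ x in D', ⟪m' - m, z - x⟫) +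
        ⟪m, z⟫ := by
      have := average_const_sub (-⟪m, z⟫) hD'.volume_ne_zero hD'.volume_ne_top (hwi'.add hl)
      have e3 : (⨍ x in D', w x) + (⨍ x in D', ⟪m' - m, z - x⟫) =
          ⨍ x in D', (w + fun x => ⟪m' - m, z - x⟫) x := by
        rw [setAverage_eq, setAverage_eq, setAverage_eq, ← smul_add, ← integral_add hwi' hl]
        rfl
      have e2 : affApprox u G D' z =
          -⨍ x in D', (-⟪m, z⟫ - (w + fun x => ⟪m' - m, z - x⟫) x) := by
        rw [affApprox, ← average_neg]
        congr 1
        funext x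
        simp only [hw, Pi.add_apply, inner_sub_right, inner_sub_left, ← hm']
        ring
      rw [e2, this, e3]
      ring
    rw [e1, h.affApprox_eq hD z]
    ring
  have hsec : ‖⨍ x in D', ⟪m' - m, z - x⟫‖ ≤ q * d := by
    have hb : ‖∫ x in D', ⟪m' - m, z - x⟫‖ ≤ q * d * volume.real D' := by
      refine norm_setIntegral_le_of_norm_le_const hD'.volume_ne_top.lt_top fun x hx => ?_
      refine (norm_inner_le_norm _ _).trans ?_
      rw [← dist_eq_norm z x]
      exact mul_le_mul hmm (hz x hx) dist_nonneg hq0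
    rw [setAverage_eq, norm_smul, norm_inv, Real.norm_of_nonneg measureReal_nonneg]
    rw [inv_mul_le_iff₀ hD'.volume_real_pos]
    linarith
  have e4 : (2 ^ (n + 1) + 1) * (√C / κ) * d ^ (1 + s - n / 2) * √(μ.real D) =
      2 ^ (n + 1) * d * q + q * d := by
    have : d ^ (1 + s - (n : ℝ) / 2) = d * d ^ (s - n / 2) := by
      rw [add_sub_assoc, Real.rpow_add hd, Real.rpow_one]
    rw [this, hq]
    ring
  rw [hdiff, e4]
  exact (abs_add_le _ _).trans (add_le_add hww hsec)

end OscRegular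

/-! ### Point values -/

/-- The homothetic copy of `D` with centre `p` and ratio `2⁻ᵏ`. -/
def shrink (p : Euc n) (k : ℕ) (D : Set (Euc n)) : Set (Euc n) :=
  AffineMap.homothety p ((1 / 2 : ℝ) ^ k) '' D

lemma shrink_zero (p : Euc n) (D : Set (Euc n)) : shrink p 0 D = D := by
  simp [shrink]

lemma shrink_mono {p : Euc n} {k : ℕ} {D D' : Set (Euc n)} (h : D ⊆ D') :
    shrink p k D ⊆ shrink p k D' := image_mono h

lemma volume_real_shrink (p : Euc n) (k : ℕ) (D : Set (Euc n)) :
    volume.real (shrink p k D) = ((1 / 2 : ℝ) ^ k) ^ n * volume.real D := by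
  rw [shrink, Measure.real, Measure.addHaar_image_homothety, ENNReal.toReal_mul,
    ENNReal.toReal_ofReal (abs_nonneg _), abs_of_nonneg (by positivity), Measure.real,
    finrank_euclideanSpace, Fintype.card_fin]

namespace ConvexPiece

variable {Ω D D' : Set (Euc n)} {d d' : ℝ} {p : Euc n}

lemma shrink_subset (h : ConvexPiece Ω D d) (hp : p ∈ closure D) (k : ℕ) :
    shrink p k D ⊆ D := by
  rintro _ ⟨x, hx, rfl⟩
  have hc : (1 / 2 : ℝ) ^ k ≤ 1 := pow_le_one₀ (by norm_num) (by norm_num)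
  have h1 := h.convex.combo_closure_interior_mem_interior hp
    (h.isOpen.interior_eq.symm ▸ hx) (sub_nonneg.2 hc) (by positivity : (0:ℝ) < (1 / 2) ^ k)
    (by ring)
  rw [h.isOpen.interior_eq] at h1
  rw [AffineMap.homothety_apply, vsub_eq_sub, vadd_eq_add]
  convert h1 using 1
  module

lemma shrink_succ_subset (h : ConvexPiece Ω D d) (hp : p ∈ closure D) (k : ℕ) :
    shrink p (k + 1) D ⊆ shrink p k D := by
  have e : shrink p (k + 1) D = shrink p k (shrink p 1 D) := by
    rw [shrink, shrink, shrink, ← image_comp, ← AffineMap.coe_comp, ← AffineMap.homothety_mul,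
      pow_one, pow_succ]
  rw [e]
  exact shrink_mono (h.shrink_subset hp 1)

lemma mem_closure_shrink (hp : p ∈ closure D) (k : ℕ) : p ∈ closure (shrink p k D) := by
  have hc : Continuous (AffineMap.homothety p ((1 / 2 : ℝ) ^ k)) :=
    AffineMap.homothety_continuous _ _
  have := image_closure_subset_closure_image hc ⟨p, hp, rfl⟩
  simpa [shrink] using this

lemma shrink (h : ConvexPiece Ω D d) (hp : p ∈ closure D) (k : ℕ) :
    ConvexPiece Ω (shrink p k D) ((1 / 2) ^ k * d) where
  isOpen := (AffineMap.homothety_isOpenMap p _ (by positivity)) _ h.isOpen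
  convex := h.convex.affine_image _
  nonempty := h.nonempty.image _
  subset := (h.shrink_subset hp k).trans h.subset
  pos := mul_pos (by positivity) h.pos
  dist_le := by
    rintro _ ⟨x, hx, rfl⟩ _ ⟨y, hy, rfl⟩
    rw [AffineMap.homothety_apply, AffineMap.homothety_apply, dist_vadd_cancel_right,
      dist_smul₀, vsub_eq_sub, vsub_eq_sub, dist_sub_right, Real.norm_of_nonneg (by positivity)]
    exact mul_le_mul_of_nonneg_left (h.dist_le x hx y hy) (by positivity)

lemma of_subset (h : ConvexPiece Ω D d) (h' : ConvexPiece Ω D' d') (hsub : D ⊆ D') :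
    ConvexPiece Ω D d' where
  isOpen := h.isOpen
  convex := h.convex
  nonempty := h.nonempty
  subset := h.subset
  pos := h'.pos
  dist_le := fun x hx y hy => h'.dist_le x (hsub hx) y (hsub hy)

end ConvexPiece

/-- A sequence satisfying `e (k + 1) ≤ e k / 2 + B q ^ k` with `q < 1` tends to zero. -/
lemma tendsto_zero_of_le_half_add {e : ℕ → ℝ} {B q : ℝ} (he : ∀ k, 0 ≤ e k) (hB : 0 ≤ B)
    (hq : 0 ≤ q) (hq1 : q < 1) (h : ∀ k, e (k + 1) ≤ e k / 2 + B * q ^ k) :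
    Tendsto e atTop (𝓝 0) := by
  set Q := max q (3 / 4) with hQ
  have hQ0 : 0 ≤ Q := hq.trans (le_max_left _ _)
  have hQ1 : Q < 1 := max_lt hq1 (by norm_num)
  have hb : ∀ k, e k ≤ (e 0 + 4 * B) * Q ^ k := by
    intro k
    induction k with
    | zero => simp only [pow_zero, mul_one]; linarith
    | succ k ih =>
      have h1 : B * q ^ k ≤ B * Q ^ k :=
        mul_le_mul_of_nonneg_left (pow_le_pow_left₀ hq (le_max_left _ _) k) hB
      have h2 : (e 0 + 4 * B) * Q ^ k * (3 / 4) ≤ (e 0 + 4 * B) * Q ^ k * Q :=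
        mul_le_mul_of_nonneg_left (le_max_right _ _)
          (mul_nonneg (add_nonneg (he 0) (by linarith)) (pow_nonneg hQ0 k))
      have h3 : 0 ≤ e 0 * Q ^ k := mul_nonneg (he 0) (pow_nonneg hQ0 k)
      have := h k
      rw [pow_succ, ← mul_assoc]
      nlinarith
  refine squeeze_zero he hb ?_
  simpa using (tendsto_pow_atTop_nhds_zero_of_lt_one hQ0 hQ1).const_mul (e 0 + 4 * B)

namespace OscRegular

variable {Ω D D' : Set (Euc n)} {u : Euc n → ℝ} {G : Euc n → Euc n} {μ : Measure (Euc n)}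
  {C s d d' : ℝ} {p : Euc n}

lemma half_rpow_lt_one (h : OscRegular Ω u G μ C s) : (1 / 2 : ℝ) ^ (1 + s - (n : ℝ) / 2) < 1 :=
  Real.rpow_lt_one (by norm_num) (by norm_num) h.exponent

/-- The values at `p` of the affine approximations on the homothetic copies of `D` with centre `p`
converge geometrically, with ratio `2⁻¹` to the power `1 + s - n / 2`. The means of `u` over the
copies have the same limit, so that the sign of `u` passes to the limit. -/
lemma exists_tendsto_affApprox (h : OscRegular Ω u G μ C s) (hD : ConvexPiece Ω D d)
    (hp : p ∈ closure D) {κ : ℝ} (hκ : 0 < κ) (hvol : κ * d ^ n ≤ volume.real D) :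
    ∃ ℓ, Tendsto (fun k => affApprox u G (shrink p k D) p) atTop (𝓝 ℓ) ∧
      Tendsto (fun k => ⨍ x in shrink p k D, u x) atTop (𝓝 ℓ) ∧
      |ℓ - affApprox u G D p| ≤ (2 ^ (n + 1) + 1) * (√C / (κ / 2 ^ n)) /
        (1 - (1 / 2) ^ (1 + s - (n : ℝ) / 2)) * d ^ (1 + s - n / 2) * √(μ.real D) := by
  have := h.finite
  set β := 1 + s - (n : ℝ) / 2 with hβ
  set q : ℝ := (1 / 2) ^ β with hq
  have hq0 : 0 ≤ q := by positivity
  have hq1 : q < 1 := h.half_rpow_lt_one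
  have hd := hD.pos
  set K := (2 ^ (n + 1) + 1) * (√C / (κ / 2 ^ n)) with hK
  set a : ℕ → ℝ := fun k => affApprox u G (ObstacleFEM.shrink p k D) p with ha
  set m : ℕ → Euc n := fun k => ⨍ y in ObstacleFEM.shrink p k D, G y with hm
  have hcmp := fun k => h.affApprox_compare (hD.shrink hp k)
    ((hD.shrink hp (k + 1)).of_subset (hD.shrink hp k) (hD.shrink_succ_subset hp k))
    (hD.shrink_succ_subset hp k) (κ := κ / 2 ^ n) (by positivity) (by
      rw [volume_real_shrink, pow_succ, mul_pow, mul_pow, mul_assoc]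
      calc κ / 2 ^ n * (((1 / 2) ^ k) ^ n * d ^ n)
          = ((1 / 2) ^ k) ^ n * ((1 / 2) ^ n * (κ * d ^ n)) := by
            rw [div_pow (1:ℝ) 2 n, one_pow]; ring
        _ ≤ _ := by gcongr)
  have hμ : ∀ k, √(μ.real (ObstacleFEM.shrink p k D)) ≤ √(μ.real D) := fun k =>
    Real.sqrt_le_sqrt (measureReal_mono (hD.shrink_subset hp k))
  have hpow : ∀ k : ℕ, ((1 / 2 : ℝ) ^ k * d) ^ β = q ^ k * d ^ β := fun k => by
    rw [Real.mul_rpow (by positivity) hd.le, hq, ← Real.rpow_natCast, ← Real.rpow_mul (by norm_num),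
      ← Real.rpow_natCast, ← Real.rpow_mul (by norm_num), mul_comm β]
  have hstep : ∀ k, dist (a k) (a (k + 1)) ≤ K * d ^ β * √(μ.real D) * q ^ k := by
    intro k
    rw [dist_comm, Real.dist_eq]
    refine ((hcmp k).2 p fun x hx => (hD.shrink hp k).dist_le_of_mem_closure
      (ConvexPiece.mem_closure_shrink hp k) (hD.shrink_succ_subset hp k hx)).trans ?_
    rw [← hβ, hpow]
    calc K * (q ^ k * d ^ β) * √(μ.real (ObstacleFEM.shrink p k D))
        ≤ K * (q ^ k * d ^ β) * √(μ.real D) :=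
          mul_le_mul_of_nonneg_left (hμ k) (by positivity)
      _ = _ := by ring
  obtain ⟨ℓ, hℓ⟩ := cauchySeq_tendsto_of_complete (cauchySeq_of_le_geometric q _ hq1 hstep)
  have hdist := dist_le_of_le_geometric_of_tendsto₀ q _ hq1 hstep hℓ
  refine ⟨ℓ, hℓ, ?_, ?_⟩
  · -- the correction by the gradient vanishes in the limit
    have hstep2 : ∀ k, ‖m (k + 1)‖ * ((1 / 2) ^ (k + 1) * d) ≤
        ‖m k‖ * ((1 / 2) ^ k * d) / 2 +
          (√C / (κ / 2 ^ n) * d ^ β * √(μ.real D) / 2) * q ^ k := by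
      intro k
      have h1 : ‖m (k + 1)‖ ≤ ‖m k‖ + √C / (κ / 2 ^ n) *
          ((1 / 2) ^ k * d) ^ (s - (n : ℝ) / 2) * √(μ.real D) := by
        have h2 := (hcmp k).1
        have h3 : ‖m (k + 1)‖ ≤ ‖m k‖ + ‖m (k + 1) - m k‖ := by
          simpa using norm_add_le (m k) (m (k + 1) - m k)
        exact h3.trans (add_le_add le_rfl (h2.trans
          (mul_le_mul_of_nonneg_left (hμ k) (by have := hD.pos; positivity))))
      have h4 : ((1 / 2 : ℝ) ^ k * d) ^ (s - (n : ℝ) / 2) * ((1 / 2) ^ k * d) = q ^ k * d ^ β := by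
        rw [← hpow, hβ, add_sub_assoc, Real.rpow_add (by positivity), Real.rpow_one, mul_comm]
      calc ‖m (k + 1)‖ * ((1 / 2) ^ (k + 1) * d)
          ≤ (‖m k‖ + √C / (κ / 2 ^ n) * ((1 / 2) ^ k * d) ^ (s - (n : ℝ) / 2) * √(μ.real D)) *
            ((1 / 2) ^ (k + 1) * d) := by gcongr
        _ = ‖m k‖ * ((1 / 2) ^ k * d) / 2 + √C / (κ / 2 ^ n) * √(μ.real D) / 2 *
            (((1 / 2 : ℝ) ^ k * d) ^ (s - (n : ℝ) / 2) * ((1 / 2) ^ k * d)) := by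
            rw [pow_succ]; ring
        _ = _ := by rw [h4]; ring
    have he := tendsto_zero_of_le_half_add (e := fun k => ‖m k‖ * ((1 / 2) ^ k * d))
      (fun k => by positivity) (by positivity) hq0 hq1 hstep2
    have hdiff : ∀ k, ‖(⨍ x in ObstacleFEM.shrink p k D, u x) - a k‖ ≤
        ‖m k‖ * ((1 / 2) ^ k * d) := by
      intro k
      have hk := hD.shrink hp k
      have hu := integrableOn_of_memLp h.grad.1 hk
      have hl : IntegrableOn (fun x => ⟪m k, p - x⟫) (ObstacleFEM.shrink p k D) :=
        integrableOn_of_memLp (Ω := Ω) (memLp_of_continuous h.isBounded (by fun_prop)) hk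
      have e1 : (⨍ x in ObstacleFEM.shrink p k D, u x) - a k =
          -⨍ x in ObstacleFEM.shrink p k D, ⟪m k, p - x⟫ := by
        rw [show a k = ⨍ x in ObstacleFEM.shrink p k D, (u x + ⟪m k, p - x⟫) from rfl]
        simp only [setAverage_eq _ _ (ObstacleFEM.shrink p k D)]
        rw [integral_add hu hl, smul_add]
        ring
      rw [e1, norm_neg, setAverage_eq, norm_smul, norm_inv, Real.norm_of_nonneg measureReal_nonneg,
        inv_mul_le_iff₀ hk.volume_real_pos, mul_comm]
      refine norm_setIntegral_le_of_norm_le_const hk.volume_ne_top.lt_top fun x hx => ?_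
      refine (norm_inner_le_norm _ _).trans ?_
      rw [← dist_eq_norm p x]
      gcongr
      exact hk.dist_le_of_mem_closure (ConvexPiece.mem_closure_shrink hp k) hx
    have h0 := squeeze_zero_norm hdiff he
    simpa using h0.add hℓ
  · rw [abs_sub_comm, ← Real.dist_eq]
    have e0 : a 0 = affApprox u G D p := by simp only [ha, shrink_zero]
    rw [← e0]
    refine hdist.trans (le_of_eq ?_)
    ring

/-- Nested convex sets lead to the same limit at a common point of their closures. -/
lemma tendsto_affApprox_of_subset (h : OscRegular Ω u G μ C s) (hD : ConvexPiece Ω D d)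
    (hD' : ConvexPiece Ω D' d') (hsub : D ⊆ D') (hp : p ∈ closure D) :
    Tendsto (fun k => affApprox u G (shrink p k D) p - affApprox u G (shrink p k D') p)
      atTop (𝓝 0) := by
  have := h.finite
  have hd := hD'.pos
  have hp' : p ∈ closure D' := closure_mono hsub hp
  set κ := volume.real D / d' ^ n with hκ
  have hκ0 : 0 < κ := div_pos hD.volume_real_pos (by positivity)
  set β := 1 + s - (n : ℝ) / 2 with hβ
  have hcmp := fun k => (h.affApprox_compare (hD'.shrink hp' k)
    ((hD.shrink hp k).of_subset (hD'.shrink hp' k) (shrink_mono hsub))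
    (shrink_mono hsub) hκ0 (by
      rw [volume_real_shrink, hκ, mul_pow]
      apply le_of_eq
      field_simp)).2 p fun x hx => (hD'.shrink hp' k).dist_le_of_mem_closure
        (ConvexPiece.mem_closure_shrink hp' k) (shrink_mono hsub hx)
  have hb : ∀ k, ‖affApprox u G (ObstacleFEM.shrink p k D) p -
      affApprox u G (ObstacleFEM.shrink p k D') p‖ ≤
      (2 ^ (n + 1) + 1) * (√C / κ) * ((1 / 2) ^ k * d') ^ β * √(μ.real univ) := by
    intro k
    exact (hcmp k).trans (mul_le_mul_of_nonneg_left
      (Real.sqrt_le_sqrt (measureReal_mono (subset_univ _))) (by positivity))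
  refine squeeze_zero_norm hb ?_
  have h1 : Tendsto (fun k : ℕ => ((1 / 2 : ℝ) ^ k * d') ^ β) atTop (𝓝 0) := by
    have h2 : Tendsto (fun k : ℕ => (1 / 2 : ℝ) ^ k * d') atTop (𝓝 0) := by
      simpa using (tendsto_pow_atTop_nhds_zero_of_lt_one (r := (1 / 2 : ℝ)) (by norm_num)
        (by norm_num)).mul_const d'
    have h3 := h2.rpow_const (p := β) (Or.inr h.exponent.le)
    rwa [Real.zero_rpow h.exponent.ne'] at h3
  simpa using (h1.const_mul _).mul_const _

end OscRegular

section

variable {Ω D D' : Set (Euc n)} {u : Euc n → ℝ} {G : Euc n → Euc n} {μ : Measure (Euc n)}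
  {C s d d' : ℝ} {p : Euc n}

lemma exists_convexPiece (hb : Bornology.IsBounded Ω) (ho : IsOpen D) (hc : Convex ℝ D)
    (hne : D.Nonempty) (hsub : D ⊆ Ω) : ∃ d, ConvexPiece Ω D d := by
  have hbD := hb.subset hsub
  refine ⟨Metric.diam D + 1, ho, hc, hne, hsub, by positivity, fun x hx y hy => ?_⟩
  linarith [Metric.dist_le_diam_of_mem hbD hx hy]

open scoped Pointwise in
/-- At each point `p` of the closure of a Lipschitz domain there is a cone in the domain with
vertex `p` such that every open convex subset of `Ω` with `p` in its closure can, after shrinking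
towards `p`, be joined to the cone within a convex subset of `Ω`. -/
lemma exists_cone_join (hΩ : IsOpen Ω) (hb : Bornology.IsBounded Ω) (hL : HasLipschitzBoundary Ω)
    (hp : p ∈ closure Ω) :
    ∃ A, (∃ a, ConvexPiece Ω A a) ∧ p ∈ closure A ∧
      ∀ D d, ConvexPiece Ω D d → p ∈ closure D →
        ∃ k D' d', ConvexPiece Ω D' d' ∧ shrink p k D ⊆ D' ∧ A ⊆ D' := by
  obtain ⟨e, θ, ρ, hθ, hρ, hcone⟩ := exists_coneAt hΩ hL hp
  -- `S` is the closed cone of directions, truncated at height `ρ`, and `A` the open cone at `p`;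
  -- half the aperture leaves room for perturbing the vertex
  set S : Set (Euc n) := {v | ∃ t : ℝ, 0 ≤ t ∧ t < ρ ∧ ‖v - t • e‖ ≤ t * (θ / 2)} with hS
  set A : Set (Euc n) := {x | ∃ t : ℝ, 0 < t ∧ t < ρ ∧ ‖x - p - t • e‖ < t * (θ / 2)} with hA
  have hSΩ : ∀ y ∈ Ω ∩ Metric.ball p ρ, ∀ v ∈ S, y + v ∈ Ω := by
    rintro y hy v ⟨t, ht, htρ, hv⟩
    rcases ht.eq_or_lt with rfl | ht0
    · have : v = 0 := by simpa using hv
      rw [this, add_zero]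
      exact hy.1
    · have h1 : t • (t⁻¹ • v) = v := smul_inv_smul₀ ht0.ne' v
      rw [← h1]
      refine hcone y hy t ht htρ _ ?_
      rw [Metric.mem_ball, dist_eq_norm]
      have h2 : t⁻¹ • v - e = t⁻¹ • (v - t • e) := by
        rw [smul_sub, inv_smul_smul₀ ht0.ne']
      rw [h2, norm_smul, norm_inv, Real.norm_of_nonneg ht, inv_mul_lt_iff₀ ht0]
      exact hv.trans_lt (mul_lt_mul_of_pos_left (by linarith) ht0)
  -- a point of the cone is reached from every point close enough to its vertex
  have hAS : ∀ B : Set (Euc n), p ∈ closure B → ∀ x ∈ A, ∃ y ∈ B ∩ Metric.ball p ρ, x - y ∈ S := by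
    rintro B hB x ⟨t, ht, htρ, hx⟩
    obtain ⟨y, hy, hyp⟩ := Metric.mem_closure_iff.1 hB (min ρ (t * (θ / 2) - ‖x - p - t • e‖))
      (lt_min hρ (sub_pos.2 hx))
    rw [lt_min_iff] at hyp
    refine ⟨y, ⟨hy, by rw [Metric.mem_ball, dist_comm]; exact hyp.1⟩, t, ht.le, htρ, ?_⟩
    have h1 : x - y - t • e = (x - p - t • e) + (p - y) := by abel
    rw [h1]
    refine (norm_add_le _ _).trans ?_
    rw [← dist_eq_norm p y]
    linarith [hyp.2]
  have hAΩ : A ⊆ Ω := by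
    intro x hx
    obtain ⟨y, hy, hv⟩ := hAS Ω hp x hx
    simpa using hSΩ y hy _ hv
  have hSc : Convex ℝ S := by
    rintro v ⟨t, ht, htρ, hv⟩ v' ⟨t', ht', htρ', hv'⟩ a b ha hb hab
    refine ⟨a * t + b * t', by positivity, ?_, ?_⟩
    · rcases ha.eq_or_lt with rfl | ha0
      · have : b = 1 := by linarith
        subst this; simpa using htρ'
      · nlinarith
    · have e1 : a • v + b • v' - (a * t + b * t') • e = a • (v - t • e) + b • (v' - t' • e) := by
        module
      rw [e1]
      refine (norm_add_le _ _).trans ?_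
      rw [norm_smul, norm_smul, Real.norm_of_nonneg ha, Real.norm_of_nonneg hb]
      nlinarith
  have hAc : Convex ℝ A := by
    rintro v ⟨t, ht, htρ, hv⟩ v' ⟨t', ht', htρ', hv'⟩ a b ha hb hab
    have e1 : a • v + b • v' - p - (a * t + b * t') • e =
        a • (v - p - t • e) + b • (v' - p - t' • e) := by
      obtain rfl : b = 1 - a := by linarith
      module
    have e2 : ‖a • v + b • v' - p - (a * t + b * t') • e‖ ≤
        a * ‖v - p - t • e‖ + b * ‖v' - p - t' • e‖ := by
      rw [e1]
      refine (norm_add_le _ _).trans ?_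
      rw [norm_smul, norm_smul, Real.norm_of_nonneg ha, Real.norm_of_nonneg hb]
    rcases ha.eq_or_lt with rfl | ha0
    · have : b = 1 := by linarith
      subst this
      exact ⟨t', ht', htρ', by simpa using hv'⟩
    · exact ⟨a * t + b * t', by positivity, by nlinarith, e2.trans_lt (by nlinarith)⟩
  have hAo : IsOpen A := by
    have : A = ⋃ t : ℝ, {x | 0 < t ∧ t < ρ ∧ ‖x - p - t • e‖ < t * (θ / 2)} := by
      ext x; simp [hA]
    rw [this]
    refine isOpen_iUnion fun t => ?_
    simp only [ofPred_and]
    exact isOpen_const.inter (isOpen_const.inter (isOpen_lt (by fun_prop) continuous_const))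
  have hpt : ∀ t : ℝ, 0 < t → t < ρ → p + t • e ∈ A := fun t ht htρ =>
    ⟨t, ht, htρ, by simp; positivity⟩
  refine ⟨A, exists_convexPiece hb hAo hAc ⟨_, hpt (ρ / 2) (by positivity) (by linarith)⟩ hAΩ,
    ?_, ?_⟩
  · refine Metric.mem_closure_iff.2 fun ε hε => ?_
    set t := min (ρ / 2) (ε / (2 * (‖e‖ + 1))) with ht
    have ht0 : 0 < t := lt_min (by positivity) (by positivity)
    refine ⟨_, hpt t ht0 ((min_le_left _ _).trans_lt (by linarith)), ?_⟩
    rw [dist_self_add_right, norm_smul, Real.norm_of_nonneg ht0.le]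
    calc t * ‖e‖ ≤ ε / (2 * (‖e‖ + 1)) * (‖e‖ + 1) :=
          mul_le_mul (min_le_right _ _) (by linarith) (norm_nonneg _) (by positivity)
      _ = ε / 2 := by field_simp
      _ < ε := by linarith
  · intro D d hD hpD
    -- once the copy of `D` lies in the ball where the cone condition holds, its sum with the cone `S`
    -- is convex and contained in `Ω`
    have hk : ∃ k : ℕ, (1 / 2 : ℝ) ^ k * d < ρ := by
      obtain ⟨k, hk⟩ := exists_pow_lt_of_lt_one (div_pos hρ hD.pos) (by norm_num : (1 / 2 : ℝ) < 1)
      exact ⟨k, (lt_div_iff₀ hD.pos).1 hk⟩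
    obtain ⟨k, hk⟩ := hk
    have hDk := hD.shrink hpD k
    have hpk := ConvexPiece.mem_closure_shrink hpD k
    have hsub : shrink p k D + S ⊆ Ω := by
      rintro _ ⟨y, hy, v, hv, rfl⟩
      refine hSΩ y ⟨hDk.subset hy, ?_⟩ v hv
      rw [Metric.mem_ball, dist_comm]
      exact (hDk.dist_le_of_mem_closure hpk hy).trans_lt hk
    have h0 : (0 : Euc n) ∈ S := ⟨0, le_rfl, hρ, by simp⟩
    obtain ⟨d', hd'⟩ := exists_convexPiece hb (hDk.isOpen.add_right (t := S)) (hDk.convex.add hSc)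
      (hDk.nonempty.add ⟨0, h0⟩) hsub
    refine ⟨k, _, d', hd', fun y hy => ⟨y, hy, 0, h0, add_zero y⟩, fun x hx => ?_⟩
    obtain ⟨y, hy, hv⟩ := hAS _ hpk x hx
    exact ⟨y, hy.1, x - y, hv, by simp⟩

namespace OscRegular

/-- The limit of the affine approximations at `p` does not depend on the convex set: the limits for
two sets are both compared with that for a cone with vertex `p`. -/
lemma tendsto_affApprox_sub (h : OscRegular Ω u G μ C s) (hD : ConvexPiece Ω D d)
    (hD' : ConvexPiece Ω D' d') (hp : p ∈ closure D) (hp' : p ∈ closure D') :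
    Tendsto (fun k => affApprox u G (shrink p k D) p - affApprox u G (shrink p k D') p)
      atTop (𝓝 0) := by
  obtain ⟨A, ⟨a, hA⟩, hpA, hjoin⟩ := exists_cone_join h.isOpen h.isBounded h.lipschitz
    (closure_mono hD.subset hp)
  have key : ∀ B b, ConvexPiece Ω B b → p ∈ closure B →
      Tendsto (fun k => affApprox u G (shrink p k B) p - affApprox u G (shrink p k A) p)
        atTop (𝓝 0) := by
    intro B b hB hpB
    obtain ⟨k, E, ε, hE, hBE, hAE⟩ := hjoin B b hB hpB
    have hBk := hB.shrink hpB k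
    have hpk := ConvexPiece.mem_closure_shrink hpB k
    have h1 := h.tendsto_affApprox_of_subset hBk hB (hB.shrink_subset hpB k) hpk
    have h2 := h.tendsto_affApprox_of_subset hBk hE hBE hpk
    have h3 := h.tendsto_affApprox_of_subset hA hE hAE hpA
    have h4 := (h2.sub h1).sub h3
    simp only [sub_zero] at h4
    exact h4.congr fun j => by ring
  have h5 := (key D d hD hp).sub (key D' d' hD' hp')
  simp only [sub_zero] at h5
  exact h5.congr fun j => by ring

/-- Point values of `u` on the closures of open convex subsets of the domain, defined as limits of the
affine approximations on homothetic copies, and the error of the affine approximations with respect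
to them. They are non-negative if `u` is. -/
lemma exists_pointValues (h : OscRegular Ω u G μ C s) :
    ∃ U : Euc n → ℝ,
      ((∀ᵐ x ∂volume.restrict Ω, 0 ≤ u x) → ∀ p, 0 ≤ U p) ∧
      ∀ κ : ℝ, 0 < κ → ∃ K : ℝ, 0 ≤ K ∧ ∀ (D : Set (Euc n)) (d : ℝ), ConvexPiece Ω D d →
        κ * d ^ n ≤ volume.real D → ∀ p ∈ closure D,
          |U p - affApprox u G D p| ≤ K * d ^ (1 + s - (n : ℝ) / 2) * √(μ.real D) := by
  classical
  set P : Euc n → ℝ → Prop := fun p ℓ => ∃ D d, ConvexPiece Ω D d ∧ p ∈ closure D ∧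
    Tendsto (fun k => affApprox u G (shrink p k D) p) atTop (𝓝 ℓ) ∧
    Tendsto (fun k => ⨍ x in shrink p k D, u x) atTop (𝓝 ℓ) with hP
  -- points without such a limit, in particular those outside the closure of `Ω`, get the value `0`
  refine ⟨fun p => if hx : ∃ ℓ, P p ℓ then hx.choose else 0, fun hu p => ?_, fun κ hκ => ?_⟩
  · dsimp only
    split_ifs with hx
    · obtain ⟨D, d, hD, hp, -, hlim⟩ := hx.choose_spec
      refine ge_of_tendsto' hlim fun k => ?_
      have hk := hD.shrink hp k
      rw [setAverage_eq]
      refine smul_nonneg (inv_nonneg.2 measureReal_nonneg) (integral_nonneg_of_ae ?_)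
      exact ae_mono (Measure.restrict_mono hk.subset le_rfl) hu
    · exact le_rfl
  · have hq := h.half_rpow_lt_one
    refine ⟨(2 ^ (n + 1) + 1) * (√C / (κ / 2 ^ n)) / (1 - (1 / 2) ^ (1 + s - (n : ℝ) / 2)),
      div_nonneg (by positivity) (by linarith), fun D d hD hvol p hp => ?_⟩
    obtain ⟨ℓ, h1, h2, h3⟩ := h.exists_tendsto_affApprox hD hp hκ hvol
    have hx : ∃ ℓ, P p ℓ := ⟨ℓ, D, d, hD, hp, h1, h2⟩
    dsimp only
    rw [dif_pos hx]
    obtain ⟨D', d', hD', hp', h1', -⟩ := hx.choose_spec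
    have h4 := h.tendsto_affApprox_sub hD hD' hp hp'
    have h5 : ℓ - hx.choose = 0 := tendsto_nhds_unique (h1.sub h1') h4
    rw [← sub_eq_zero.1 h5]
    exact h3

end OscRegular

end

/-! ### Mean oscillation of functions in Sobolev–Slobodeckij spaces -/

section

variable {Ω : Set (Euc n)} {u : Euc n → ℝ} {G : Euc n → Euc n}

lemma enorm_sq_eq_sum (v : Euc n) : ‖v‖ₑ ^ 2 = ∑ i, ‖v i‖ₑ ^ 2 := by
  have h1 : ∀ {F : Type} [NormedAddCommGroup F] (w : F), ‖w‖ₑ ^ 2 = ENNReal.ofReal (‖w‖ ^ 2) :=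
    fun w => by rw [← ofReal_norm, ENNReal.ofReal_pow (norm_nonneg _)]
  rw [h1, EuclideanSpace.norm_sq_eq, ENNReal.ofReal_sum_of_nonneg fun i _ => by positivity]
  simp only [h1]

lemma osc_eq_sum {A : Set (Euc n)} (hG : AEStronglyMeasurable G (volume.restrict A)) :
    osc A A G = ∑ i, osc A A (fun x => G x i) := by
  have hGi : ∀ i, AEMeasurable (fun x => G x i) (volume.restrict A) := fun i =>
    (EuclideanSpace.proj (𝕜 := ℝ) i).measurable.comp_aemeasurable hG.aemeasurable
  simp only [osc, enorm_sq_eq_sum]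
  rw [← lintegral_finsetSum']
  · refine lintegral_congr fun x => ?_
    rw [← lintegral_finsetSum' _ fun i _ => by have := hGi i; fun_prop]
    rfl
  · intro i _
    have h1 : AEMeasurable (fun z : Euc n × Euc n => ‖G z.1 i - G z.2 i‖ₑ ^ 2)
        ((volume.restrict A).prod (volume.restrict A)) :=
      (((hGi i).comp_quasiMeasurePreserving Measure.quasiMeasurePreserving_fst).sub
        ((hGi i).comp_quasiMeasurePreserving Measure.quasiMeasurePreserving_snd)).enorm.pow_const 2
    exact h1.lintegral_prod_right'

/-- The finite measures that control the components of the gradient add up to one for the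
gradient. -/
lemma oscRegular_of_components (hΩ : IsOpen Ω) (hb : Bornology.IsBounded Ω)
    (hL : HasLipschitzBoundary Ω) (hG : HasH1Grad Ω u G) {s : ℝ} (hs : 0 < 1 + s - (n : ℝ) / 2)
    {C : ℝ} (hC : 0 ≤ C)
    (h : ∀ i, ∃ μ : Measure (Euc n), IsFiniteMeasure μ ∧
      ∀ (D : Set (Euc n)) (d : ℝ), IsOpen D → Convex ℝ D → D ⊆ Ω → 0 < d →
        (∀ x ∈ D, ∀ y ∈ D, dist x y ≤ d) →
          osc D D (fun x => G x i) ≤ ENNReal.ofReal (C * d ^ ((n : ℝ) + 2 * s)) * μ D) :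
    ∃ μ, OscRegular Ω u G μ C s := by
  choose μ hμ hosc using h
  refine ⟨∑ i, μ i, hΩ, hb, hL, hG, hC, ⟨?_⟩, hs, fun D d hDo hDc hDΩ hd hdD => ?_⟩
  · rw [Measure.finsetSum_apply]
    exact ENNReal.sum_lt_top.2 fun i _ => (hμ i).1
  · rw [osc_eq_sum (hG.2.1.mono_measure (Measure.restrict_mono hDΩ le_rfl)),
      Measure.finsetSum_apply, Finset.mul_sum]
    exact Finset.sum_le_sum fun i _ => hosc i D d hDo hDc hDΩ hd hdD

/-- For points at distance at most `d` the Slobodeckij kernel is at least `d ^ -(n + 2 s)` times the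
squared difference, so the seminorm density `x ↦ ∫ k x y dy` serves as density of `μ`. -/
lemma exists_measure_osc_le_of_slobodeckij {f : Euc n → ℝ} {s : ℝ} (hs : 0 < s)
    (hf : slobodeckij Ω s f < ⊤) :
    ∃ μ : Measure (Euc n), IsFiniteMeasure μ ∧
      ∀ (D : Set (Euc n)) (d : ℝ), IsOpen D → D ⊆ Ω → 0 < d →
        (∀ x ∈ D, ∀ y ∈ D, dist x y ≤ d) →
          osc D D f ≤ ENNReal.ofReal (d ^ ((n : ℝ) + 2 * s)) * μ D := by
  set p := (n : ℝ) + 2 * s with hp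
  have hp0 : 0 < p := by positivity
  set k : Euc n → Euc n → ℝ≥0∞ := fun x y => ENNReal.ofReal (|f x - f y| ^ 2 / ‖x - y‖ ^ p) with hk
  refine ⟨(volume.restrict Ω).withDensity fun x => ∫⁻ y in Ω, k x y, ⟨?_⟩,
    fun D d hDo hDΩ hd hdD => ?_⟩
  · rw [withDensity_apply _ MeasurableSet.univ, Measure.restrict_univ]
    exact hf
  · have hpt : ∀ x ∈ D, ∀ y ∈ D, ‖f x - f y‖ₑ ^ 2 ≤ ENNReal.ofReal (d ^ p) * k x y := by
      intro x hx y hy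
      rw [← ofReal_norm, ← ENNReal.ofReal_pow (norm_nonneg _), hk,
        ← ENNReal.ofReal_mul (by positivity), Real.norm_eq_abs]
      refine ENNReal.ofReal_le_ofReal ?_
      rcases eq_or_ne x y with rfl | hxy
      · simp
      · have h0 : 0 < ‖x - y‖ := norm_pos_iff.2 (sub_ne_zero.2 hxy)
        have h1 : ‖x - y‖ ^ p ≤ d ^ p :=
          Real.rpow_le_rpow h0.le (dist_eq_norm x y ▸ hdD x hx y hy) hp0.le
        rw [← mul_div_assoc, le_div_iff₀ (by positivity), mul_comm]
        gcongr
    rw [withDensity_apply _ hDo.measurableSet, Measure.restrict_restrict hDo.measurableSet,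
      inter_eq_left.2 hDΩ, ← lintegral_const_mul' _ _ ENNReal.ofReal_ne_top]
    refine setLIntegral_mono' hDo.measurableSet fun x hx => ?_
    calc ∫⁻ y in D, ‖f x - f y‖ₑ ^ 2 ≤ ∫⁻ y in D, ENNReal.ofReal (d ^ p) * k x y :=
          setLIntegral_mono' hDo.measurableSet fun y hy => hpt x hx y hy
      _ = ENNReal.ofReal (d ^ p) * ∫⁻ y in D, k x y :=
          lintegral_const_mul' _ _ ENNReal.ofReal_ne_top
      _ ≤ _ := by gcongr

lemma volume_le_of_dist_le {D : Set (Euc n)} {d : ℝ} (hd : 0 ≤ d) {x : Euc n} (hx : x ∈ D)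
    (hdD : ∀ x ∈ D, ∀ y ∈ D, dist x y ≤ d) :
    volume D ≤ ENNReal.ofReal (d ^ n * volume.real (Metric.closedBall (0 : Euc n) 1)) := by
  have h1 : D ⊆ Metric.closedBall x d := fun y hy => hdD y hy x hx
  refine (measure_mono h1).trans (le_of_eq ?_)
  rw [Measure.addHaar_closedBall' volume x hd, finrank_euclideanSpace, Fintype.card_fin,
    ENNReal.ofReal_mul (by positivity), ofReal_measureReal measure_closedBall_lt_top.ne]

/-- The limiting case of smoothness `1`: by the Poincaré inequality the squared length of the weak
gradient serves as density of `μ`. -/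
lemma exists_measure_osc_le_of_memH1 (hΩ : IsOpen Ω) (hb : Bornology.IsBounded Ω)
    (hL : HasLipschitzBoundary Ω) {f : Euc n → ℝ} (hf : MemH1 Ω f) :
    ∃ μ : Measure (Euc n), IsFiniteMeasure μ ∧
      ∀ (D : Set (Euc n)) (d : ℝ), IsOpen D → Convex ℝ D → D ⊆ Ω → 0 < d →
        (∀ x ∈ D, ∀ y ∈ D, dist x y ≤ d) →
          osc D D f ≤ ENNReal.ofReal (4 * 2 ^ n *
            volume.real (Metric.closedBall (0 : Euc n) 1) * d ^ ((n : ℝ) + 2 * 1)) * μ D := by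
  obtain ⟨H, hH⟩ := memH1_iff.1 hf
  have hs := smoothLimit_of_hasH1Grad hΩ hb hL hH
  refine ⟨(volume.restrict Ω).withDensity fun x => ‖H x‖ₑ ^ 2, ⟨?_⟩,
    fun D d hDo hDc hDΩ hd hdD => ?_⟩
  · rw [withDensity_apply _ MeasurableSet.univ, Measure.restrict_univ]
    exact lsq_lt_top hH.2
  · rw [withDensity_apply _ hDo.measurableSet, Measure.restrict_restrict hDo.measurableSet,
      inter_eq_left.2 hDΩ]
    rcases D.eq_empty_or_nonempty with rfl | ⟨x, hx⟩
    · simp [osc]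
    set V := volume.real (Metric.closedBall (0 : Euc n) 1)
    have hVD : volume D ≤ ENNReal.ofReal (d ^ n * V) := volume_le_of_dist_le hd.le hx hdD
    have hDf : volume D ≠ ⊤ := (hVD.trans_lt ENNReal.ofReal_lt_top).ne
    refine (osc_convex_le hDc hDo.measurableSet hDΩ hDf hdD hH hs).trans ?_
    have e1 : ENNReal.ofReal (4 * 2 ^ n * V * d ^ ((n : ℝ) + 2 * 1)) =
        4 * 2 ^ n * ENNReal.ofReal d ^ 2 * ENNReal.ofReal (d ^ n * V) := by
      have e2 : 4 * 2 ^ n * V * d ^ ((n : ℝ) + 2 * 1) = 4 * 2 ^ n * d ^ 2 * (d ^ n * V) := by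
        rw [Real.rpow_add hd, Real.rpow_natCast, mul_one, Real.rpow_two]
        ring
      rw [e2, ENNReal.ofReal_mul (by positivity), ENNReal.ofReal_mul (by positivity),
        ENNReal.ofReal_mul (by positivity), ENNReal.ofReal_pow hd.le,
        ENNReal.ofReal_pow (by norm_num)]
      simp
    rw [e1]
    gcongr
    exact le_rfl

/-- Functions in `H^r(Ω)`, `1 < r ≤ 2`, have gradients of controlled oscillation. For `r = 2` the
integer part is `2` and no fractional seminorm occurs, hence the case distinction. -/
lemma exists_oscRegular (hΩ : IsOpen Ω) (hb : Bornology.IsBounded Ω)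
    (hL : HasLipschitzBoundary Ω) {r : ℝ} (hr₁ : 1 < r) (hr₂ : r ≤ 2) (hrn : (n : ℝ) / 2 < r)
    (hu : MemHr Ω r u) : ∃ G μ C, OscRegular Ω u G μ C (r - 1) := by
  rcases hr₂.lt_or_eq with hr | rfl
  · have h1 : ⌊r⌋ = 1 := by rw [Int.floor_eq_iff]; norm_num; constructor <;> linarith
    have h2 : ⌊r⌋₊ = 1 := by rw [Nat.floor_eq_iff (by linarith)]; norm_num; constructor <;> linarith
    have h3 : Int.fract r = r - 1 := by rw [Int.fract, h1]; norm_num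
    rw [MemHr, h2, h3] at hu
    obtain ⟨hu1, G, hG, hGi⟩ := hu
    obtain ⟨μ, hμ⟩ := oscRegular_of_components hΩ hb hL
      ⟨hu1, memLp_euc_iff.2 fun i => (hGi i).1, hG⟩ (s := r - 1) (by linarith) zero_le_one
      (fun i => by
        obtain ⟨μ, h, h'⟩ := exists_measure_osc_le_of_slobodeckij (by linarith)
          ((hGi i).2 (by linarith))
        exact ⟨μ, h, fun D d hDo _ hDΩ hd hdD => by simpa using h' D d hDo hDΩ hd hdD⟩)
    exact ⟨G, μ, 1, hμ⟩
  · have h2 : ⌊(2 : ℝ)⌋₊ = 2 := Nat.floor_ofNat 2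
    have h3 : Int.fract (2 : ℝ) = 0 := Int.fract_ofNat 2
    rw [MemHr, h2, h3] at hu
    obtain ⟨hu1, G, hG, hGi⟩ := hu
    have e : (2 : ℝ) - 1 = 1 := by norm_num
    obtain ⟨μ, hμ⟩ := oscRegular_of_components hΩ hb hL
      ⟨hu1, memLp_euc_iff.2 fun i => (hGi i).1, hG⟩ (s := 1) (by linarith)
      (C := 4 * 2 ^ n * volume.real (Metric.closedBall (0 : Euc n) 1)) (by positivity)
      (fun i => exists_measure_osc_le_of_memH1 hΩ hb hL (hGi i))
    exact ⟨G, μ, _, e ▸ hμ⟩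

end

/-! ### Triangulations -/

section

variable {Ω : Set (Euc n)} {T : Geometry.SimplicialComplex ℝ (Euc n)} {s t : Finset (Euc n)}

/-- A domain with Lipschitz boundary lies on one side of its boundary, so it is recovered from its
closure; hence the open simplices of a triangulation lie in it. -/
lemma interior_closure_of_hasLipschitzBoundary (hΩ : IsOpen Ω) (hL : HasLipschitzBoundary Ω) :
    interior (closure Ω) = Ω := by
  refine Subset.antisymm (fun x hx => ?_) (interior_maximal subset_closure hΩ)
  by_contra hxΩ
  have hxf : x ∈ frontier Ω := ⟨interior_subset hx, by rwa [hΩ.interior_eq]⟩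
  obtain ⟨e, L, ψ, ρ, he, hψ, hρ, hmem⟩ := hL x hxf
  have hx0 := frontier_eq_of_epigraph hΩ hψ.continuous hmem (Metric.mem_ball_self hρ) hxf
  have hee : ⟪e, e⟫ = 1 := by rw [real_inner_self_eq_norm_sq, he, one_pow]
  -- points slightly below the graph are not in the closure of the domain
  have hlim : Tendsto (fun t : ℝ => x - t • e) (𝓝[>] 0) (𝓝 x) := by
    have h1 : Tendsto (fun t : ℝ => x - t • e) (𝓝 0) (𝓝 (x - (0 : ℝ) • e)) := by
      apply Continuous.tendsto; fun_prop
    simp only [zero_smul, sub_zero] at h1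
    exact h1.mono_left nhdsWithin_le_nhds
  have hev := (hlim.eventually (isOpen_interior.mem_nhds hx)).and
    ((hlim.eventually (Metric.isOpen_ball.mem_nhds (Metric.mem_ball_self hρ))).and
      self_mem_nhdsWithin)
  obtain ⟨t, ht1, ht2, ht3⟩ := hev.exists
  have ht3 : 0 < t := ht3
  set y := x - t • e with hy
  have hy1 : y - ⟪e, y⟫ • e = x - ⟪e, x⟫ • e := by
    rw [hy, inner_sub_right, inner_smul_right, hee]
    module
  have hy2 : ⟪e, y⟫ < ψ (y - ⟪e, y⟫ • e) := by
    rw [hy1, hx0, hy, inner_sub_right, inner_smul_right, hee]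
    linarith
  have hyo : IsOpen {z : Euc n | ⟪e, z⟫ < ψ (z - ⟪e, z⟫ • e)} :=
    isOpen_lt (by fun_prop) (hψ.continuous.comp (by fun_prop))
  obtain ⟨z, ⟨hz1, hz2⟩, hz3⟩ := mem_closure_iff.1 (interior_subset ht1) _
    (hyo.inter Metric.isOpen_ball) ⟨hy2, ht2⟩
  exact lt_asymm hz1 ((hmem z hz2).1 hz3)

/-- The open simplex with vertex set `s`. -/
def cell (s : Finset (Euc n)) : Set (Euc n) := interior (convexHull ℝ (s : Set (Euc n)))

lemma isClosed_hull (s : Finset (Euc n)) : IsClosed (convexHull ℝ (s : Set (Euc n))) :=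
  (s.finite_toSet.isCompact_convexHull (𝕜 := ℝ)).isClosed

lemma isOpen_cell (s : Finset (Euc n)) : IsOpen (cell s) := isOpen_interior

lemma convex_cell (s : Finset (Euc n)) : Convex ℝ (cell s) := (convex_convexHull ℝ _).interior

lemma cell_subset (s : Finset (Euc n)) : cell s ⊆ convexHull ℝ (s : Set (Euc n)) :=
  interior_subset

namespace IsTriangulation

lemma finite_facets (hT : IsTriangulation Ω T) : T.facets.Finite :=
  hT.finite.subset Geometry.SimplicialComplex.facets_subset

lemma affineSpan_eq_top (hT : IsTriangulation Ω T) (hs : s ∈ T.facets) :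
    affineSpan ℝ (s : Set (Euc n)) = ⊤ := by
  have h1 := (T.indep hs.1).affineSpan_eq_top_iff_card_eq_finrank_add_one.2 (by
    rw [Fintype.card_coe, hT.pure s hs, finrank_euclideanSpace, Fintype.card_fin])
  simpa using h1

lemma cell_nonempty (hT : IsTriangulation Ω T) (hs : s ∈ T.facets) : (cell s).Nonempty :=
  interior_convexHull_nonempty_iff_affineSpan_eq_top.2 (hT.affineSpan_eq_top hs)

lemma closure_cell (hT : IsTriangulation Ω T) (hs : s ∈ T.facets) :
    closure (cell s) = convexHull ℝ (s : Set (Euc n)) := by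
  rw [cell, (convex_convexHull ℝ _).closure_interior_eq_closure_of_nonempty_interior
    (hT.cell_nonempty hs), (isClosed_hull s).closure_eq]

lemma hull_subset (hT : IsTriangulation Ω T) (hs : s ∈ T.facets) :
    convexHull ℝ (s : Set (Euc n)) ⊆ closure Ω :=
  hT.space_eq ▸ Geometry.SimplicialComplex.convexHull_subset_space hs.1

lemma cell_subset_domain (hT : IsTriangulation Ω T) (hΩ : IsOpen Ω) (hL : HasLipschitzBoundary Ω)
    (hs : s ∈ T.facets) : cell s ⊆ Ω := by
  rw [← interior_closure_of_hasLipschitzBoundary hΩ hL]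
  exact interior_mono (hT.hull_subset hs)

lemma closure_eq_iUnion (hT : IsTriangulation Ω T) :
    closure Ω = ⋃ s : T.facets, convexHull ℝ ((s : Finset (Euc n)) : Set (Euc n)) := by
  refine Subset.antisymm (fun x hx => ?_) (iUnion_subset fun s => hT.hull_subset s.2)
  rw [← hT.space_eq] at hx
  obtain ⟨s, hs, hxs⟩ := Geometry.SimplicialComplex.mem_space_iff.1 hx
  obtain ⟨t, hst, ht⟩ := hT.finite.exists_le_maximal hs
  exact mem_iUnion.2 ⟨⟨t, ht.prop, fun a ha hta => hta.antisymm (ht.le_of_ge ha hta)⟩,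
    convexHull_mono (by exact_mod_cast hst) hxs⟩

/-- Two simplices of a complex meet in the hull of their common vertices, which has empty interior
if the simplices are distinct. -/
lemma disjoint_cell (hs : s ∈ T.facets) (ht : t ∈ T.facets)
    (hst : s ≠ t) : Disjoint (cell s) (cell t) := by
  classical
  rw [Set.disjoint_iff_inter_eq_empty, ← not_nonempty_iff_eq_empty]
  intro hne
  have h1 : cell s ∩ cell t ⊆ interior (convexHull ℝ ((s ∩ t : Finset (Euc n)) : Set (Euc n))) := by
    refine interior_maximal ?_ ((isOpen_cell s).inter (isOpen_cell t))
    rw [Finset.coe_inter, ← Geometry.SimplicialComplex.convexHull_inter_convexHull hs.1 ht.1]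
    exact inter_subset_inter (cell_subset s) (cell_subset t)
  have h2 := interior_convexHull_nonempty_iff_affineSpan_eq_top.1 (hne.mono h1)
  -- a vertex of `s` outside `t` is not in the affine span of the others
  obtain ⟨p, hp, hpt⟩ : ∃ p ∈ s, p ∉ t := by
    by_contra! hcon
    exact hst (hs.2 ht.1 hcon)
  have h3 := (T.indep hs.1).notMem_affineSpan_sdiff ⟨p, hp⟩ univ
  apply h3
  have h4 : ((s ∩ t : Finset (Euc n)) : Set (Euc n)) ⊆
      ((↑) : s → Euc n) '' (univ \ {⟨p, hp⟩}) := by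
    intro q hq
    rw [Finset.coe_inter] at hq
    refine ⟨⟨q, hq.1⟩, ⟨mem_univ _, fun h => hpt ?_⟩, rfl⟩
    rw [mem_singleton_iff, Subtype.mk.injEq] at h
    exact h ▸ hq.2
  have h5 := affineSpan_mono ℝ h4
  rw [h2] at h5
  exact h5 trivial

lemma dist_le_meshSize (hT : IsTriangulation Ω T) (hs : s ∈ T.facets) {x y : Euc n}
    (hx : x ∈ s) (hy : y ∈ s) : dist x y ≤ meshSize T := by
  refine le_csSup ?_ ⟨s, hs, x, hx, y, hy, rfl⟩
  have hfin : {d | ∃ s ∈ T.facets, ∃ x ∈ s, ∃ y ∈ s, d = dist x y}.Finite := by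
    have h1 : (⋃ s ∈ T.facets, (fun z : Euc n × Euc n => dist z.1 z.2) ''
        ((s : Set (Euc n)) ×ˢ (s : Set (Euc n)))).Finite :=
      hT.finite_facets.biUnion fun s _ => (s.finite_toSet.prod s.finite_toSet).image _
    refine h1.subset ?_
    rintro d ⟨s, hs, x, hx, y, hy, rfl⟩
    exact mem_biUnion hs ⟨(x, y), ⟨hx, hy⟩, rfl⟩
  exact hfin.bddAbove

lemma diam_le_meshSize (hT : IsTriangulation Ω T) (hs : s ∈ T.facets) :
    Metric.diam (convexHull ℝ (s : Set (Euc n))) ≤ meshSize T := by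
  obtain ⟨x, hx⟩ := T.nonempty_of_mem_faces hs.1
  have h0 : 0 ≤ meshSize T := by simpa using hT.dist_le_meshSize hs hx hx
  rw [convexHull_diam]
  exact Metric.diam_le_of_forall_dist_le h0 fun _ hx _ hy => hT.dist_le_meshSize hs hx hy

lemma diam_pos (hT : IsTriangulation Ω T) (hn : 1 ≤ n) (hs : s ∈ T.facets) :
    0 < Metric.diam (convexHull ℝ (s : Set (Euc n))) := by
  obtain ⟨x, hx, y, hy, hxy⟩ := Finset.one_lt_card.1 (by rw [hT.pure s hs]; omega : 1 < s.card)
  rw [convexHull_diam]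
  exact (dist_pos.2 hxy).trans_le (Metric.dist_le_diam_of_mem s.finite_toSet.isBounded hx hy)

lemma meshSize_pos (hT : IsTriangulation Ω T) (hn : 1 ≤ n) (hne : Ω.Nonempty) :
    0 < meshSize T := by
  obtain ⟨x, hx⟩ := hne
  have := subset_closure hx
  rw [hT.closure_eq_iUnion] at this
  obtain ⟨s, -⟩ := mem_iUnion.1 this
  exact (hT.diam_pos hn s.2).trans_le (hT.diam_le_meshSize s.2)

lemma convexPiece_cell (hT : IsTriangulation Ω T) (hΩ : IsOpen Ω) (hL : HasLipschitzBoundary Ω)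
    (hn : 1 ≤ n) (hs : s ∈ T.facets) :
    ConvexPiece Ω (cell s) (Metric.diam (convexHull ℝ (s : Set (Euc n)))) where
  isOpen := isOpen_cell s
  convex := convex_cell s
  nonempty := hT.cell_nonempty hs
  subset := hT.cell_subset_domain hΩ hL hs
  pos := hT.diam_pos hn hs
  dist_le := fun _ hx _ hy => Metric.dist_le_diam_of_mem
    (s.finite_toSet.isCompact_convexHull (𝕜 := ℝ)).isBounded (cell_subset s hx) (cell_subset s hy)

/-- The boundaries of the simplices are null sets. -/
lemma ae_mem_cell (hT : IsTriangulation Ω T) :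
    ∀ᵐ x ∂volume.restrict Ω, ∃ s ∈ T.facets, x ∈ cell s := by
  have h1 : ∀ s ∈ T.facets, ∀ᵐ x : Euc n, x ∉ frontier (convexHull ℝ (s : Set (Euc n))) :=
    fun s _ => measure_eq_zero_iff_ae_notMem.1 ((convex_convexHull ℝ _).addHaar_frontier volume)
  have h2 := (ae_ball_iff hT.finite_facets.countable).2 h1
  have h3 : ∀ᵐ x ∂volume.restrict (closure Ω), x ∈ closure Ω :=
    ae_restrict_mem isClosed_closure.measurableSet
  filter_upwards [ae_restrict_of_ae h2, ae_mono (Measure.restrict_mono subset_closure le_rfl) h3]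
    with x hx hxΩ
  rw [hT.closure_eq_iUnion] at hxΩ
  obtain ⟨⟨s, hs⟩, hxs⟩ := mem_iUnion.1 hxΩ
  refine ⟨s, hs, ?_⟩
  by_contra hcon
  exact hx s hs ⟨subset_closure hxs, hcon⟩

lemma lsq_le_sum_cell (hT : IsTriangulation Ω T) {F : Type*} [NormedAddCommGroup F]
    (f : Euc n → F) :
    lsq (volume.restrict Ω) f ≤
      ∑ s ∈ hT.finite_facets.toFinset, lsq (volume.restrict (cell s)) f := by
  have h1 : volume.restrict Ω ≤ volume.restrict (⋃ s ∈ hT.finite_facets.toFinset, cell s) := by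
    refine Measure.restrict_mono_ae ?_
    have := ae_imp_of_ae_restrict hT.ae_mem_cell
    filter_upwards [this] with x hx hxΩ
    obtain ⟨s, hs, hxs⟩ := hx hxΩ
    exact mem_biUnion (by simpa using hs) hxs
  refine (lsq_mono_measure h1).trans (le_of_eq (lintegral_biUnion_finset ?_ ?_ _))
  · intro s hs t ht hst
    exact disjoint_cell (by simpa using hs) (by simpa using ht) hst
  · exact fun s _ => (isOpen_cell s).measurableSet

lemma sum_measureReal_cell_le (hT : IsTriangulation Ω T) (μ : Measure (Euc n))
    [IsFiniteMeasure μ] :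
    ∑ s ∈ hT.finite_facets.toFinset, μ.real (cell s) ≤ μ.real univ := by
  rw [← measureReal_biUnion_finset]
  · exact measureReal_mono (subset_univ _)
  · intro s hs t ht hst
    exact disjoint_cell (by simpa using hs) (by simpa using ht) hst
  · exact fun s _ => (isOpen_cell s).measurableSet

end IsTriangulation

end

/-! ### Finite element functions -/

section

variable {Ω : Set (Euc n)} {T : Geometry.SimplicialComplex ℝ (Euc n)}

/-- The gradient of an affine function. -/
def affGrad (q : Euc n →ᵃ[ℝ] ℝ) : Euc n :=
  (InnerProductSpace.toDual ℝ (Euc n)).symm (LinearMap.toContinuousLinearMap q.linear)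

lemma affine_sub (q : Euc n →ᵃ[ℝ] ℝ) (x y : Euc n) : q x - q y = ⟪affGrad q, x - y⟫ := by
  rw [affGrad, InnerProductSpace.toDual_symm_apply, LinearMap.coe_toContinuousLinearMap']
  exact (AffineMap.linearMap_vsub q x y).symm

lemma continuous_affine (q : Euc n →ᵃ[ℝ] ℝ) : Continuous q :=
  AffineMap.continuous_of_finiteDimensional q

lemma abs_affine_sub_le (q : Euc n →ᵃ[ℝ] ℝ) (x y : Euc n) :
    |q x - q y| ≤ ‖affGrad q‖ * dist x y := by
  rw [affine_sub, dist_eq_norm]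
  exact abs_real_inner_le_norm _ _

lemma affine_nonneg_on_hull {q : Euc n →ᵃ[ℝ] ℝ} {s : Set (Euc n)} (h : ∀ x ∈ s, 0 ≤ q x) :
    ∀ x ∈ convexHull ℝ s, 0 ≤ q x :=
  convexHull_min h ((convex_Ici (0 : ℝ)).affine_preimage q)

lemma affine_eq_on_hull {q q' : Euc n →ᵃ[ℝ] ℝ} {s : Set (Euc n)} (h : ∀ x ∈ s, q x = q' x) :
    ∀ x ∈ convexHull ℝ s, q x = q' x := by
  intro x hx
  have h1 : ∀ y ∈ convexHull ℝ s, 0 ≤ (q - q') y :=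
    affine_nonneg_on_hull fun y hy => by simp [h y hy]
  have h2 : ∀ y ∈ convexHull ℝ s, 0 ≤ (q' - q) y :=
    affine_nonneg_on_hull fun y hy => by simp [h y hy]
  have h3 := h1 x hx
  have h4 := h2 x hx
  simp only [AffineMap.coe_sub, Pi.sub_apply] at h3 h4
  linarith

/-- A bound for an affine function on a ball bounds its gradient. -/
lemma norm_grad_le_of_abs_le {f : Euc n → ℝ} {a z : Euc n} {ρ A : ℝ}
    (hf : ∀ x y, f x - f y = ⟪a, x - y⟫) (hρ : 0 < ρ) (h : ∀ x ∈ Metric.ball z ρ, |f x| ≤ A) :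
    ‖a‖ ≤ 4 * A / ρ := by
  rcases eq_or_ne a 0 with h0 | h0
  · have hA := (abs_nonneg _).trans (h z (Metric.mem_ball_self hρ))
    rw [h0, norm_zero]
    positivity
  have ha0 : 0 < ‖a‖ := norm_pos_iff.2 h0
  set w : Euc n := (ρ / 2 / ‖a‖) • a with hw
  have hwn : ‖w‖ = ρ / 2 := by
    rw [hw, norm_smul, Real.norm_of_nonneg (by positivity)]
    field_simp
  have h1 := h (z + w) (by rw [Metric.mem_ball, dist_self_add_left, hwn]; linarith)
  have h2 := h z (Metric.mem_ball_self hρ)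
  have h3 : f (z + w) - f z = ρ / 2 * ‖a‖ := by
    rw [hf, add_sub_cancel_left, hw, inner_smul_right, real_inner_self_eq_norm_sq]
    field_simp
  rw [le_div_iff₀ hρ]
  rw [abs_le] at h1 h2
  linarith

lemma IsTriangulation.exists_affine {s : Finset (Euc n)} (hT : IsTriangulation Ω T)
    (hs : s ∈ T.facets) (U : Euc n → ℝ) : ∃ q : Euc n →ᵃ[ℝ] ℝ, ∀ x ∈ s, q x = U x := by
  classical
  let b : AffineBasis s ℝ (Euc n) :=
    ⟨((↑) : s → Euc n), T.indep hs.1, by simpa using hT.affineSpan_eq_top hs⟩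
  refine ⟨(Fintype.linearCombination ℝ fun i : s => U i).toAffineMap.comp b.coords, fun x hx => ?_⟩
  have h1 : ∀ i : s, b.coord i x = if i = ⟨x, hx⟩ then 1 else 0 := fun i =>
    b.coord_apply i ⟨x, hx⟩
  simp [Fintype.linearCombination_apply, h1]

/-- The piecewise affine function with prescribed values at the vertices. The pieces agree on common
faces because simplices meet in the hull of their common vertices. -/
lemma IsTriangulation.exists_interpolant (hT : IsTriangulation Ω T) (U : Euc n → ℝ) :
    ∃ v ∈ Vh Ω T, ∀ s ∈ T.facets, ∃ q : Euc n →ᵃ[ℝ] ℝ, (∀ x ∈ s, q x = U x) ∧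
      EqOn v q (convexHull ℝ (s : Set (Euc n))) := by
  classical
  choose q hq using fun s : T.facets => hT.exists_affine s.2 U
  set v : Euc n → ℝ := fun x =>
    if h : ∃ s : T.facets, x ∈ convexHull ℝ ((s : Finset (Euc n)) : Set (Euc n)) then
      q h.choose x else 0 with hv
  have hvq : ∀ s : T.facets, EqOn v (q s) (convexHull ℝ ((s : Finset (Euc n)) : Set (Euc n))) := by
    intro s x hx
    have hex : ∃ s : T.facets, x ∈ convexHull ℝ ((s : Finset (Euc n)) : Set (Euc n)) := ⟨s, hx⟩
    simp only [hv]
    rw [dif_pos hex]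
    set t := hex.choose with ht
    have hxt := hex.choose_spec
    have h1 : x ∈ convexHull ℝ (((s : Finset (Euc n)) : Set (Euc n)) ∩ (t : Finset (Euc n))) :=
      T.inter_subset_convexHull s.2.1 t.2.1 ⟨hx, hxt⟩
    exact affine_eq_on_hull (fun y hy => by rw [hq t y hy.2, hq s y hy.1]) x h1
  refine ⟨v, ⟨?_, fun s hs => ⟨q ⟨s, hs⟩, hvq ⟨s, hs⟩⟩⟩, fun s hs =>
    ⟨q ⟨s, hs⟩, hq ⟨s, hs⟩, hvq ⟨s, hs⟩⟩⟩
  have : Finite T.facets := hT.finite_facets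
  rw [hT.closure_eq_iUnion]
  exact (locallyFinite_of_finite _).continuousOn_iUnion (fun s => isClosed_hull _) fun s =>
    (continuous_affine (q s)).continuousOn.congr (hvq s)

/-- A continuous function on `[0, 1]` that is `L`-Lipschitz on each of finitely many closed sets
covering the interval increases by at most `L`. -/
lemma sub_le_of_finite_closed_cover {f : ℝ → ℝ} {ι : Type*} [Finite ι] {F : ι → Set ℝ} {L : ℝ}
    (hf : ContinuousOn f (Icc 0 1)) (hF : ∀ i, IsClosed (F i)) (hcov : Icc 0 1 ⊆ ⋃ i, F i)
    (hL : ∀ i, ∀ t ∈ F i, ∀ t' ∈ F i, |f t - f t'| ≤ L * |t - t'|) : f 1 - f 0 ≤ L := by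
  have h := image_le_of_liminf_slope_right_le_deriv_boundary hf (B := fun t => f 0 + L * t)
    (B' := fun _ => L) (by simp) (by fun_prop)
    (fun x _ => (((hasDerivAt_id x).const_mul L).const_add (f 0)).hasDerivWithinAt.congr_deriv
      (by simp))
    (fun x hx r hr => by
      have h1 : ∃ i, ∃ᶠ z in 𝓝[>] x, z ∈ F i := by
        by_contra! hcon
        have h2 : ∀ᶠ z in 𝓝[>] x, z ∈ Icc (0 : ℝ) 1 := by
          filter_upwards [Ioo_mem_nhdsGT hx.2] with z hz
          exact ⟨hx.1.trans hz.1.le, hz.2.le⟩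
        obtain ⟨z, hz1, hz2⟩ := (h2.and (eventually_all.2 hcon)).exists
        obtain ⟨i, hi⟩ := mem_iUnion.1 (hcov hz1)
        exact hz2 i hi
      obtain ⟨i, hi⟩ := h1
      have hx' : x ∈ F i := by
        rw [← (hF i).closure_eq]
        exact mem_closure_iff_frequently.2 (hi.filter_mono nhdsWithin_le_nhds)
      refine (hi.and_eventually self_mem_nhdsWithin).mono fun z hz => ?_
      have hzx : 0 < z - x := sub_pos.2 hz.2
      refine lt_of_le_of_lt ?_ hr
      rw [slope_def_field, div_le_iff₀ hzx]
      have := hL i z hz.1 x hx'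
      rw [abs_of_pos hzx] at this
      exact (le_abs_self _).trans this)
  have := h (right_mem_Icc.2 zero_le_one)
  simp only [mul_one] at this
  linarith

/-- A finite element function is Lipschitz on convex subsets of the closed domain. -/
lemma IsTriangulation.exists_lipschitzOnWith (hT : IsTriangulation Ω T) {v : Euc n → ℝ}
    (hv : v ∈ Vh Ω T) : ∃ L : ℝ≥0, ∀ B, Convex ℝ B → B ⊆ closure Ω → LipschitzOnWith L v B := by
  have : Finite T.facets := hT.finite_facets
  have := Fintype.ofFinite T.facets
  choose q hq using fun s : T.facets => hv.2 s s.2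
  refine ⟨∑ s, ‖affGrad (q s)‖₊, fun B hB hBΩ => LipschitzOnWith.of_dist_le_mul ?_⟩
  have key : ∀ x ∈ B, ∀ y ∈ B, v y - v x ≤ (∑ s, ‖affGrad (q s)‖) * dist x y := by
    intro x hx y hy
    set γ : ℝ → Euc n := fun t => AffineMap.lineMap x y t with hγ
    have hγc : Continuous γ :=
      AffineMap.continuous_of_finiteDimensional (AffineMap.lineMap x y : ℝ →ᵃ[ℝ] Euc n)
    have hγB : MapsTo γ (Icc 0 1) (closure Ω) := fun t ht =>
      hBΩ (hB.lineMap_mem hx hy ht)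
    have h1 := sub_le_of_finite_closed_cover (f := v ∘ γ)
      (F := fun s : T.facets => γ ⁻¹' convexHull ℝ ((s : Finset (Euc n)) : Set (Euc n)))
      (L := (∑ s, ‖affGrad (q s)‖) * dist x y) (hv.1.comp hγc.continuousOn hγB)
      (fun s => (isClosed_hull _).preimage hγc)
      (fun t ht => by
        have := hγB ht
        rw [hT.closure_eq_iUnion] at this
        obtain ⟨s, hs⟩ := mem_iUnion.1 this
        exact mem_iUnion.2 ⟨s, hs⟩)
      (fun s t ht t' ht' => by
        simp only [Function.comp_apply]
        rw [hq s ht, hq s ht']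
        refine (abs_affine_sub_le _ _ _).trans ?_
        rw [hγ, dist_lineMap_lineMap, Real.dist_eq]
        have h2 : ‖affGrad (q s)‖ ≤ ∑ s, ‖affGrad (q s)‖ :=
          Finset.single_le_sum (f := fun s => ‖affGrad (q s)‖) (fun _ _ => norm_nonneg _)
            (Finset.mem_univ s)
        calc ‖affGrad (q s)‖ * (|t - t'| * dist x y)
            ≤ (∑ s, ‖affGrad (q s)‖) * (|t - t'| * dist x y) := by gcongr
          _ = _ := by ring)
    simpa [hγ] using h1
  intro x hx y hy
  rw [NNReal.coe_sum, Real.dist_eq]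
  simp only [coe_nnnorm]
  refine abs_le.2 ⟨?_, ?_⟩
  · linarith [key x hx y hy]
  · have := key y hy x hx
    rwa [dist_comm] at this

end

section

variable {Ω : Set (Euc n)} {T : Geometry.SimplicialComplex ℝ (Euc n)}

lemma setIntegral_mul_eq_of_tsupport_subset {A : Set (Euc n)} {f ψ : Euc n → ℝ}
    (h : tsupport ψ ⊆ A) : ∫ x in A, f x * ψ x = ∫ x, f x * ψ x := by
  refine setIntegral_eq_integral_of_forall_compl_eq_zero fun x hx => ?_
  rw [image_eq_zero_of_notMem_tsupport (fun hx' => hx (h hx')), mul_zero]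

/-- Weak differentiability is a local property. -/
lemma hasWeakGrad_of_local {v : Euc n → ℝ} {G : Euc n → Euc n} (hv : LocallyIntegrableOn v Ω)
    (hG : LocallyIntegrableOn G Ω)
    (h : ∀ x ∈ Ω, ∃ ρ, 0 < ρ ∧ HasWeakGrad (Metric.ball x ρ) v G) : HasWeakGrad Ω v G := by
  refine ⟨hv, hG, fun φ hφ hc hs w => ?_⟩
  have h' : ∀ x : Euc n, ∃ ρ, x ∈ Ω → 0 < ρ ∧ HasWeakGrad (Metric.ball x ρ) v G := fun x => by
    by_cases hx : x ∈ Ω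
    · obtain ⟨ρ, hρ⟩ := h x hx
      exact ⟨ρ, fun _ => hρ⟩
    · exact ⟨0, fun hx' => absurd hx' hx⟩
  choose ρ hρ using h'
  -- split the test function into pieces supported in the given balls
  obtain ⟨t, χ, htK, hχ, hsupp, hsum⟩ := exists_smooth_partition hc ρ
    fun x hx => (hρ x (hs hx)).1
  set ψ : t → Euc n → ℝ := fun i x => χ i x * φ x with hψ
  have hψd : ∀ i, ContDiff ℝ ∞ (ψ i) := fun i => (hχ i).mul hφ
  have hψc : ∀ i, HasCompactSupport (ψ i) := fun i => hc.mul_left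
  have hψs : ∀ i, tsupport (ψ i) ⊆ Ω := fun i => (tsupport_mul_subset_right).trans hs
  have hψb : ∀ i, tsupport (ψ i) ⊆ Metric.ball (i : Euc n) (ρ i) := fun i =>
    (tsupport_mul_subset_left).trans (hsupp i)
  have hφψ : φ = fun x => ∑ i, ψ i x := by
    funext x
    simp only [hψ, ← Finset.sum_mul]
    by_cases hx : x ∈ tsupport φ
    · rw [hsum x hx, one_mul]
    · rw [image_eq_zero_of_notMem_tsupport hx, mul_zero]
  have hfd : ∀ x, fderiv ℝ φ x w = ∑ i, fderiv ℝ (ψ i) x w := by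
    intro x
    conv_lhs => rw [hφψ]
    rw [fderiv_fun_sum fun i _ => ((hψd i).differentiable (by simp)) x]
    simp
  have hloc : ∀ i, ∫ x in Ω, v x * fderiv ℝ (ψ i) x w = -∫ x in Ω, ⟪G x, w⟫ * ψ i x := by
    intro i
    have h1 := (hρ i (hs (htK i))).2.2.2 (ψ i) (hψd i) (hψc i) (hψb i) w
    have h2 := tsupport_fderiv_apply_subset (f := ψ i) ℝ w
    rw [setIntegral_mul_eq_of_tsupport_subset (h2.trans (hψb i)),
      setIntegral_mul_eq_of_tsupport_subset (hψb i)] at h1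
    rw [setIntegral_mul_eq_of_tsupport_subset (h2.trans (hψs i)),
      setIntegral_mul_eq_of_tsupport_subset (hψs i), h1]
  have i1 : ∀ i, IntegrableOn (fun x => v x * fderiv ℝ (ψ i) x w) Ω := fun i =>
    integrable_mul_of_locallyIntegrableOn hv
      (((hψd i).continuous_fderiv (by simp)).clm_apply continuous_const)
      ((hψc i).fderiv_apply (𝕜 := ℝ) w) ((tsupport_fderiv_apply_subset ℝ w).trans (hψs i))
  have i2 : ∀ i, IntegrableOn (fun x => ⟪G x, w⟫ * ψ i x) Ω := fun i =>
    integrable_mul_of_locallyIntegrableOn (locallyIntegrableOn_inner hG w) (hψd i).continuous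
      (hψc i) (hψs i)
  simp only [hfd, Finset.mul_sum]
  rw [integral_finsetSum _ fun i _ => i1 i, Finset.sum_congr rfl fun i _ => hloc i,
    Finset.sum_neg_distrib, ← integral_finsetSum _ fun i _ => i2 i]
  congr 1
  refine integral_congr_ae (ae_of_all _ fun x => ?_)
  simp only [← Finset.mul_sum]
  rw [hφψ]

/-- A function that is Lipschitz on an open set and has gradient `G x` at almost every point `x` has
weak gradient `G`: extended to a Lipschitz function on the whole space, it can be integrated by parts
against test functions. -/
lemma hasWeakGrad_of_lipschitzOnWith {B : Set (Euc n)} (hB : IsOpen B) {v : Euc n → ℝ}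
    {G : Euc n → Euc n} {L : ℝ≥0} (hv : LipschitzOnWith L v B) (hG : LocallyIntegrableOn G B)
    (hd : ∀ᵐ x ∂volume.restrict B, HasGradientAt v (G x) x) : HasWeakGrad B v G := by
  obtain ⟨f, hf, hfv⟩ := hv.extend_real
  have hloc : LocallyIntegrableOn v B :=
    hv.continuousOn.locallyIntegrableOn hB.measurableSet
  refine ⟨hloc, hG, fun φ hφ hc hs w => ?_⟩
  have hφL : ∃ D, LipschitzWith D φ := by
    obtain ⟨D, hD⟩ := ContDiff.lipschitzWith_of_hasCompactSupport hc hφ (by simp)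
    exact ⟨D, hD⟩
  obtain ⟨D, hD⟩ := hφL
  have h1 := hf.integral_lineDeriv_mul_eq (μ := volume) hD hc w
  have h2 : ∀ x, lineDeriv ℝ φ x (-w) = -fderiv ℝ φ x w := fun x => by
    rw [((hφ.differentiable (by simp)) x).lineDeriv_eq_fderiv, map_neg]
  have h3 : ∫ x, lineDeriv ℝ f x w * φ x = ∫ x in B, ⟪G x, w⟫ * φ x := by
    rw [← setIntegral_mul_eq_of_tsupport_subset hs]
    refine integral_congr_ae ?_
    filter_upwards [hd, ae_restrict_mem hB.measurableSet] with x hx hxB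
    have h4 : f =ᶠ[𝓝 x] v := by
      filter_upwards [hB.mem_nhds hxB] with y hy
      exact (hfv hy).symm
    have h5 := (hx.hasFDerivAt.congr_of_eventuallyEq h4)
    have h6 : lineDeriv ℝ f x w = ⟪G x, w⟫ := by
      rw [(h5.hasLineDerivAt w).lineDeriv]
      simp
    simp only [h6]
  have h7 : ∫ x in B, v x * fderiv ℝ φ x w = ∫ x, f x * fderiv ℝ φ x w := by
    rw [← setIntegral_mul_eq_of_tsupport_subset (A := B)
      ((tsupport_fderiv_apply_subset ℝ w).trans hs)]
    exact setIntegral_congr_fun hB.measurableSet fun x hx => by simp only [hfv hx]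
  rw [h7, ← h3, h1, ← integral_neg]
  refine integral_congr_ae (ae_of_all _ fun x => ?_)
  simp only [h2]
  ring

lemma hasGradientAt_affine (q : Euc n →ᵃ[ℝ] ℝ) (x : Euc n) : HasGradientAt q (affGrad q) x := by
  have h1 : HasGradientAt (fun y : Euc n => q 0 + ⟪affGrad q, y⟫) (affGrad q) x := by
    rw [hasGradientAt_iff_hasFDerivAt]
    exact ((InnerProductSpace.toDual ℝ (Euc n) (affGrad q)).hasFDerivAt).const_add _
  have h2 : (q : Euc n → ℝ) = fun y => q 0 + ⟪affGrad q, y⟫ := by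
    funext y
    have := affine_sub q y 0
    rw [sub_zero] at this
    linarith
  rw [h2]
  exact h1

/-- Finite element functions belong to `H¹(Ω)`, and their weak gradients are the piecewise
gradients. -/
lemma IsTriangulation.exists_hasH1Grad (hT : IsTriangulation Ω T) (hΩ : IsOpen Ω)
    (hb : Bornology.IsBounded Ω) {v : Euc n → ℝ} (hv : v ∈ Vh Ω T) :
    ∃ G, HasH1Grad Ω v G ∧ ∀ s ∈ T.facets, ∀ q : Euc n →ᵃ[ℝ] ℝ,
      EqOn v q (convexHull ℝ (s : Set (Euc n))) → ∀ x ∈ cell s, G x = affGrad q := by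
  have : Finite T.facets := hT.finite_facets
  have := Fintype.ofFinite T.facets
  choose q hq using fun s : T.facets => hv.2 s s.2
  have hgrad : ∀ s ∈ T.facets, ∀ q : Euc n →ᵃ[ℝ] ℝ,
      EqOn v q (convexHull ℝ (s : Set (Euc n))) → ∀ x ∈ cell s, HasGradientAt v (affGrad q) x := by
    intro s hs q hq x hx
    have h1 := (hasGradientAt_affine q x).hasFDerivAt
    refine hasGradientAt_iff_hasFDerivAt.2 (h1.congr_of_eventuallyEq ?_)
    filter_upwards [(isOpen_cell s).mem_nhds hx] with y hy
    exact hq (cell_subset s hy)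
  set G : Euc n → Euc n := fun x =>
    ∑ s : T.facets, (cell (s : Finset (Euc n))).indicator (fun _ => affGrad (q s)) x with hG
  have hGs : ∀ s : T.facets, ∀ x ∈ cell (s : Finset (Euc n)), G x = affGrad (q s) := by
    intro s x hx
    simp only [hG]
    rw [Finset.sum_eq_single s, indicator_of_mem hx]
    · intro t _ hts
      refine indicator_of_notMem (fun hxt => ?_) _
      exact Set.disjoint_left.1 (disjoint_cell t.2 s.2 fun h => hts (Subtype.ext h)) hxt hx
    · exact fun h => absurd (Finset.mem_univ s) h
  have hfin : IsFiniteMeasure (volume.restrict Ω) := ⟨by simpa using hb.measure_lt_top⟩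
  have hGL : MemLp G 2 (volume.restrict Ω) := by
    refine memLp_finsetSum _ fun s _ => ?_
    exact (memLp_const _).indicator (isOpen_cell _).measurableSet
  have hvL : MemLp v 2 (volume.restrict Ω) := by
    have hcp : IsCompact (closure Ω) := hb.isCompact_closure
    obtain ⟨M, hM⟩ := hcp.exists_bound_of_continuousOn hv.1
    refine MemLp.of_bound ((hv.1.mono subset_closure).aestronglyMeasurable hΩ.measurableSet) M ?_
    filter_upwards [ae_restrict_mem hΩ.measurableSet] with x hx
    exact hM x (subset_closure hx)
  obtain ⟨L, hL⟩ := hT.exists_lipschitzOnWith hv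
  refine ⟨G, ⟨hvL, hGL, ?_⟩, fun s hs p hp x hx => ?_⟩
  · refine hasWeakGrad_of_local (locallyIntegrableOn_of_memLp hvL)
      (locallyIntegrableOn_of_memLp hGL) fun x hx => ?_
    obtain ⟨ρ, hρ, hball⟩ := Metric.isOpen_iff.1 hΩ x hx
    refine ⟨ρ, hρ, hasWeakGrad_of_lipschitzOnWith Metric.isOpen_ball
      (hL _ (convex_ball x ρ) (hball.trans subset_closure))
      ((locallyIntegrableOn_of_memLp hGL).mono_set hball) ?_⟩
    filter_upwards [ae_mono (Measure.restrict_mono hball le_rfl) hT.ae_mem_cell] with y hy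
    obtain ⟨s, hs, hys⟩ := hy
    rw [hGs ⟨s, hs⟩ y hys]
    exact hgrad s hs _ (hq ⟨s, hs⟩) y hys
  · rw [hGs ⟨s, hs⟩ x hx]
    exact HasGradientAt.unique (hgrad s hs _ (hq ⟨s, hs⟩) x hx) (hgrad s hs p hp x hx)

end

/-! ### The interpolation error -/

section

variable {Ω D : Set (Euc n)} {u : Euc n → ℝ} {G : Euc n → Euc n} {μ : Measure (Euc n)}
  {C s d : ℝ}

lemma le_ofReal_div_of_mul_le {X V : ℝ≥0∞} {κ Q : ℝ} (hκ : 0 < κ) (hV : ENNReal.ofReal κ ≤ V)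
    (h : X * V ≤ ENNReal.ofReal Q) : X ≤ ENNReal.ofReal (Q / κ) := by
  rw [ENNReal.ofReal_div_of_pos hκ]
  refine (ENNReal.le_div_iff_mul_le (Or.inl (by simpa using hκ)) (Or.inl (by simp))).2 ?_
  exact (mul_le_mul_right hV X).trans h

namespace OscRegular

/-- The error on one convex set of an affine function `q` close to the affine approximation. The
ball in the set bounds the gradient of the difference of the two affine functions by its values. -/
lemma lsq_affine_sub_le (h : OscRegular Ω u G μ C s) (hD : ConvexPiece Ω D d) {κ σ K : ℝ}
    (hκ : 0 < κ) (hvol : κ * d ^ n ≤ volume.real D) (hσ : 0 < σ) {z : Euc n}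
    (hball : Metric.ball z (d / (2 * σ)) ⊆ D) (q : Euc n →ᵃ[ℝ] ℝ)
    (hq : ∀ x ∈ D, |q x - affApprox u G D x| ≤ K * d ^ (1 + s - (n : ℝ) / 2) * √(μ.real D)) :
    lsq (volume.restrict D) (fun x => q x - u x) +
        lsq (volume.restrict D) (fun x => affGrad q - G x) ≤
      ENNReal.ofReal (2 * (d ^ 2 * (K ^ 2 * volume.real (Metric.closedBall (0 : Euc n) 1) +
          4 * 2 ^ n * (C / κ)) +
        (64 * σ ^ 2 * K ^ 2 * volume.real (Metric.closedBall (0 : Euc n) 1) + C / κ)) *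
          (d ^ (2 * s) * μ.real D)) := by
  have := h.finite
  have hd := hD.pos
  obtain ⟨x₀, hx₀⟩ := hD.nonempty
  have hVD := volume_le_of_dist_le hd.le hx₀ hD.dist_le
  set V := volume.real (Metric.closedBall (0 : Euc n) 1) with hV
  have hV0 : 0 ≤ V := measureReal_nonneg
  have hC := h.C_nonneg
  set E := d ^ (2 * s) * μ.real D with hE
  have hE0 : 0 ≤ E := by positivity
  set A := K * d ^ (1 + s - (n : ℝ) / 2) * √(μ.real D) with hA
  have hA2 : A ^ 2 * d ^ n = K ^ 2 * d ^ 2 * E := by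
    have e1 : (d ^ (1 + s - (n : ℝ) / 2)) ^ 2 * d ^ n = d ^ 2 * d ^ (2 * s) := by
      rw [← Real.rpow_natCast (d ^ (1 + s - (n : ℝ) / 2)) 2, ← Real.rpow_mul hd.le,
        ← Real.rpow_natCast d n, ← Real.rpow_natCast d 2, ← Real.rpow_add hd, ← Real.rpow_add hd]
      congr 1
      push_cast
      ring
    rw [hA, mul_pow, mul_pow, Real.sq_sqrt measureReal_nonneg, hE]
    linear_combination K ^ 2 * μ.real D * e1
  set m := ⨍ y in D, G y with hm
  set w : Euc n → ℝ := fun x => u x - ⟪m, x⟫ with hw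
  have hκd : 0 < κ * d ^ n := by positivity
  have hVκ : ENNReal.ofReal (κ * d ^ n) ≤ volume D := by
    rw [← ofReal_measureReal hD.volume_ne_top]
    exact ENNReal.ofReal_le_ofReal hvol
  have hoscG : osc D D G ≤ ENNReal.ofReal (C * d ^ n * E) := by
    refine (h.osc_le D d hD.isOpen hD.convex hD.subset hd hD.dist_le).trans (le_of_eq ?_)
    rw [← ofReal_measureReal (measure_ne_top μ D), ← ENNReal.ofReal_mul (by positivity),
      Real.rpow_add hd, Real.rpow_natCast, hE]
    congr 1
    ring
  -- the gradient and its mean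
  have b1 : lsq (volume.restrict D) (fun x => G x - m) ≤ ENNReal.ofReal (C / κ * E) := by
    have h1 := (lsq_sub_average_le (A := D) hD.volume_ne_zero hD.volume_ne_top
      (integrableOn_of_memLp h.grad.2 hD)).trans hoscG
    refine (le_ofReal_div_of_mul_le hκd hVκ h1).trans (le_of_eq ?_)
    congr 1
    field_simp
  -- the function and its affine approximation
  have hw1 := hasH1Grad_sub_linear h.isBounded h.grad m
  have b2 : lsq (volume.restrict D) (fun x => u x - affApprox u G D x) ≤
      ENNReal.ofReal (d ^ 2 * (4 * 2 ^ n * (C / κ)) * E) := by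
    have h1 := (lsq_sub_average_le (A := D) hD.volume_ne_zero hD.volume_ne_top
      (integrableOn_of_memLp hw1.1 hD)).trans (h.osc_sub_linear_le hD)
    have h2 : 4 * 2 ^ n * ENNReal.ofReal d ^ 2 * osc D D G ≤
        ENNReal.ofReal (4 * 2 ^ n * d ^ 2 * (C * d ^ n * E)) := by
      rw [ENNReal.ofReal_mul (by positivity), ENNReal.ofReal_mul (by positivity),
        ENNReal.ofReal_mul (by positivity), ENNReal.ofReal_pow hd.le,
        ENNReal.ofReal_pow (by norm_num)]
      simp only [ENNReal.ofReal_ofNat]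
      gcongr
    have h3 := le_ofReal_div_of_mul_le hκd hVκ (h1.trans h2)
    have e1 : (fun x => u x - affApprox u G D x) = fun x => w x - ⨍ y in D, w y := by
      funext x
      rw [h.affApprox_eq hD]
      simp only [hw, hm]
      ring
    rw [e1]
    refine h3.trans (le_of_eq ?_)
    congr 1
    field_simp
  -- the difference of the affine functions
  set f : Euc n → ℝ := fun x => q x - affApprox u G D x with hf
  have hfa : ∀ x y, f x - f y = ⟪affGrad q - m, x - y⟫ := by
    intro x y
    have h1 := affine_sub q x y
    simp only [hf]
    rw [h.affApprox_eq hD, h.affApprox_eq hD, inner_sub_left, ← h1, inner_sub_right]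
    ring
  have hA0 : 0 ≤ A := (abs_nonneg _).trans (hq x₀ hx₀)
  have hgrad : ‖affGrad q - m‖ ≤ 8 * σ * A / d := by
    refine (norm_grad_le_of_abs_le hfa (by positivity) fun x hx => hq x (hball hx)).trans
      (le_of_eq ?_)
    field_simp
    ring
  have hcst : ∀ {F : Type} [NormedAddCommGroup F] (g : Euc n → F) (B : ℝ), 0 ≤ B →
      (∀ x ∈ D, ‖g x‖ ≤ B) → lsq (volume.restrict D) g ≤ ENNReal.ofReal (B ^ 2 * d ^ n * V) := by
    intro F _ g B hB hg
    calc lsq (volume.restrict D) g ≤ ∫⁻ _ in D, ENNReal.ofReal (B ^ 2) := by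
          refine setLIntegral_mono' hD.isOpen.measurableSet fun x hx => ?_
          rw [← ofReal_norm, ← ENNReal.ofReal_pow (norm_nonneg _)]
          exact ENNReal.ofReal_le_ofReal (pow_le_pow_left₀ (norm_nonneg _) (hg x hx) 2)
      _ = ENNReal.ofReal (B ^ 2) * volume D := setLIntegral_const _ _
      _ ≤ ENNReal.ofReal (B ^ 2) * ENNReal.ofReal (d ^ n * V) := by gcongr
      _ = _ := by rw [← ENNReal.ofReal_mul (by positivity), mul_assoc]
  have b3 : lsq (volume.restrict D) f ≤ ENNReal.ofReal (d ^ 2 * (K ^ 2 * V) * E) := by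
    refine (hcst f A hA0 fun x hx => hq x hx).trans (le_of_eq ?_)
    rw [hA2]
    congr 1
    ring
  have b4 : lsq (volume.restrict D) (fun _ : Euc n => affGrad q - m) ≤
      ENNReal.ofReal (64 * σ ^ 2 * K ^ 2 * V * E) := by
    refine (hcst (fun _ => affGrad q - m) (8 * σ * A / d) (by positivity)
      fun x _ => hgrad).trans (le_of_eq ?_)
    congr 1
    have : (8 * σ * A / d) ^ 2 * d ^ n = 64 * σ ^ 2 * (A ^ 2 * d ^ n) / d ^ 2 := by
      field_simp
      ring
    rw [this, hA2]
    field_simp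
  have hfc : Continuous f := by
    have : f = fun x => q x - ((⨍ y in D, w y) + ⟪m, x⟫) := by
      funext x
      simp only [hf]
      rw [h.affApprox_eq hD]
    rw [this]
    exact (continuous_affine q).sub (by fun_prop)
  have c1 : lsq (volume.restrict D) (fun x => q x - u x) ≤
      2 * ENNReal.ofReal (d ^ 2 * (K ^ 2 * V) * E) +
        2 * ENNReal.ofReal (d ^ 2 * (4 * 2 ^ n * (C / κ)) * E) := by
    have e1 : (fun x => q x - u x) = f - fun x => u x - affApprox u G D x := by
      funext x
      simp only [hf, Pi.sub_apply]
      ring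
    rw [e1]
    exact (lsq_sub_le hfc.aestronglyMeasurable).trans (by gcongr)
  have c2 : lsq (volume.restrict D) (fun x => affGrad q - G x) ≤
      2 * ENNReal.ofReal (64 * σ ^ 2 * K ^ 2 * V * E) + 2 * ENNReal.ofReal (C / κ * E) := by
    have e1 : (fun x => affGrad q - G x) = (fun _ => affGrad q - m) - fun x => G x - m := by
      funext x
      simp only [Pi.sub_apply]
      abel
    rw [e1]
    exact (lsq_sub_le aestronglyMeasurable_const).trans (by gcongr)
  refine (add_le_add c1 c2).trans (le_of_eq ?_)
  have e2 : ∀ x : ℝ, 2 * ENNReal.ofReal x = ENNReal.ofReal (2 * x) := fun x => by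
    rw [ENNReal.ofReal_mul (by norm_num), ENNReal.ofReal_ofNat]
  simp only [e2]
  rw [← ENNReal.ofReal_add (by positivity) (by positivity),
    ← ENNReal.ofReal_add (by positivity) (by positivity),
    ← ENNReal.ofReal_add (by positivity) (by positivity)]
  congr 1
  ring

/-- A non-negative function with controlled oscillation of its gradient is approximated in `H¹(Ω)` by
non-negative finite element functions: interpolate the point values at the vertices. -/
lemma exists_interpolation_error (h : OscRegular Ω u G μ C s) (hn : 1 ≤ n) (hs : 0 ≤ s)
    {ι : Type*} {τ : ι → Geometry.SimplicialComplex ℝ (Euc n)} (hτ : IsRegularFamily Ω τ)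
    (hu : ∀ᵐ x ∂volume.restrict Ω, 0 ≤ u x) :
    ∃ M : ℝ, 0 ≤ M ∧ ∀ i, ∃ v ∈ KPlush Ω (τ i), ∃ Gv, HasH1Grad Ω v Gv ∧
      energy Ω (v - u) (Gv - G) ≤ ENNReal.ofReal (M * meshSize (τ i) ^ (2 * s)) := by
  have := h.finite
  obtain ⟨hT, σ, hσ, hreg⟩ := hτ
  obtain ⟨U, hU0, hU⟩ := h.exists_pointValues
  set W := volume.real (Metric.ball (0 : Euc n) 1) with hW
  have hW0 : 0 < W := ENNReal.toReal_pos (Metric.measure_ball_pos volume _ one_pos).ne'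
    measure_ball_lt_top.ne
  set κ := W / (2 * σ) ^ n with hκ
  have hκ0 : 0 < κ := by positivity
  obtain ⟨K, hK0, hK⟩ := hU κ hκ0
  set V := volume.real (Metric.closedBall (0 : Euc n) 1) with hV
  have hC := h.C_nonneg
  set R := Metric.diam (closure Ω) with hR
  set M := 2 * (R ^ 2 * (K ^ 2 * V + 4 * 2 ^ n * (C / κ)) +
    (64 * σ ^ 2 * K ^ 2 * V + C / κ)) with hM
  have hM0 : 0 ≤ M := by positivity
  refine ⟨M * μ.real univ, by positivity, fun i => ?_⟩
  have hTi := hT i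
  obtain ⟨v, hv, hvq⟩ := hTi.exists_interpolant U
  obtain ⟨Gv, hGv, hGvq⟩ := hTi.exists_hasH1Grad h.isOpen h.isBounded hv
  refine ⟨v, ⟨hv, fun x hx => ?_⟩, Gv, hGv, ?_⟩
  -- an affine function that is non-negative at the vertices is non-negative on the simplex
  · have hx' := subset_closure hx
    rw [hTi.closure_eq_iUnion] at hx'
    obtain ⟨s, hxs⟩ := mem_iUnion.1 hx'
    obtain ⟨q, hq, hvs⟩ := hvq s s.2
    rw [hvs hxs]
    exact affine_nonneg_on_hull (fun y hy => by rw [hq y hy]; exact hU0 hu y) x hxs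
  · have hcell : ∀ S ∈ hTi.finite_facets.toFinset,
        lsq (volume.restrict (cell S)) (v - u) + lsq (volume.restrict (cell S)) (Gv - G) ≤
          ENNReal.ofReal (M * meshSize (τ i) ^ (2 * s) * μ.real (cell S)) := by
      intro S hS
      rw [Set.Finite.mem_toFinset] at hS
      obtain ⟨q, hq, hvs⟩ := hvq S hS
      set d := Metric.diam (convexHull ℝ (S : Set (Euc n))) with hd
      have hD := hTi.convexPiece_cell h.isOpen h.lipschitz hn hS
      rw [← hd] at hD
      have hd0 := hD.pos
      obtain ⟨z, hz⟩ := hreg i S hS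
      have hball : Metric.ball z (d / (2 * σ)) ⊆ cell S := interior_maximal hz Metric.isOpen_ball
      have hvol : κ * d ^ n ≤ volume.real (cell S) := by
        refine le_trans (le_of_eq ?_) (measureReal_mono hball hD.volume_ne_top)
        rw [Measure.real, Measure.addHaar_ball_of_pos volume z (by positivity),
          finrank_euclideanSpace, Fintype.card_fin, ENNReal.toReal_mul,
          ENNReal.toReal_ofReal (by positivity), hκ, hW, Measure.real, div_pow]
        ring
      have herr : ∀ x ∈ convexHull ℝ (S : Set (Euc n)), |q x - affApprox u G (cell S) x| ≤
          K * d ^ (1 + s - (n : ℝ) / 2) * √(μ.real (cell S)) := by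
        set A := K * d ^ (1 + s - (n : ℝ) / 2) * √(μ.real (cell S)) with hA
        -- the affine approximation as an affine map
        set m := ⨍ y in cell S, G y with hm
        set c := ⨍ x in cell S, (u x - ⟪m, x⟫) with hc
        let p : Euc n →ᵃ[ℝ] ℝ :=
          AffineMap.const ℝ (Euc n) c + (innerSL ℝ m).toLinearMap.toAffineMap
        have hp : ∀ x, p x = affApprox u G (cell S) x := fun x => by
          rw [h.affApprox_eq hD]
          rfl
        -- the difference of two affine functions on a simplex is bounded by its values at the vertices
        have hvert : ∀ x ∈ S, |q x - p x| ≤ A := fun x hx => by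
          rw [hq x hx, hp]
          refine hK _ _ hD hvol x ?_
          rw [hTi.closure_cell hS]
          exact subset_convexHull ℝ _ hx
        have h1 := affine_nonneg_on_hull (q := AffineMap.const ℝ (Euc n) A - (q - p))
          (s := (S : Set (Euc n))) fun x hx => by
            have := (abs_le.1 (hvert x hx)).2
            simpa using this
        have h2 := affine_nonneg_on_hull (q := AffineMap.const ℝ (Euc n) A + (q - p))
          (s := (S : Set (Euc n))) fun x hx => by
            have := (abs_le.1 (hvert x hx)).1
            simp only [AffineMap.coe_add, AffineMap.coe_sub, AffineMap.coe_const, Pi.add_apply,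
              Pi.sub_apply, Function.const_apply]
            linarith
        intro x hx
        have h3 := h1 x hx
        have h4 := h2 x hx
        simp only [AffineMap.coe_add, AffineMap.coe_sub, AffineMap.coe_const, Pi.add_apply,
          Pi.sub_apply, Function.const_apply] at h3 h4
        rw [← hp, abs_le]
        constructor <;> linarith
      have key := h.lsq_affine_sub_le hD hκ0 hvol hσ hball q
        fun x hx => herr x (cell_subset S hx)
      have e1 : lsq (volume.restrict (cell S)) (v - u) =
          lsq (volume.restrict (cell S)) (fun x => q x - u x) :=
        setLIntegral_congr_fun (isOpen_cell S).measurableSet fun x hx => by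
          simp only [Pi.sub_apply, hvs (cell_subset S hx)]
      have e2 : lsq (volume.restrict (cell S)) (Gv - G) =
          lsq (volume.restrict (cell S)) (fun x => affGrad q - G x) :=
        setLIntegral_congr_fun (isOpen_cell S).measurableSet fun x hx => by
          simp only [Pi.sub_apply, hGvq S hS q hvs x hx]
      rw [e1, e2]
      refine key.trans (ENNReal.ofReal_le_ofReal ?_)
      have hdR : d ≤ R := Metric.diam_mono (hTi.hull_subset hS) h.isBounded.closure
      have hdh : d ≤ meshSize (τ i) := hTi.diam_le_meshSize hS
      rw [hM, ← mul_assoc]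
      gcongr
    have hh0 : 0 < meshSize (τ i) ∨ hTi.finite_facets.toFinset = ∅ := by
      rcases Finset.eq_empty_or_nonempty hTi.finite_facets.toFinset with h0 | ⟨S, hS⟩
      · exact Or.inr h0
      · rw [Set.Finite.mem_toFinset] at hS
        exact Or.inl ((hTi.diam_pos hn hS).trans_le (hTi.diam_le_meshSize hS))
    -- the local errors add up because `μ` is a finite measure and the cells are disjoint
    have hsum : ∑ S ∈ hTi.finite_facets.toFinset, μ.real (cell S) ≤ μ.real univ :=
      IsTriangulation.sum_measureReal_cell_le hTi μ
    calc energy Ω (v - u) (Gv - G)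
        ≤ ∑ S ∈ hTi.finite_facets.toFinset, (lsq (volume.restrict (cell S)) (v - u) +
            lsq (volume.restrict (cell S)) (Gv - G)) := by
          rw [Finset.sum_add_distrib]
          exact add_le_add (hTi.lsq_le_sum_cell _) (hTi.lsq_le_sum_cell _)
      _ ≤ ∑ S ∈ hTi.finite_facets.toFinset,
            ENNReal.ofReal (M * meshSize (τ i) ^ (2 * s) * μ.real (cell S)) :=
          Finset.sum_le_sum hcell
      _ ≤ _ := by
          rcases hh0 with hh0 | hh0
          · rw [← ENNReal.ofReal_sum_of_nonneg fun S _ => by positivity, ← Finset.mul_sum]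
            refine ENNReal.ofReal_le_ofReal ?_
            calc _ ≤ M * meshSize (τ i) ^ (2 * s) * μ.real univ := by gcongr
              _ = _ := by ring
          · rw [hh0]
            simp

end OscRegular

end

/-! ### The bilinear form and the load -/

section L2

variable {X F : Type*} [MeasurableSpace X] {μ : Measure X} [NormedAddCommGroup F] {f g : X → F}

lemma toReal_eLpNorm_le {N : ℝ} (hN : 0 ≤ N) (h : lsq μ f ≤ ENNReal.ofReal (N ^ 2)) :
    (eLpNorm f 2 μ).toReal ≤ N := by
  rw [lsq_eq_eLpNorm_sq, ENNReal.ofReal_pow hN] at h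
  exact ENNReal.toReal_le_of_le_ofReal hN ((ENNReal.pow_le_pow_left_iff two_ne_zero).1 h)

lemma integrable_mul_of_memLp {f g : X → ℝ} (hf : MemLp f 2 μ) (hg : MemLp g 2 μ) :
    Integrable (fun x => f x * g x) μ :=
  hf.integrable_mul hg

variable [InnerProductSpace ℝ F]

lemma integrable_inner_of_memLp (hf : MemLp f 2 μ) (hg : MemLp g 2 μ) :
    Integrable (fun x => ⟪f x, g x⟫) μ := by
  refine (L2.integrable_inner (𝕜 := ℝ) hf.toLp hg.toLp).congr ?_
  filter_upwards [hf.coeFn_toLp, hg.coeFn_toLp] with x h1 h2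
  rw [h1, h2]

lemma abs_integral_inner_le (hf : MemLp f 2 μ) (hg : MemLp g 2 μ) :
    |∫ x, ⟪f x, g x⟫ ∂μ| ≤ (eLpNorm f 2 μ).toReal * (eLpNorm g 2 μ).toReal := by
  have h1 := abs_real_inner_le_norm hf.toLp hg.toLp
  rw [L2.inner_def, Lp.norm_toLp, Lp.norm_toLp] at h1
  convert h1 using 2
  refine integral_congr_ae ?_
  filter_upwards [hf.coeFn_toLp, hg.coeFn_toLp] with x h1 h2
  rw [h1, h2]

end L2

section forms

variable {Ω Γ Γ₁ Γ₂ : Set (Euc n)} {u v w : Euc n → ℝ} {α b : ℝ} {q g : Euc n → ℝ}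

namespace MemH1

lemma hasH1Grad_weakGrad (hΩ : IsOpen Ω) (h : MemH1 Ω u) : HasH1Grad Ω u (weakGrad Ω u) := by
  obtain ⟨G, hG⟩ := memH1_iff.1 h
  exact hG.weakGrad hΩ

lemma sub (h : MemH1 Ω u) (h' : MemH1 Ω v) : MemH1 Ω (u - v) := by
  obtain ⟨G, hG⟩ := memH1_iff.1 h
  obtain ⟨G', hG'⟩ := memH1_iff.1 h'
  exact (hG.sub hG').memH1

lemma weakGrad_sub_ae (hΩ : IsOpen Ω) (h : MemH1 Ω u) (h' : MemH1 Ω v) :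
    weakGrad Ω (u - v) =ᵐ[volume.restrict Ω] weakGrad Ω u - weakGrad Ω v :=
  ((h.hasH1Grad_weakGrad hΩ).sub (h'.hasH1Grad_weakGrad hΩ)).weakGrad_ae hΩ

lemma norm_le (hΩ : IsOpen Ω) (h : MemH1 Ω u) :
    (eLpNorm u 2 (volume.restrict Ω)).toReal ≤ h1Norm Ω u := by
  refine toReal_eLpNorm_le h1Norm_nonneg ?_
  rw [(h.hasH1Grad_weakGrad hΩ).ofReal_h1Norm_sq hΩ]
  exact le_self_add

lemma norm_weakGrad_le (hΩ : IsOpen Ω) (h : MemH1 Ω u) :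
    (eLpNorm (weakGrad Ω u) 2 (volume.restrict Ω)).toReal ≤ h1Norm Ω u := by
  refine toReal_eLpNorm_le h1Norm_nonneg ?_
  rw [(h.hasH1Grad_weakGrad hΩ).ofReal_h1Norm_sq hΩ]
  exact le_add_self

end MemH1

namespace IsPolygonalDomain

lemma isTrace (hΩ : IsPolygonalDomain Ω) (h : MemH1 Ω u) : IsTrace Ω u (trace Ω u) :=
  isTrace_trace hΩ.isOpen hΩ.isBounded hΩ.lipschitz h

lemma memLp_trace (hΩ : IsPolygonalDomain Ω) (hΓ : Γ ⊆ frontier Ω) (h : MemH1 Ω u) :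
    MemLp (trace Ω u) 2 (surf Γ) :=
  (hΩ.isTrace h).2.1.mono_measure (surf_mono hΓ)

lemma trace_sub_ae (hΩ : IsPolygonalDomain Ω) (hΓ : Γ ⊆ frontier Ω) (h : MemH1 Ω u)
    (h' : MemH1 Ω v) : trace Ω (u - v) =ᵐ[surf Γ] trace Ω u - trace Ω v :=
  ae_mono (surf_mono hΓ)
    (ObstacleFEM.trace_sub_ae hΩ.isOpen hΩ.isBounded hΩ.lipschitz h h')

lemma exists_norm_trace_le (hΩ : IsPolygonalDomain Ω) :
    ∃ C : ℝ, 0 ≤ C ∧ ∀ Γ ⊆ frontier Ω, ∀ u, MemH1 Ω u →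
      (eLpNorm (trace Ω u) 2 (surf Γ)).toReal ≤ C * h1Norm Ω u := by
  obtain ⟨C, hC, h⟩ := exists_isTrace_le hΩ.isOpen hΩ.isBounded hΩ.lipschitz
  refine ⟨√C.toReal, Real.sqrt_nonneg _, fun Γ hΓ u hu => ?_⟩
  refine toReal_eLpNorm_le (mul_nonneg (Real.sqrt_nonneg _) h1Norm_nonneg) ?_
  have hG := hu.hasH1Grad_weakGrad hΩ.isOpen
  rw [mul_pow, Real.sq_sqrt ENNReal.toReal_nonneg, ENNReal.ofReal_mul ENNReal.toReal_nonneg,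
    ENNReal.ofReal_toReal hC, hG.ofReal_h1Norm_sq hΩ.isOpen]
  exact (lsq_mono_measure (surf_mono hΓ)).trans (h _ _ _ hG (hΩ.isTrace hu))

lemma aForm_comm (u v : Euc n → ℝ) : aForm Ω Γ₁ α u v = aForm Ω Γ₁ α v u := by
  simp only [aForm, mul_comm (trace Ω u _), real_inner_comm]

lemma aForm_sub (hΩ : IsPolygonalDomain Ω) (hΓ₁ : Γ₁ ⊆ frontier Ω) (hu : MemH1 Ω u)
    (hv : MemH1 Ω v) (hw : MemH1 Ω w) :
    aForm Ω Γ₁ α u (v - w) = aForm Ω Γ₁ α u v - aForm Ω Γ₁ α u w := by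
  have gu := (hu.hasH1Grad_weakGrad hΩ.isOpen).2
  have gv := (hv.hasH1Grad_weakGrad hΩ.isOpen).2
  have gw := (hw.hasH1Grad_weakGrad hΩ.isOpen).2
  have tu := hΩ.memLp_trace hΓ₁ hu
  have tv := hΩ.memLp_trace hΓ₁ hv
  have tw := hΩ.memLp_trace hΓ₁ hw
  have e1 : ∫ x in Ω, ⟪weakGrad Ω u x, weakGrad Ω (v - w) x⟫ =
      (∫ x in Ω, ⟪weakGrad Ω u x, weakGrad Ω v x⟫) -
        ∫ x in Ω, ⟪weakGrad Ω u x, weakGrad Ω w x⟫ := by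
    rw [← integral_sub (integrable_inner_of_memLp gu gv) (integrable_inner_of_memLp gu gw)]
    refine integral_congr_ae ?_
    filter_upwards [hv.weakGrad_sub_ae hΩ.isOpen hw] with x hx
    rw [hx, Pi.sub_apply, inner_sub_right]
  have e2 : ∫ x, trace Ω u x * trace Ω (v - w) x ∂surf Γ₁ =
      (∫ x, trace Ω u x * trace Ω v x ∂surf Γ₁) - ∫ x, trace Ω u x * trace Ω w x ∂surf Γ₁ := by
    rw [← integral_sub (integrable_mul_of_memLp tu tv) (integrable_mul_of_memLp tu tw)]
    refine integral_congr_ae ?_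
    filter_upwards [hΩ.trace_sub_ae hΓ₁ hv hw] with x hx
    rw [hx, Pi.sub_apply, mul_sub]
  rw [aForm, e1, e2, aForm, aForm]
  ring

lemma exists_abs_aForm_le (hΩ : IsPolygonalDomain Ω) (hΓ₁ : Γ₁ ⊆ frontier Ω) (α : ℝ) :
    ∃ C : ℝ, 0 ≤ C ∧ ∀ u v, MemH1 Ω u → MemH1 Ω v →
      |aForm Ω Γ₁ α u v| ≤ C * h1Norm Ω u * h1Norm Ω v := by
  obtain ⟨C, hC, ht⟩ := hΩ.exists_norm_trace_le
  refine ⟨1 + |α| * (C * C), by positivity, fun u v hu hv => ?_⟩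
  have h1 := (abs_integral_inner_le (hu.hasH1Grad_weakGrad hΩ.isOpen).2
    (hv.hasH1Grad_weakGrad hΩ.isOpen).2).trans (mul_le_mul (hu.norm_weakGrad_le hΩ.isOpen)
      (hv.norm_weakGrad_le hΩ.isOpen) ENNReal.toReal_nonneg h1Norm_nonneg)
  have h2 := (abs_integral_inner_le (hΩ.memLp_trace hΓ₁ hv) (hΩ.memLp_trace hΓ₁ hu)).trans
    (mul_le_mul (ht _ hΓ₁ v hv) (ht _ hΓ₁ u hu) ENNReal.toReal_nonneg
      (mul_nonneg hC h1Norm_nonneg))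
  have h3 : ∫ x, trace Ω u x * trace Ω v x ∂surf Γ₁ = ∫ x, ⟪trace Ω v x, trace Ω u x⟫ ∂surf Γ₁ :=
    rfl
  rw [aForm, h3]
  refine (abs_add_le _ _).trans ?_
  rw [abs_mul]
  have h4 := mul_le_mul_of_nonneg_left h2 (abs_nonneg α)
  linarith

lemma load_sub (hΩ : IsPolygonalDomain Ω) (hΓ₁ : Γ₁ ⊆ frontier Ω) (hΓ₂ : Γ₂ ⊆ frontier Ω)
    (hq : MemLp q 2 (surf Γ₂)) (hg : MemLp g 2 (volume.restrict Ω)) (hv : MemH1 Ω v)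
    (hw : MemH1 Ω w) :
    load Ω Γ₁ Γ₂ α b q g (v - w) = load Ω Γ₁ Γ₂ α b q g v - load Ω Γ₁ Γ₂ α b q g w := by
  have : IsFiniteMeasure (surf Γ₁) := ⟨(surf_mono hΓ₁ univ).trans_lt
    (surf_frontier_lt_top hΩ.isOpen hΩ.isBounded hΩ.lipschitz)⟩
  have hb : MemLp (fun _ : Euc n => b) 2 (surf Γ₁) := memLp_const b
  have e1 : ∫ x in Ω, g x * (v - w) x = (∫ x in Ω, g x * v x) - ∫ x in Ω, g x * w x := by
    rw [← integral_sub (integrable_mul_of_memLp hg hv.1) (integrable_mul_of_memLp hg hw.1)]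
    simp only [Pi.sub_apply, mul_sub]
  have e2 : ∀ {Γ : Set (Euc n)} {f : Euc n → ℝ}, Γ ⊆ frontier Ω → MemLp f 2 (surf Γ) →
      ∫ x, f x * trace Ω (v - w) x ∂surf Γ =
        (∫ x, f x * trace Ω v x ∂surf Γ) - ∫ x, f x * trace Ω w x ∂surf Γ := by
    intro Γ f hΓ hf
    rw [← integral_sub (integrable_mul_of_memLp hf (hΩ.memLp_trace hΓ hv))
      (integrable_mul_of_memLp hf (hΩ.memLp_trace hΓ hw))]
    refine integral_congr_ae ?_
    filter_upwards [hΩ.trace_sub_ae hΓ hv hw] with x hx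
    rw [hx, Pi.sub_apply, mul_sub]
  rw [load, e1, e2 hΓ₂ hq, e2 hΓ₁ hb, load, load]
  ring

lemma exists_abs_load_le (hΩ : IsPolygonalDomain Ω) (hΓ₁ : Γ₁ ⊆ frontier Ω)
    (hΓ₂ : Γ₂ ⊆ frontier Ω) (hq : MemLp q 2 (surf Γ₂)) (hg : MemLp g 2 (volume.restrict Ω))
    (α b : ℝ) :
    ∃ C : ℝ, 0 ≤ C ∧ ∀ v, MemH1 Ω v → |load Ω Γ₁ Γ₂ α b q g v| ≤ C * h1Norm Ω v := by
  have : IsFiniteMeasure (surf Γ₁) := ⟨(surf_mono hΓ₁ univ).trans_lt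
    (surf_frontier_lt_top hΩ.isOpen hΩ.isBounded hΩ.lipschitz)⟩
  have hb : MemLp (fun _ : Euc n => b) 2 (surf Γ₁) := memLp_const b
  obtain ⟨C, hC, ht⟩ := hΩ.exists_norm_trace_le
  have key : ∀ {Γ : Set (Euc n)} {f : Euc n → ℝ}, Γ ⊆ frontier Ω → MemLp f 2 (surf Γ) →
      ∀ v, MemH1 Ω v → |∫ x, f x * trace Ω v x ∂surf Γ| ≤
        C * h1Norm Ω v * (eLpNorm f 2 (surf Γ)).toReal := fun {Γ f} hΓ hf v hv =>
    (abs_integral_inner_le (hΩ.memLp_trace hΓ hv) hf).trans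
      (mul_le_mul_of_nonneg_right (ht _ hΓ v hv) ENNReal.toReal_nonneg)
  refine ⟨(eLpNorm g 2 (volume.restrict Ω)).toReal + C * (eLpNorm q 2 (surf Γ₂)).toReal +
    |α| * (C * (eLpNorm (fun _ : Euc n => b) 2 (surf Γ₁)).toReal), by positivity, fun v hv => ?_⟩
  have h1 : |∫ x in Ω, g x * v x| ≤ h1Norm Ω v * (eLpNorm g 2 (volume.restrict Ω)).toReal :=
    (abs_integral_inner_le hv.1 hg).trans
      (mul_le_mul_of_nonneg_right (hv.norm_le hΩ.isOpen) ENNReal.toReal_nonneg)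
  have h2 := key hΓ₂ hq v hv
  have h3 := mul_le_mul_of_nonneg_left (key hΓ₁ hb v hv) (abs_nonneg α)
  rw [load]
  refine (abs_add_le _ _).trans ?_
  rw [abs_mul]
  have h4 := abs_sub (∫ x in Ω, g x * v x) (∫ x, q x * trace Ω v x ∂surf Γ₂)
  linarith

/-- The bilinear form is coercive, since the boundary part has positive measure. -/
lemma exists_coercive (hΩ : IsPolygonalDomain Ω) (hn : 1 ≤ n) (hΓ₁ : Γ₁ ⊆ frontier Ω)
    (hpos : 0 < surf Γ₁ univ) (hα : 0 < α) :
    ∃ c : ℝ, 0 < c ∧ ∀ v, MemH1 Ω v → c * h1Norm Ω v ^ 2 ≤ aForm Ω Γ₁ α v v := by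
  obtain ⟨T, hT⟩ := hΩ.polygonal
  have : Finite T.facets := hT.finite_facets
  have := Fintype.ofFinite T.facets
  have hcell := fun s : T.facets => hT.convexPiece_cell hΩ.isOpen hΩ.lipschitz hn s.2
  have hlink := linked_self_of_tiling hΩ.isOpen hΩ.isConnected.isPreconnected
    (fun s => (hcell s).isOpen) (fun s => (hcell s).convex) (fun s => (hcell s).isBounded)
    (fun s => (hcell s).nonempty) (fun s => (hcell s).subset) (by
      refine subset_closure.trans (hT.closure_eq_iUnion.subset.trans ?_)
      exact iUnion_mono fun s => (hT.closure_cell s.2).superset)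
  obtain ⟨C, hC, h⟩ := exists_energy_le_of_trace hΩ.isOpen hΩ.isBounded hΩ.lipschitz hlink hΓ₁ hpos
  have hm : 0 < min 1 α := lt_min one_pos hα
  refine ⟨min 1 α / (C.toReal + 1), by positivity, fun v hv => ?_⟩
  have hG := hv.hasH1Grad_weakGrad hΩ.isOpen
  have ht := hΩ.memLp_trace hΓ₁ hv
  have h1 := h _ _ _ hG (hΩ.isTrace hv)
  have h2 := ENNReal.toReal_mono (ENNReal.mul_ne_top hC
    (ENNReal.add_ne_top.2 ⟨(lsq_lt_top hG.2).ne, (lsq_lt_top ht).ne⟩)) h1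
  rw [← hG.h1Norm_sq hΩ.isOpen, ENNReal.toReal_mul,
    ENNReal.toReal_add (lsq_lt_top hG.2).ne (lsq_lt_top ht).ne, ← integral_norm_sq hG.2,
    ← integral_norm_sq ht] at h2
  have e1 : aForm Ω Γ₁ α v v = (∫ x in Ω, ‖weakGrad Ω v x‖ ^ 2) +
      α * ∫ x, ‖trace Ω v x‖ ^ 2 ∂surf Γ₁ := by
    simp only [aForm, real_inner_self_eq_norm_sq, Real.norm_eq_abs, sq_abs, ← pow_two]
  rw [e1]
  set A := ∫ x in Ω, ‖weakGrad Ω v x‖ ^ 2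
  set B := ∫ x, ‖trace Ω v x‖ ^ 2 ∂surf Γ₁
  have hA : 0 ≤ A := integral_nonneg fun x => by positivity
  have hB : 0 ≤ B := integral_nonneg fun x => by positivity
  have hC0 : 0 ≤ C.toReal := ENNReal.toReal_nonneg
  rw [div_mul_eq_mul_div, div_le_iff₀ (by positivity)]
  have h3 : h1Norm Ω v ^ 2 ≤ (A + B) * (C.toReal + 1) := by nlinarith
  have h4 : min 1 α * (A + B) ≤ A + α * B := by
    have := mul_le_mul_of_nonneg_right (min_le_left 1 α) hA
    have := mul_le_mul_of_nonneg_right (min_le_right 1 α) hB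
    linarith
  calc min 1 α * h1Norm Ω v ^ 2 ≤ min 1 α * ((A + B) * (C.toReal + 1)) := by gcongr
    _ = min 1 α * (A + B) * (C.toReal + 1) := by ring
    _ ≤ _ := by gcongr

/-- Falk's estimate: the squared error of a conforming approximation of the variational inequality
is bounded by the distance from the solution to the discrete convex set. The exponent on the right is
only `1`, because the solution satisfies an inequality and not an equation. -/
lemma exists_error_le (hΩ : IsPolygonalDomain Ω) (hn : 1 ≤ n) (hΓ₁ : Γ₁ ⊆ frontier Ω)
    (hΓ₂ : Γ₂ ⊆ frontier Ω) (hpos : 0 < surf Γ₁ univ) (hα : 0 < α) (hq : MemLp q 2 (surf Γ₂))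
    (hg : MemLp g 2 (volume.restrict Ω)) (hu : SolvesVI Ω Γ₁ Γ₂ α b q g (KPlus Ω) u) :
    ∃ C : ℝ, 0 ≤ C ∧ ∀ (K : Set (Euc n → ℝ)) (uh : Euc n → ℝ), K ⊆ KPlus Ω → 0 ∈ K →
      SolvesVI Ω Γ₁ Γ₂ α b q g K uh → ∀ v ∈ K,
        h1Norm Ω (uh - u) ^ 2 ≤ C * h1Norm Ω (v - u) := by
  obtain ⟨c, hc, hcoer⟩ := hΩ.exists_coercive hn hΓ₁ hpos hα
  obtain ⟨Ca, hCa, ha⟩ := hΩ.exists_abs_aForm_le hΓ₁ α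
  obtain ⟨Cl, hCl, hl⟩ := hΩ.exists_abs_load_le hΓ₁ hΓ₂ hq hg α b
  refine ⟨(Ca * (Cl / c) + Cl) / c, by positivity, fun K uh hK h0 huh v hv => ?_⟩
  have mu : MemH1 Ω u := hu.1.1
  have muh : MemH1 Ω uh := (hK huh.1).1
  have mv : MemH1 Ω v := (hK hv).1
  have m0 : MemH1 Ω (0 : Euc n → ℝ) := (hK h0).1
  -- stability: test the discrete inequality with zero
  have hstab : h1Norm Ω uh ≤ Cl / c := by
    have h1 := huh.2 0 h0
    have a0 : aForm Ω Γ₁ α uh 0 = 0 := by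
      have := hΩ.aForm_sub (α := α) hΓ₁ muh m0 m0
      rwa [sub_zero, sub_self] at this
    have l0 : load Ω Γ₁ Γ₂ α b q g 0 = 0 := by
      have := hΩ.load_sub (α := α) (b := b) hΓ₁ hΓ₂ hq hg m0 m0
      rwa [sub_zero, sub_self] at this
    rw [hΩ.aForm_sub hΓ₁ muh m0 muh, hΩ.load_sub hΓ₁ hΓ₂ hq hg m0 muh, a0, l0] at h1
    have h2 := hcoer uh muh
    have h3 := (le_abs_self _).trans (hl uh muh)
    have hN : 0 ≤ h1Norm Ω uh := h1Norm_nonneg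
    rw [le_div_iff₀ hc]
    rcases hN.eq_or_lt with h0 | h0
    · rw [← h0, zero_mul]; exact hCl
    · have : c * h1Norm Ω uh * h1Norm Ω uh ≤ Cl * h1Norm Ω uh := by nlinarith
      have := le_of_mul_le_mul_right this h0
      linarith
  -- test the continuous inequality with `uh` and the discrete one with `v`, and add
  have h1 := hu.2 uh (hK huh.1)
  have h2 := huh.2 v hv
  rw [hΩ.aForm_sub hΓ₁ mu muh mu, hΩ.load_sub hΓ₁ hΓ₂ hq hg muh mu] at h1
  rw [hΩ.aForm_sub hΓ₁ muh mv muh, hΩ.load_sub hΓ₁ hΓ₂ hq hg mv muh] at h2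
  have h3 := hcoer (uh - u) (muh.sub mu)
  rw [hΩ.aForm_sub hΓ₁ (muh.sub mu) muh mu, aForm_comm (uh - u) uh, aForm_comm (uh - u) u,
    hΩ.aForm_sub hΓ₁ muh muh mu, hΩ.aForm_sub hΓ₁ mu muh mu] at h3
  have h4 := (le_abs_self _).trans (ha uh (v - u) muh (mv.sub mu))
  rw [hΩ.aForm_sub hΓ₁ muh mv mu] at h4
  have h5 := (neg_le_abs _).trans (hl (v - u) (mv.sub mu))
  rw [hΩ.load_sub hΓ₁ hΓ₂ hq hg mv mu] at h5
  have hN : 0 ≤ h1Norm Ω (v - u) := h1Norm_nonneg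
  have h6 : Ca * h1Norm Ω uh * h1Norm Ω (v - u) ≤ Ca * (Cl / c) * h1Norm Ω (v - u) := by gcongr
  rw [div_mul_eq_mul_div, le_div_iff₀ hc]
  linarith

end IsPolygonalDomain

end forms

/-! ### The rate of convergence -/

lemma kPlush_subset_kPlus {Ω : Set (Euc n)} (hΩ : IsPolygonalDomain Ω)
    {T : Geometry.SimplicialComplex ℝ (Euc n)} (hT : IsTriangulation Ω T) :
    KPlush Ω T ⊆ KPlus Ω := by
  intro v hv
  obtain ⟨G, hG, -⟩ := hT.exists_hasH1Grad hΩ.isOpen hΩ.isBounded hv.1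
  exact ⟨hG.memH1, (ae_restrict_mem hΩ.isOpen.measurableSet).mono hv.2⟩

lemma zero_mem_kPlush (Ω : Set (Euc n)) (T : Geometry.SimplicialComplex ℝ (Euc n)) :
    (0 : Euc n → ℝ) ∈ KPlush Ω T :=
  ⟨⟨continuousOn_const, fun _ _ => ⟨AffineMap.const ℝ (Euc n) 0, fun _ _ => rfl⟩⟩, fun _ _ => le_rfl⟩

end ObstacleFEM

end

open ObstacleFEM in
theorem lemma2p2 {n : ℕ} (hn : 1 ≤ n) {Ω Γ₁ Γ₂ : Set (Euc n)} (hΩ : IsPolygonalDomain Ω)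
    (hΓ₁ : MeasurableSet Γ₁) (hΓ₂ : MeasurableSet Γ₂) (hΓ : Γ₁ ∪ Γ₂ = frontier Ω)
    (hdisj : Disjoint Γ₁ Γ₂) (hpos : 0 < surf Γ₁ univ)
    {ι : Type*} {τ : ι → Geometry.SimplicialComplex ℝ (Euc n)} (hτ : IsRegularFamily Ω τ)
    {b : ℝ} (hb : 0 < b) {q : Euc n → ℝ} (hq : MemLp q 2 (surf Γ₂))
    {g : Euc n → ℝ} (hg : MemLp g 2 (volume.restrict Ω))
    {r : ℝ} (hr₁ : 1 < r) (hr₂ : r ≤ 2) (hrn : (n : ℝ) / 2 < r)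
    {α : ℝ} (hα : 0 < α) {u : Euc n → ℝ}
    (hu : SolvesVI Ω Γ₁ Γ₂ α b q g (KPlus Ω) u) (hur : MemHr Ω r u) :
    ∃ C : ℝ, 0 < C ∧ ∀ (i : ι) (uh : Euc n → ℝ),
      SolvesVI Ω Γ₁ Γ₂ α b q g (KPlush Ω (τ i)) uh →
        h1Norm Ω (uh - u) ≤ C * meshSize (τ i) ^ ((r - 1) / 2) := by
  -- `B` comes from the variational inequalities and `M` from the interpolation error; adding `1` to
  -- the constant makes it positive
  have hs : 0 < r - 1 := by linarith
  obtain ⟨B, hB, herr⟩ := hΩ.exists_error_le hn (hΓ ▸ subset_union_left)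
    (hΓ ▸ subset_union_right) hpos hα hq hg hu
  obtain ⟨G, μ, C, hosc⟩ := exists_oscRegular hΩ.isOpen hΩ.isBounded hΩ.lipschitz hr₁ hr₂ hrn hur
  obtain ⟨M, hM, hint⟩ := hosc.exists_interpolation_error hn hs.le hτ hu.1.2
  refine ⟨√(B * √M) + 1, by positivity, fun i uh huh => ?_⟩
  obtain ⟨v, hv, Gv, hGv, hle⟩ := hint i
  have hh : 0 < meshSize (τ i) := (hτ.1 i).meshSize_pos hn hΩ.isConnected.nonempty
  set h := meshSize (τ i)
  have h1 : h1Norm Ω (v - u) ≤ √M * h ^ (r - 1) := by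
    have h2 : ENNReal.ofReal (h1Norm Ω (v - u) ^ 2) ≤ ENNReal.ofReal (M * h ^ (2 * (r - 1))) := by
      rw [(hGv.sub hosc.grad).ofReal_h1Norm_sq hΩ.isOpen]
      exact hle
    rw [ENNReal.ofReal_le_ofReal_iff (by positivity)] at h2
    have e1 : M * h ^ (2 * (r - 1)) = (√M * h ^ (r - 1)) ^ 2 := by
      rw [mul_pow, Real.sq_sqrt hM, ← Real.rpow_natCast (h ^ (r - 1)), ← Real.rpow_mul hh.le]
      congr 2
      push_cast
      ring
    rw [e1] at h2
    exact (sq_le_sq₀ h1Norm_nonneg (by positivity)).1 h2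
  -- the squared error is linear in the interpolation error, so the rate is halved
  have h3 : h1Norm Ω (uh - u) ^ 2 ≤ (√(B * √M) * h ^ ((r - 1) / 2)) ^ 2 := by
    refine (herr _ uh (kPlush_subset_kPlus hΩ (hτ.1 i)) (zero_mem_kPlush Ω (τ i)) huh v hv).trans ?_
    have e2 : (√(B * √M) * h ^ ((r - 1) / 2)) ^ 2 = B * (√M * h ^ (r - 1)) := by
      rw [mul_pow, Real.sq_sqrt (by positivity), ← Real.rpow_natCast (h ^ ((r - 1) / 2)),
        ← Real.rpow_mul hh.le, Nat.cast_ofNat, div_mul_cancel₀ _ (two_ne_zero)]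
      ring
    rw [e2]
    gcongr
  refine ((sq_le_sq₀ h1Norm_nonneg (by positivity)).1 h3).trans ?_
  gcongr
  linarith
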